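/- Consider the real discrete-time plant $x(k+1)=Ax(k)+Bu(k)$, $y(k)=Cx(k)$ with $x\in\mathbb R^{n}$, $u\in\mathbb R^{m}$, $y\in\mathbb R^{p}$, the reference system $x_d(k+1)=Sx_d(k)$, $y_d(k)=Rx_d(k)$ with $x_d\in\mathbb R^{q}$, and the tracking error $y_e=y-y_d$. Assume: (1) $(A,B)$ is controllable and $(A,C)$ is observable; (2) all eigenvalues of $S$ lie on or outside the unit circle; (3) (using the minimal polynomial of $S$) $(F,G)$ is a $p$-copy internal model of $S$, i.e. $F=\mathrm{diag}(\beta_1,\dots,\beta_p)$, $G=\mathrm{diag}(\sigma_1,\dots,\sigma_p)$ with $\beta_i\in\mathbb R^{d\times d}$, $\sigma_i\in\mathbb R^{d}$, each $(\beta_i,\sigma_i)$ controllable, the minimal polynomial of $S$ dividing the characteristic polynomial of $\beta_i$, and every eigenvalue of $\beta_i$ being an eigenvalue of $S$; (4) $\mathrm{rank}\begin{bmatrix}A-\lambda I&B\\ C&0\end{bmatrix}=n+p$ for every eigenvalue $\lambda$ of $S$. Let $p\ge m$, let $T$ be such that $(F,T)$ is observable, and let $Q>0$, $\bar R>0$.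 Put $n_z=n+dp$, $\underline A=\begin{bmatrix}A&-BT\\-GC&F\end{bmatrix}$, $\bar B=\begin{bmatrix}B\\0\end{bmatrix}$, $\bar G=\begin{bmatrix}0\\G\end{bmatrix}$, $\bar C=[C,\,0]$, $\bar z(k+1)=F\bar z(k)-Gy(k)+G\vartheta(k)$ and $r=[x^T,\bar z^T]^T$. The plant input is $\bar u(k)-T\bar z(k)$, so that $r(k+1)=\underline Ar(k)+\bar B\bar u(k)+\bar G\vartheta(k)$. Let $A_\zeta\in\mathbb R^{n_z\times n_z}$ be a Schur companion matrix, $b=[0,\dots,0,1]^T$, and let $\bar\zeta=[\zeta_{\bar u}^T,\zeta_y^T,\zeta_\vartheta^T]^T$ be generated by $\zeta_v(k+1)=(I\otimes A_\zeta)\zeta_v(k)+v(k)\otimes b$ for $v=\bar u,y,\vartheta$. Problem 1: find $\bar K$ such that for $e(k+1)=\underline Ae(k)+\bar Bu_e(k)$, $y_e=\bar Ce$, the feedback $u_e=-\bar Ke$ drives $e$ to zero and minimizes $\sum_{i\ge k}(y_e^TQy_e+u_e^T\bar Ru_e)$ over all input sequences. Then the following hold. (a) The algebraic Riccati equation $\underline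 A^TP\bar B(\bar R+\bar B^TP\bar B)^{-1}\bar B^TP\underline A=\bar C^TQ\bar C+\underline A^TP\underline A-P$ has exactly one positive semidefinite solution $P^*$, and $\bar K^*=(\bar R+\bar B^TP^*\bar B)^{-1}\bar B^TP^*\underline A$ is the unique solution of Problem 1. (b) There is $\bar L$ such that $\underline A-\bar L\bar C$ and $A_\zeta$ have the same characteristic polynomial. Fix any such $\bar L$, and let $\bar M=[M_u,M_y,M_\vartheta]$ be the parameterization matrix, whose blocks consist of the coefficients of the polynomial matrices $\mathrm{adj}(zI-\underline A+\bar L\bar C)W$, $W=\bar B,\bar L,\bar G$. Then $r(k)=\bar M\bar\zeta(k)+(\underline A-\bar L\bar C)^k(r(0)-\bar M\bar\zeta(0))$ along all signals. (c) There is $\gamma\ge0$ such that the controller $u(k)=-\hat K\bar\zeta(k)-T\bar z(k)$ with $\vartheta=y_d$ has the following properties, for all initial states. For $\hat K=\bar K^*\bar M$ there is $X$ with $(\underline A-\bar B\bar K^*)X+\bar GR=XS$, $\bar CX=R$ such that, with $e=r-Xx_d$ and $u_e=\bar u+\bar K^*Xx_d$, one has $e(k+1)=\underline Ae(k)+\bar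 Bu_e(k)$, $e(k)\to0$, $y_e(k)\to0$, and the cost from time $0$ is at most the optimal value $e(0)^TP^*e(0)$ plus $\gamma|r(0)-\bar M\bar\zeta(0)|^2$; so it is optimal when $r(0)=\bar M\bar\zeta(0)$. Further, for every $\eta>0$ and all $\hat K$ sufficiently close to $\bar K^*\bar M$, there are $X,U$ with $\underline AX+\bar BU+\bar GR=XS$, $\bar CX=R$ such that the same holds with $e=r-Xx_d$, $u_e=\bar u-Ux_d$ and the cost bound increased by $\eta(|x_d(0)|^2+|r(0)|^2+|\bar\zeta(0)|^2)$. (d) Let $\underline A-\bar B\bar K^0$ be Schur, and run the following algorithm. The behavior policy $\bar u=-\bar K^0r+\xi$ with exploration noise $\xi$ and an arbitrary signal $\vartheta$ is applied, with $\bar\zeta(0)=0$ and given $r(0)$. Data are collected at the times $k_0,\dots,k_0+N$ such that the matrix with rows $[\bar\zeta\otimes\bar\zeta,\ \bar u\otimes\bar\zeta,\ \mathrm{vecv}(\bar u),\ \vartheta\otimes\bar\zeta,\ \bar u\otimes\vartheta,\ \mathrm{vecv}(\vartheta)](k)^T$, $k_0\le k<k_0+N$, where $\mathrm{vecv}(v)$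 lists the products $v_iv_j$, $i\le j$, has rank $\tfrac12(n_\zeta(n_\zeta+1)+m(m+1)+p(p+1))+n_\zeta m+pn_\zeta+pm$, $n_\zeta=\dim\bar\zeta$. Set $\hat K^0=\bar K^0\bar M$. Given $\hat K^j$, solve, in the least-squares sense over $k_0\le k<k_0+N$, for matrices $L_P,L_1,\dots,L_5$ with $L_P,L_2,L_5$ symmetric, the equations $$\bar\zeta^TL_P\bar\zeta\big|_{k}^{k+1}-2\bar\zeta^TL_1(\hat K^j\bar\zeta+\bar u)-\bar u^TL_2\bar u+(\hat K^j\bar\zeta)^TL_2\hat K^j\bar\zeta-2\bar\zeta^TL_3\vartheta-2\vartheta^TL_4\bar u-\vartheta^TL_5\vartheta=-y^TQy-(\hat K^j\bar\zeta)^T\bar R\hat K^j\bar\zeta,$$ and set $\hat K^{j+1}=(\bar R+L_2)^{-1}L_1^T$. The algorithm returns $\hat K^*=\hat K^{j+1}$ at the first $j$ with $\|\hat K^{j+1}-\hat K^j\|\le\varepsilon$. Let $\sigma,b>0$ and consider data matrices whose nonzero singular values are at least $\sigma$ and whose entries are at most $b$ in absolute value. Then the learned gain converges to $\bar K^*\bar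 M$: for every $\eta>0$ there are $J,\kappa$ (not depending on $\xi,\vartheta,N$) such that $\|\hat K^j-\bar K^*\bar M\|<\eta$ for all $j\ge J$ whenever $k_0\ge\kappa$; and for every $\eta>0$ there is $\varepsilon_0>0$ such that for every $\varepsilon\in(0,\varepsilon_0]$ and all $k_0\ge\kappa(\varepsilon)$ the algorithm stops, its result satisfies $\|\hat K^*-\bar K^*\bar M\|<\eta$, and the controller $u=-\hat K^*\bar\zeta-T\bar z$ with $\vartheta=y_d$ has the tracking and near-optimality properties of (c); in particular $y_e(k)\to0$. -/

import Mathlib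

open scoped Matrix Kronecker Topology ENNReal
open Filter

attribute [local instance] Matrix.frobeniusNormedAddCommGroup

namespace OutputTracking

/-! ### Linear-systems vocabulary -/

section Basic

variable {ι κ : Type*} [Fintype ι] [DecidableEq ι]

/-- The controllability matrix `[A₂, A₁ A₂, …, A₁^(N-1) A₂]`, with `N` the size of `A₁`. -/
def ctrbMatrix (A₁ : Matrix ι ι ℝ) (A₂ : Matrix ι κ ℝ) :
    Matrix ι (Fin (Fintype.card ι) × κ) ℝ :=
  Matrix.of fun i kj => (A₁ ^ (kj.1 : ℕ) * A₂) i kj.2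

/-- `(A₁, A₂)` is controllable: the controllability matrix has full row rank. -/
def Controllable [Fintype κ] (A₁ : Matrix ι ι ℝ) (A₂ : Matrix ι κ ℝ) : Prop :=
  (ctrbMatrix A₁ A₂).rank = Fintype.card ι

/-- `(A₁, C₁)` is observable: the transposed pair is controllable. -/
def Observable [Fintype κ] (A₁ : Matrix ι ι ℝ) (C₁ : Matrix κ ι ℝ) : Prop :=
  Controllable A₁ᵀ C₁ᵀ

/-- The complex spectrum of a real square matrix. -/
def cspec (A₁ : Matrix ι ι ℝ) : Set ℂ :=
  spectrum ℂ (A₁.map (algebraMap ℝ ℂ))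

/-- Discrete-time stability: every complex eigenvalue has modulus less than one. -/
def Schur (A₁ : Matrix ι ι ℝ) : Prop :=
  ∀ μ ∈ cspec A₁, ‖μ‖ < 1

end Basic

/-- The companion matrix of `z^N + d₁ z^(N-1) + ⋯ + d_N` (`d₁, …, d_N` is `c 0, …, c (N-1)`): ones
above the diagonal and last row `-d_N, …, -d₁`. -/
def companion {N : ℕ} (c : Fin N → ℝ) : Matrix (Fin N) (Fin N) ℝ :=
  Matrix.of fun i j =>
    if (i : ℕ) + 1 = N then -c (Fin.rev j) else if (i : ℕ) + 1 = j then 1 else 0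

/-- The vector `b = [0, …, 0, 1]ᵀ`. -/
def lastVec (N : ℕ) : Fin N → ℝ := fun l => if (l : ℕ) + 1 = N then 1 else 0

/-- `(F, G)` is a `p`-copy internal model of `S`: `F = diag(β₁, …, β_p)`, `G = diag(σ₁, …, σ_p)`
where each `(β_i, σ_i)` is controllable, the minimal polynomial of `S` divides the characteristic
polynomial of `β_i`, and `β_i` has no eigenvalue that is not an eigenvalue of `S`. -/
def IsInternalModel {p q d : ℕ} (S : Matrix (Fin q) (Fin q) ℝ)
    (F : Matrix (Fin d × Fin p) (Fin d × Fin p) ℝ) (G : Matrix (Fin d × Fin p) (Fin p) ℝ) : Prop :=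
  ∃ (β : Fin p → Matrix (Fin d) (Fin d) ℝ) (σ : Fin p → Fin d → ℝ),
    (∀ i, Controllable (β i) (Matrix.of fun a (_ : Unit) => σ i a) ∧
      minpoly ℝ S ∣ (β i).charpoly ∧ cspec (β i) ⊆ cspec S) ∧
    F = Matrix.blockDiagonal β ∧
    G = Matrix.of fun a j => if a.2 = j then σ j a.1 else 0

/-! ### The plant, the reference system and the internal model -/

/-- The matrices of the plant `(A, B, C)`, of the reference system `(S, R)`, of the internal model
`(F, G)` and the feedforward gain `T`. -/
structure Sys (n m p q d : ℕ) where
  A : Matrix (Fin n) (Fin n) ℝ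
  B : Matrix (Fin n) (Fin m) ℝ
  C : Matrix (Fin p) (Fin n) ℝ
  S : Matrix (Fin q) (Fin q) ℝ
  R : Matrix (Fin p) (Fin q) ℝ
  F : Matrix (Fin d × Fin p) (Fin d × Fin p) ℝ
  G : Matrix (Fin d × Fin p) (Fin p) ℝ
  T : Matrix (Fin m) (Fin d × Fin p) ℝ

/-- Coordinates of the augmented state `r = [x; z̄]`; there are `n_z = n + d p` of them. -/
abbrev RIdx (n p d : ℕ) : Type := Fin n ⊕ (Fin d × Fin p)

/-- Coordinates of the filter state `ζ̄ = [ζ_u; ζ_y; ζ_ϑ]`, where `N = n_z`. -/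
abbrev ZIdx (m p N : ℕ) : Type := (Fin m × Fin N) ⊕ ((Fin p × Fin N) ⊕ (Fin p × Fin N))

namespace Sys

variable {n m p q d : ℕ} (s : Sys n m p q d)

/-- The augmented state matrix `[A, -B T; -G C, F]`. -/
def Aaug : Matrix (RIdx n p d) (RIdx n p d) ℝ :=
  Matrix.fromBlocks s.A (-(s.B * s.T)) (-(s.G * s.C)) s.F

/-- `[B; 0]`. -/
def Baug : Matrix (RIdx n p d) (Fin m) ℝ := Matrix.fromRows s.B 0

/-- `[0; G]`. -/
def Gaug : Matrix (RIdx n p d) (Fin p) ℝ := Matrix.fromRows 0 s.G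

/-- `[C, 0]`. -/
def Caug : Matrix (Fin p) (RIdx n p d) ℝ := Matrix.fromCols s.C 0

/-! ### The linear quadratic problem -/

/-- The discrete-time algebraic Riccati equation. -/
def ARE (Q : Matrix (Fin p) (Fin p) ℝ) (Rb : Matrix (Fin m) (Fin m) ℝ)
    (P : Matrix (RIdx n p d) (RIdx n p d) ℝ) : Prop :=
  s.Aaugᵀ * P * s.Baug * (Rb + s.Baugᵀ * P * s.Baug)⁻¹ * s.Baugᵀ * P * s.Aaug
    = s.Caugᵀ * Q * s.Caug + s.Aaugᵀ * P * s.Aaug - P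

/-- The gain `(R̄ + B̄ᵀ P B̄)⁻¹ B̄ᵀ P A̲`. -/
noncomputable def lqrGain (Rb : Matrix (Fin m) (Fin m) ℝ) (P : Matrix (RIdx n p d) (RIdx n p d) ℝ) :
    Matrix (Fin m) (RIdx n p d) ℝ :=
  (Rb + s.Baugᵀ * P * s.Baug)⁻¹ * s.Baugᵀ * P * s.Aaug

/-- The error system `e(k+1) = A̲ e(k) + B̄ u_e(k)`. -/
def IsErrorTraj (e : ℕ → RIdx n p d → ℝ) (ue : ℕ → Fin m → ℝ) : Prop :=
  ∀ k, e (k + 1) = s.Aaug *ᵥ e k + s.Baug *ᵥ ue k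

/-- The performance index `∑_{i ≥ k} (y_eᵀ Q y_e + u_eᵀ R̄ u_e)`, `y_e = C̄ e`, in `[0, ∞]`. -/
noncomputable def cost (Q : Matrix (Fin p) (Fin p) ℝ) (Rb : Matrix (Fin m) (Fin m) ℝ)
    (e : ℕ → RIdx n p d → ℝ) (ue : ℕ → Fin m → ℝ) (k : ℕ) : ℝ≥0∞ :=
  ∑' i, ENNReal.ofReal
    ((s.Caug *ᵥ e (k + i)) ⬝ᵥ (Q *ᵥ (s.Caug *ᵥ e (k + i))) + ue (k + i) ⬝ᵥ (Rb *ᵥ ue (k + i)))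

/-- The gain `K` solves the optimal tracking problem: the feedback `u_e = -K e` drives the error to
zero, and its cost is minimal among all input sequences. -/
def SolvesProblem (Q : Matrix (Fin p) (Fin p) ℝ) (Rb : Matrix (Fin m) (Fin m) ℝ)
    (K : Matrix (Fin m) (RIdx n p d) ℝ) : Prop :=
  ∀ (e : ℕ → RIdx n p d → ℝ) (ue : ℕ → Fin m → ℝ),
    s.IsErrorTraj e ue → (∀ k, ue k = -(K *ᵥ e k)) →
      Tendsto e atTop (𝓝 0) ∧
      ∀ (k : ℕ) (e' : ℕ → RIdx n p d → ℝ) (ue' : ℕ → Fin m → ℝ),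
        s.IsErrorTraj e' ue' → e' k = e k → s.cost Q Rb e ue k ≤ s.cost Q Rb e' ue' k

end Sys

/-! ### Signals, filters and the parameterization matrix -/

/-- The signals of a run: plant state `x`, internal-model state `z̄`, the part `ū` of the input that
is not the feedforward term (the plant receives `ū - T z̄`), the signal `ϑ` and the three filter
states. -/
structure Signals (n m p d : ℕ) where
  x : ℕ → Fin n → ℝ
  z : ℕ → Fin d × Fin p → ℝ
  u : ℕ → Fin m → ℝ
  th : ℕ → Fin p → ℝ
  zu : ℕ → Fin m × Fin (n + d * p) → ℝ
  zy : ℕ → Fin p × Fin (n + d * p) → ℝ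
  zth : ℕ → Fin p × Fin (n + d * p) → ℝ

namespace Signals

variable {n m p d : ℕ} (w : Signals n m p d)

/-- The augmented state `r = [x; z̄]`. -/
def r (k : ℕ) : RIdx n p d → ℝ := Sum.elim (w.x k) (w.z k)

/-- The filter state `ζ̄ = [ζ_u; ζ_y; ζ_ϑ]`. -/
def zeta (k : ℕ) : ZIdx m p (n + d * p) → ℝ :=
  Sum.elim (w.zu k) (Sum.elim (w.zy k) (w.zth k))

end Signals

/-- One step `(I ⊗ A_ζ) ζ + v ⊗ b` of a filter driven by `v`. -/
def filterStep {a N : ℕ} (c : Fin N → ℝ) (ζ : Fin a × Fin N → ℝ) (v : Fin a → ℝ) :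
    Fin a × Fin N → ℝ :=
  ((1 : Matrix (Fin a) (Fin a) ℝ) ⊗ₖ companion c) *ᵥ ζ + fun il => v il.1 * lastVec N il.2

/-- The signals obey the plant equation, the equation of `z̄` and the three filter equations. -/
def Sys.Obeys {n m p q d : ℕ} (s : Sys n m p q d) (c : Fin (n + d * p) → ℝ)
    (w : Signals n m p d) : Prop :=
  ∀ k,
    w.x (k + 1) = s.A *ᵥ w.x k + s.B *ᵥ (w.u k - s.T *ᵥ w.z k) ∧
    w.z (k + 1) = s.F *ᵥ w.z k - s.G *ᵥ (s.C *ᵥ w.x k) + s.G *ᵥ w.th k ∧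
    w.zu (k + 1) = filterStep c (w.zu k) (w.u k) ∧
    w.zy (k + 1) = filterStep c (w.zy k) (s.C *ᵥ w.x k) ∧
    w.zth (k + 1) = filterStep c (w.zth k) (w.th k)

/-- The block of the parameterization matrix belonging to an input matrix `W`: in column `(j, l)` it
has the coefficient of `z^l` in the `j`-th column of `adj(zI - A_o) W`. -/
noncomputable def paramBlock {ι : Type*} [Fintype ι] [DecidableEq ι] {a : ℕ} (N : ℕ)
    (Ao : Matrix ι ι ℝ) (W : Matrix ι (Fin a) ℝ) : Matrix ι (Fin a × Fin N) ℝ :=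
  Matrix.of fun i jl =>
    (((Matrix.charmatrix Ao).adjugate * W.map Polynomial.C) i jl.1).coeff (jl.2 : ℕ)

/-- The parameterization matrix `M̄ = [M_u, M_y, M_ϑ]` of the observer gain `L`. -/
noncomputable def Sys.paramMatrix {n m p q d : ℕ} (s : Sys n m p q d)
    (L : Matrix (RIdx n p d) (Fin p) ℝ) : Matrix (RIdx n p d) (ZIdx m p (n + d * p)) ℝ :=
  Matrix.fromCols (paramBlock (n + d * p) (s.Aaug - L * s.Caug) s.Baug)
    (Matrix.fromCols (paramBlock (n + d * p) (s.Aaug - L * s.Caug) L)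
      (paramBlock (n + d * p) (s.Aaug - L * s.Caug) s.Gaug))

/-! ### The learning algorithm -/

/-- Index pairs `i ≤ j`, for the vector `vecv`. -/
abbrev UpperPairs (a : ℕ) : Type := {ij : Fin a × Fin a // ij.1 ≤ ij.2}

/-- Columns of the data matrix. -/
abbrev DataIdx (m p N : ℕ) : Type :=
  (ZIdx m p N × ZIdx m p N) ⊕ (Fin m × ZIdx m p N) ⊕ UpperPairs m ⊕
    (Fin p × ZIdx m p N) ⊕ (Fin m × Fin p) ⊕ UpperPairs p

/-- The data matrix `[D_ζζ, D_uζ, D_u, D_ϑζ, D_uϑ, D_ϑ]` over the times `k₀, …, k₀ + N - 1`; its rows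
are `[ζ̄ ⊗ ζ̄, ū ⊗ ζ̄, vecv ū, ϑ ⊗ ζ̄, ū ⊗ ϑ, vecv ϑ]`. -/
def Signals.dataMatrix {n m p d : ℕ} (w : Signals n m p d) (k₀ N : ℕ) :
    Matrix (Fin N) (DataIdx m p (n + d * p)) ℝ :=
  Matrix.of fun t =>
    let k := k₀ + (t : ℕ)
    Sum.elim (fun ij => w.zeta k ij.1 * w.zeta k ij.2) <|
    Sum.elim (fun ij => w.u k ij.1 * w.zeta k ij.2) <|
    Sum.elim (fun ij => w.u k ij.1.1 * w.u k ij.1.2) <|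
    Sum.elim (fun ij => w.th k ij.1 * w.zeta k ij.2) <|
    Sum.elim (fun ij => w.u k ij.1 * w.th k ij.2) <|
    fun ij => w.th k ij.1.1 * w.th k ij.1.2

/-- The rank condition on the collected data, where `n_ζ` is the dimension of `ζ̄`. -/
def Signals.RankCondition {n m p d : ℕ} (w : Signals n m p d) (k₀ N : ℕ) : Prop :=
  let nζ := Fintype.card (ZIdx m p (n + d * p))
  (w.dataMatrix k₀ N).rank =
    (nζ * (nζ + 1) + m * (m + 1) + p * (p + 1)) / 2 + nζ * m + p * nζ + p * m

/-- The nonzero singular values of `D` are at least `c`, and its entries are at most `b` in absolute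
value. -/
def Conditioned {ι κ : Type*} [Fintype ι] [Fintype κ] (c b : ℝ) (D : Matrix ι κ ℝ) : Prop :=
  (∀ v : κ → ℝ, c ^ 2 * ((D *ᵥ v) ⬝ᵥ (D *ᵥ v)) ≤ (Dᵀ *ᵥ (D *ᵥ v)) ⬝ᵥ (Dᵀ *ᵥ (D *ᵥ v))) ∧
  ∀ i j, |D i j| ≤ b

/-- The unknown matrices of the off-policy Bellman equation in output-feedback form. -/
structure BellmanUnknown (m p N : ℕ) where
  LP : Matrix (ZIdx m p N) (ZIdx m p N) ℝ
  L1 : Matrix (ZIdx m p N) (Fin m) ℝ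
  L2 : Matrix (Fin m) (Fin m) ℝ
  L3 : Matrix (ZIdx m p N) (Fin p) ℝ
  L4 : Matrix (Fin p) (Fin m) ℝ
  L5 : Matrix (Fin p) (Fin p) ℝ

/-- `LP`, `L2` and `L5` are symmetric (they enter the equation through `vecs`). -/
def BellmanUnknown.Symm {m p N : ℕ} (L : BellmanUnknown m p N) : Prop :=
  L.LP.IsSymm ∧ L.L2.IsSymm ∧ L.L5.IsSymm

/-- The entry, at time `k`, of the difference of the two sides of the data-based Bellman equation for
the gain `K`. -/
def Sys.residual {n m p q d : ℕ} (s : Sys n m p q d) (Q : Matrix (Fin p) (Fin p) ℝ)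
    (Rb : Matrix (Fin m) (Fin m) ℝ) (w : Signals n m p d)
    (K : Matrix (Fin m) (ZIdx m p (n + d * p)) ℝ) (L : BellmanUnknown m p (n + d * p))
    (k : ℕ) : ℝ :=
  let ζ := w.zeta k
  let ζ' := w.zeta (k + 1)
  let u := w.u k
  let th := w.th k
  let y := s.C *ᵥ w.x k
  (ζ' ⬝ᵥ (L.LP *ᵥ ζ') - ζ ⬝ᵥ (L.LP *ᵥ ζ) - 2 * (ζ ⬝ᵥ (L.L1 *ᵥ (K *ᵥ ζ + u)))
      - u ⬝ᵥ (L.L2 *ᵥ u) + (K *ᵥ ζ) ⬝ᵥ (L.L2 *ᵥ (K *ᵥ ζ))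
      - 2 * (ζ ⬝ᵥ (L.L3 *ᵥ th)) - 2 * (th ⬝ᵥ (L.L4 *ᵥ u)) - th ⬝ᵥ (L.L5 *ᵥ th))
    - (-(y ⬝ᵥ (Q *ᵥ y)) - (K *ᵥ ζ) ⬝ᵥ (Rb *ᵥ (K *ᵥ ζ)))

/-- `L` solves the data-based Bellman equation for the gain `K` over the times `k₀, …, k₀ + N`, in the
least-squares sense. -/
def Sys.SolvesBellman {n m p q d : ℕ} (s : Sys n m p q d) (Q : Matrix (Fin p) (Fin p) ℝ)
    (Rb : Matrix (Fin m) (Fin m) ℝ) (w : Signals n m p d) (k₀ N : ℕ)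
    (K : Matrix (Fin m) (ZIdx m p (n + d * p)) ℝ) (L : BellmanUnknown m p (n + d * p)) : Prop :=
  L.Symm ∧ ∀ L' : BellmanUnknown m p (n + d * p), L'.Symm →
    ∑ t ∈ Finset.range N, s.residual Q Rb w K L (k₀ + t) ^ 2 ≤
      ∑ t ∈ Finset.range N, s.residual Q Rb w K L' (k₀ + t) ^ 2

/-- `K 0, K 1, …` are gains that the policy iteration of the algorithm produces from the collected
data, starting from `Kinit`. -/
def Sys.IsIteration {n m p q d : ℕ} (s : Sys n m p q d) (Q : Matrix (Fin p) (Fin p) ℝ)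
    (Rb : Matrix (Fin m) (Fin m) ℝ) (w : Signals n m p d) (k₀ N : ℕ)
    (Kinit : Matrix (Fin m) (ZIdx m p (n + d * p)) ℝ)
    (K : ℕ → Matrix (Fin m) (ZIdx m p (n + d * p)) ℝ) : Prop :=
  K 0 = Kinit ∧
  ∀ j, ∃ L : BellmanUnknown m p (n + d * p),
    s.SolvesBellman Q Rb w k₀ N (K j) L ∧ K (j + 1) = (Rb + L.L2)⁻¹ * L.L1ᵀ

/-- The data-collection run: zero initial filter states, initial plant and internal-model state
`(x₀, z₀)`, behaviour policy `ū = -K⁰ r + ξ` (so that the plant receives `-K⁰ r + ξ - T z̄`) with some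
exploration noise `ξ`, and an arbitrary signal `ϑ`. -/
def Sys.IsBehaviorRun {n m p q d : ℕ} (s : Sys n m p q d) (c : Fin (n + d * p) → ℝ)
    (K0 : Matrix (Fin m) (RIdx n p d) ℝ) (x₀ : Fin n → ℝ) (z₀ : Fin d × Fin p → ℝ)
    (w : Signals n m p d) : Prop :=
  s.Obeys c w ∧ w.x 0 = x₀ ∧ w.z 0 = z₀ ∧ w.zeta 0 = 0 ∧
  ∃ ξ : ℕ → Fin m → ℝ, ∀ k, w.u k = -(K0 *ᵥ w.r k) + ξ k

/-- `K (j+1)` is the gain that the algorithm returns when its stopping threshold is `ε`. -/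
def StopsAt {ι κ : Type*} [Fintype ι] [Fintype κ] (ε : ℝ) (K : ℕ → Matrix ι κ ℝ) (j : ℕ) : Prop :=
  ‖K (j + 1) - K j‖ ≤ ε ∧ ∀ i < j, ε < ‖K (i + 1) - K i‖

/-! ### The output-feedback controller -/

/-- `w` is a run of the output-feedback controller `u = -K̂ ζ̄ - T z̄` with `ϑ = y_d = R x_d`, along the
reference state `xd`; all initial states are arbitrary. -/
def Sys.IsClosedLoop {n m p q d : ℕ} (s : Sys n m p q d) (c : Fin (n + d * p) → ℝ)
    (Kh : Matrix (Fin m) (ZIdx m p (n + d * p)) ℝ) (xd : ℕ → Fin q → ℝ)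
    (w : Signals n m p d) : Prop :=
  (∀ k, xd (k + 1) = s.S *ᵥ xd k) ∧ s.Obeys c w ∧
  (∀ k, w.u k = -(Kh *ᵥ w.zeta k)) ∧ ∀ k, w.th k = s.R *ᵥ xd k

/-- The controller with gain `Kh` achieves output tracking, with performance index optimal up to
`γ |r(0) - M̄ ζ̄(0)|² + η (|x_d(0)|² + |r(0)|² + |ζ̄(0)|²)`. The steady state of `(r, ū)` is
`(X x_d, U x_d)`, the error is `e = r - X x_d` with input `u_e = ū - U x_d`, and `eᵀ P e` is the
optimal value. -/
def Sys.Tracks {n m p q d : ℕ} (s : Sys n m p q d) (Q : Matrix (Fin p) (Fin p) ℝ)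
    (Rb : Matrix (Fin m) (Fin m) ℝ) (c : Fin (n + d * p) → ℝ)
    (P : Matrix (RIdx n p d) (RIdx n p d) ℝ) (M : Matrix (RIdx n p d) (ZIdx m p (n + d * p)) ℝ)
    (Kh : Matrix (Fin m) (ZIdx m p (n + d * p)) ℝ)
    (X : Matrix (RIdx n p d) (Fin q) ℝ) (U : Matrix (Fin m) (Fin q) ℝ) (γ η : ℝ) : Prop :=
  s.Aaug * X + s.Baug * U + s.Gaug * s.R = X * s.S ∧ s.Caug * X = s.R ∧
  ∀ (xd : ℕ → Fin q → ℝ) (w : Signals n m p d), s.IsClosedLoop c Kh xd w →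
    let e : ℕ → RIdx n p d → ℝ := fun k => w.r k - X *ᵥ xd k
    let ue : ℕ → Fin m → ℝ := fun k => w.u k - U *ᵥ xd k
    let ω₀ := w.r 0 - M *ᵥ w.zeta 0
    s.IsErrorTraj e ue ∧
    Tendsto e atTop (𝓝 0) ∧
    Tendsto (fun k => s.C *ᵥ w.x k - s.R *ᵥ xd k) atTop (𝓝 0) ∧
    s.cost Q Rb e ue 0 ≤ ENNReal.ofReal (e 0 ⬝ᵥ (P *ᵥ e 0) + γ * (ω₀ ⬝ᵥ ω₀) +
      η * (xd 0 ⬝ᵥ xd 0 + w.r 0 ⬝ᵥ w.r 0 + w.zeta 0 ⬝ᵥ w.zeta 0))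

end OutputTracking

/-!
Optimal output tracking by output feedback, with and without knowledge of the plant.

**The augmented plant.** An eigenvector `a + ib` of a real matrix for the eigenvalue `α + iβ` is
kept as a pair of real vectors (`IsEigenPair`), and observability is used in the form that the
output annihilates no such pair except zero (`PairObservable`). An eigenvector of the augmented
plant that is invisible at the output, or one of the transposed plant that is invisible at the
input, has a component that is an eigenvector of `F`, or of its transpose. If this component is
nonzero, then its eigenvalue belongs to `S`, the transmission-zero condition eliminates the plant
component (for the output this uses `m ≤ p`), and observability of `(F, T)`, or controllability of
`(F, G)`, is contradicted. If it vanishes, then `(A, C)`, or `(A, B)`, is contradicted. Hence the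
augmented pair is observable and reachable, and an observer gain for a prescribed characteristic
polynomial exists after reduction to a single input by Heymann's argument
(`Reachable.exists_charpoly_eq`).

**The Riccati equation.** It says that `P` is the cost matrix of its own greedy gain
(`Weights.riccati_iff`). Starting from a stabilizing gain, policy iteration produces a decreasing
sequence of positive semidefinite cost matrices (`IsPolicyIteration.exists_tendsto`), whose limit is
a solution; observability makes the greedy gain of any positive semidefinite solution stabilizing,
and comparison gives uniqueness. Completion of squares writes the cost of any input as `e(0)ᵀPe(0)`
plus the squared deviation of the input from the feedback law, weighted by `R + BᵀPB`
(`Weights.sum_stage_eq`), whence optimality.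

**State reconstruction.** The coefficients of `adj(zI - A + LC)W` satisfy the recursion of a
companion matrix with the same characteristic polynomial, so that the parameterization matrix `M`
intertwines the filters with the observer `A - LC` (`paramBlock_mul_kronecker`) and the error
`r - Mζ` decays like `(A - LC)^k`. A controller `u = -K̂ζ - Tz̄` thus acts as the state feedback up
to this error. Its steady state `X` exists because the closed loop is Schur and `S` has no
eigenvalue inside the unit disc; its output equals `R` because the internal model contained in the
closed loop leaves no room for a nonzero output error (`IsInternalModel.eq_zero`). The excess cost
is a sum of squares of `K(r - Mζ)` and `(K̂ - KM)ζ`, measured relative to the steady state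
(`IsReconstructor.exists_cost_le`).

**Learning.** The filters themselves form a linear system driven by `u` and `ϑ`, up to the
reconstruction error, and the optimal gain of this system is `K*M`. Along a policy, the exact
Bellman equation holds for the data with a residual governed by the reconstruction error only, and
the sum of squares of this residual over `k ≥ k₀` tends to zero uniformly in the exploration signals
because `ζ(0) = 0` makes the error independent of them. The rank hypothesis says that the data
determine a quadratic form in `(ζ, u, ϑ)`, and the bound on the singular values makes this
quantitative (`norm_sq_le_sum`), so the least-squares gains are uniformly close to the exact
policy-iteration gains (`exists_gain_estimate`). Inexact policy iteration follows the exact one on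
any finite horizon, and near the optimum the policy-improvement step is quadratically contracting,
so that small errors keep the iterates there (`IsInexactIteration.near_exact`,
`IsInexactIteration.invariant`); this yields convergence and, for small thresholds, that the
stopping rule does not fire before the iterates are close to the optimum
(`IsInexactIteration.stops`).
-/

namespace OutputTracking

/-! ### Squares of vectors and the Frobenius norm -/

section Squares

variable {ι κ : Type*} [Fintype ι] [Fintype κ]

lemma dotProduct_self_nonneg' (v : ι → ℝ) : 0 ≤ v ⬝ᵥ v :=
  Finset.sum_nonneg fun i _ => mul_self_nonneg (v i)

lemma dotProduct_self_eq_zero' {v : ι → ℝ} (h : v ⬝ᵥ v ≤ 0) : v = 0 :=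
  dotProduct_self_eq_zero.1 (le_antisymm h (dotProduct_self_nonneg' v))

lemma sq_apply_le_dotProduct_self (v : ι → ℝ) (i : ι) : v i ^ 2 ≤ v ⬝ᵥ v := by
  rw [pow_two]
  exact Finset.single_le_sum (f := fun i => v i * v i)
    (fun i _ => mul_self_nonneg (v i)) (Finset.mem_univ i)

lemma dotProduct_sq_le (v w : ι → ℝ) : (v ⬝ᵥ w) ^ 2 ≤ (v ⬝ᵥ v) * (w ⬝ᵥ w) := by
  have := Finset.sum_mul_sq_le_sq_mul_sq Finset.univ v w
  simpa only [dotProduct, pow_two] using this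

lemma add_dotProduct_self_le (v w : ι → ℝ) :
    (v + w) ⬝ᵥ (v + w) ≤ 2 * (v ⬝ᵥ v) + 2 * (w ⬝ᵥ w) := by
  have := dotProduct_self_nonneg' (v - w)
  simp only [add_dotProduct, dotProduct_add, sub_dotProduct, dotProduct_sub] at *
  linarith

lemma sub_dotProduct_self_le (v w : ι → ℝ) :
    (v - w) ⬝ᵥ (v - w) ≤ 2 * (v ⬝ᵥ v) + 2 * (w ⬝ᵥ w) := by
  have := dotProduct_self_nonneg' (v + w)
  simp only [add_dotProduct, dotProduct_add, sub_dotProduct, dotProduct_sub] at *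
  linarith

lemma norm_sq_eq_sum (A : Matrix ι κ ℝ) : ‖A‖ ^ 2 = ∑ i, ∑ j, A i j ^ 2 := by
  have h0 : 0 ≤ ∑ i, ∑ j, A i j ^ 2 :=
    Finset.sum_nonneg fun i _ => Finset.sum_nonneg fun j _ => sq_nonneg _
  have h : ‖A‖ = Real.sqrt (∑ i, ∑ j, A i j ^ 2) := by
    rw [Matrix.frobenius_norm_def, Real.sqrt_eq_rpow]
    congr 1
    refine Finset.sum_congr rfl fun i _ => Finset.sum_congr rfl fun j _ => ?_
    rw [Real.norm_eq_abs, Real.rpow_two, sq_abs]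
  rw [h, Real.sq_sqrt h0]

lemma mulVec_dotProduct_self_le (A : Matrix ι κ ℝ) (v : κ → ℝ) :
    (A *ᵥ v) ⬝ᵥ (A *ᵥ v) ≤ ‖A‖ ^ 2 * (v ⬝ᵥ v) := by
  rw [norm_sq_eq_sum, Finset.sum_mul]
  refine Finset.sum_le_sum fun i _ => ?_
  have := dotProduct_sq_le (A i) v
  rw [← pow_two]
  simpa [Matrix.mulVec, dotProduct, pow_two] using this

lemma dotProduct_mulVec_sq_le (A : Matrix ι κ ℝ) (v : ι → ℝ) (w : κ → ℝ) :
    (v ⬝ᵥ (A *ᵥ w)) ^ 2 ≤ ‖A‖ ^ 2 * (v ⬝ᵥ v) * (w ⬝ᵥ w) := by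
  refine (dotProduct_sq_le _ _).trans ?_
  have := mul_le_mul_of_nonneg_left (mulVec_dotProduct_self_le A w) (dotProduct_self_nonneg' v)
  linarith

lemma abs_quadratic_le (A : Matrix ι ι ℝ) (v : ι → ℝ) :
    |v ⬝ᵥ (A *ᵥ v)| ≤ ‖A‖ * (v ⬝ᵥ v) := by
  refine abs_le_of_sq_le_sq ?_ (mul_nonneg (norm_nonneg A) (dotProduct_self_nonneg' v))
  refine (dotProduct_mulVec_sq_le A v v).trans (le_of_eq (by ring))

/-- A sum of squares that stays bounded along a trajectory forces convergence to zero. -/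
lemma tendsto_zero_of_sum_dotProduct_self_le {x : ℕ → ι → ℝ} {c : ℝ}
    (h : ∀ T, ∑ k ∈ Finset.range T, x k ⬝ᵥ x k ≤ c) : Tendsto x atTop (𝓝 0) := by
  have hs : Summable fun k => x k ⬝ᵥ x k :=
    summable_of_sum_range_le (fun k => dotProduct_self_nonneg' _) h
  have h0 := hs.tendsto_atTop_zero
  refine tendsto_pi_nhds.2 fun i => ?_
  have h1 : Tendsto (fun k => x k i ^ 2) atTop (𝓝 0) :=
    squeeze_zero (fun k => sq_nonneg _) (fun k => sq_apply_le_dotProduct_self (x k) i) h0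
  have h2 := (Real.continuous_sqrt.tendsto 0).comp h1
  simp only [Real.sqrt_zero] at h2
  refine tendsto_zero_iff_abs_tendsto_zero _ |>.2 (h2.congr fun k => ?_)
  simp [Real.sqrt_sq_eq_abs]

lemma norm_mul_le' {l : Type*} [Fintype l] (A : Matrix ι κ ℝ) (B : Matrix κ l ℝ) :
    ‖A * B‖ ≤ ‖A‖ * ‖B‖ := Matrix.frobenius_norm_mul A B

end Squares

/-! ### Eigenvalues through pairs of real vectors -/

section Pairs

variable {ι κ : Type*} [Fintype ι] [DecidableEq ι]

/-- `a + i b` is a (possibly zero) complex eigenvector of the real matrix `A` for the eigenvalue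
`α + i β`, expressed by its real and imaginary parts. -/
def IsEigenPair (A : Matrix ι ι ℝ) (α β : ℝ) (a b : ι → ℝ) : Prop :=
  A *ᵥ a = α • a - β • b ∧ A *ᵥ b = β • a + α • b

omit [DecidableEq ι] in
lemma map_ofReal_mulVec {κ : Type*} (A : Matrix κ ι ℝ) (a b : ι → ℝ) :
    (A.map (algebraMap ℝ ℂ)) *ᵥ (fun i => (⟨a i, b i⟩ : ℂ)) =
      fun i => (⟨(A *ᵥ a) i, (A *ᵥ b) i⟩ : ℂ) := by
  funext i
  apply Complex.ext
  · simp [Matrix.mulVec, dotProduct, Complex.re_sum]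
  · simp [Matrix.mulVec, dotProduct, Complex.im_sum]

omit [DecidableEq ι] in
lemma isEigenPair_iff (A : Matrix ι ι ℝ) (α β : ℝ) (a b : ι → ℝ) :
    IsEigenPair A α β a b ↔
      (A.map (algebraMap ℝ ℂ)) *ᵥ (fun i => (⟨a i, b i⟩ : ℂ)) =
        (⟨α, β⟩ : ℂ) • fun i => (⟨a i, b i⟩ : ℂ) := by
  rw [map_ofReal_mulVec, IsEigenPair, funext_iff, funext_iff, funext_iff, ← forall_and]
  refine forall_congr' fun i => ?_
  simp only [Pi.smul_apply, smul_eq_mul, Complex.ext_iff, Complex.mul_re, Complex.mul_im,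
    Pi.sub_apply, Pi.add_apply]
  constructor
  · rintro ⟨h1, h2⟩; exact ⟨h1, by rw [h2]; ring⟩
  · rintro ⟨h1, h2⟩; exact ⟨h1, by rw [h2]; ring⟩

lemma mem_cspec_iff (A : Matrix ι ι ℝ) (μ : ℂ) :
    μ ∈ cspec A ↔ ∃ v : ι → ℂ, v ≠ 0 ∧ (A.map (algebraMap ℝ ℂ)) *ᵥ v = μ • v := by
  rw [cspec, ← Matrix.spectrum_toLin', ← Module.End.hasEigenvalue_iff_mem_spectrum]
  constructor
  · intro h
    obtain ⟨v, hv⟩ := h.exists_hasEigenvector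
    exact ⟨v, hv.2, by simpa using hv.apply_eq_smul⟩
  · rintro ⟨v, hv0, hv⟩
    exact Module.End.hasEigenvalue_of_hasEigenvector
      (x := v) ⟨Module.End.mem_eigenspace_iff.2 (by simpa using hv), hv0⟩

lemma mem_cspec_of_isEigenPair {A : Matrix ι ι ℝ} {α β : ℝ} {a b : ι → ℝ}
    (h : IsEigenPair A α β a b) (h0 : ¬(a = 0 ∧ b = 0)) : (⟨α, β⟩ : ℂ) ∈ cspec A := by
  rw [mem_cspec_iff]
  refine ⟨_, ?_, (isEigenPair_iff A α β a b).1 h⟩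
  intro hv
  refine h0 ⟨funext fun i => ?_, funext fun i => ?_⟩
  · simpa using congrArg Complex.re (congrFun hv i)
  · simpa using congrArg Complex.im (congrFun hv i)

lemma exists_isEigenPair_of_mem_cspec {A : Matrix ι ι ℝ} {μ : ℂ} (h : μ ∈ cspec A) :
    ∃ a b : ι → ℝ, ¬(a = 0 ∧ b = 0) ∧ IsEigenPair A μ.re μ.im a b := by
  obtain ⟨v, hv0, hv⟩ := (mem_cspec_iff A μ).1 h
  refine ⟨fun i => (v i).re, fun i => (v i).im, ?_, (isEigenPair_iff _ _ _ _ _).2 hv⟩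
  rintro ⟨h1, h2⟩
  exact hv0 (funext fun i => Complex.ext (congrFun h1 i) (congrFun h2 i))

lemma Schur.eq_zero_of_isEigenPair {A : Matrix ι ι ℝ} (hA : Schur A) {α β : ℝ} {a b : ι → ℝ}
    (h : IsEigenPair A α β a b) (h1 : 1 ≤ α ^ 2 + β ^ 2) : a = 0 ∧ b = 0 := by
  by_contra h0
  have h2 := hA _ (mem_cspec_of_isEigenPair h h0)
  have h3 : ‖(⟨α, β⟩ : ℂ)‖ ^ 2 = α ^ 2 + β ^ 2 := by
    rw [Complex.sq_norm, Complex.normSq_mk]; ring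
  have h4 := norm_nonneg (⟨α, β⟩ : ℂ)
  nlinarith

lemma schur_of_isEigenPair {A : Matrix ι ι ℝ}
    (h : ∀ (α β : ℝ) (a b : ι → ℝ), IsEigenPair A α β a b → 1 ≤ α ^ 2 + β ^ 2 → a = 0 ∧ b = 0) :
    Schur A := by
  intro μ hμ
  by_contra hlt
  obtain ⟨a, b, h0, hab⟩ := exists_isEigenPair_of_mem_cspec hμ
  refine h0 (h _ _ a b hab ?_)
  have h3 : ‖μ‖ ^ 2 = μ.re ^ 2 + μ.im ^ 2 := by
    rw [Complex.sq_norm, Complex.normSq_apply]; ring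
  rw [← h3]
  nlinarith [not_lt.1 hlt]

lemma Schur.of_charpoly_eq {κ : Type*} [Fintype κ] [DecidableEq κ] {A : Matrix ι ι ℝ}
    {A' : Matrix κ κ ℝ} (hA : Schur A) (h : A'.charpoly = A.charpoly) : Schur A' := by
  intro μ hμ
  refine hA μ ?_
  rw [cspec, Matrix.mem_spectrum_iff_isRoot_charpoly, Matrix.charpoly_map] at hμ ⊢
  rwa [← h]

end Pairs

/-! ### Stability and powers -/

section Powers

variable {ι : Type*} [Fintype ι] [DecidableEq ι]

attribute [local instance] Matrix.frobeniusNormedRing Matrix.frobeniusNormedAlgebra in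
lemma tendsto_pow_of_spectrum {A : Matrix ι ι ℂ} (hA : ∀ μ ∈ spectrum ℂ A, ‖μ‖ < 1) (i j : ι) :
    Tendsto (fun k : ℕ => (A ^ k) i j) atTop (𝓝 0) := by
  have : Nonempty ι := ⟨i⟩
  have hr : spectralRadius ℂ A < (1 : NNReal) :=
    spectrum.spectralRadius_lt_of_forall_lt A fun k hk => by
      rw [← NNReal.coe_lt_coe]; simpa using hA k hk
  obtain ⟨r, hr1, hr2⟩ := ENNReal.lt_iff_exists_nnreal_btwn.1 hr
  have hev := (spectrum.pow_nnnorm_pow_one_div_tendsto_nhds_spectralRadius A).eventually_lt_const hr1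
  have h1 : ∀ᶠ k : ℕ in atTop, ‖(A ^ k) i j‖ ≤ (r : ℝ) ^ k := by
    filter_upwards [hev, eventually_gt_atTop 0] with k hk hk0
    have hk' : (‖A ^ k‖₊ : ENNReal) ≤ (r : ENNReal) ^ k := by
      have h2 := ENNReal.rpow_le_rpow hk.le (Nat.cast_nonneg (α := ℝ) k)
      rwa [← ENNReal.rpow_mul, one_div, inv_mul_cancel₀ (by positivity), ENNReal.rpow_one,
        ENNReal.rpow_natCast] at h2
    have h3 : ‖A ^ k‖ ≤ (r : ℝ) ^ k := by exact_mod_cast hk'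
    refine le_trans ?_ h3
    rw [Matrix.frobenius_norm_def]
    have h4 : ‖(A ^ k) i j‖ ^ (2 : ℝ) ≤ ∑ i, ∑ j, ‖(A ^ k) i j‖ ^ (2 : ℝ) := by
      refine le_trans ?_ (Finset.single_le_sum (f := fun i => ∑ j, ‖(A ^ k) i j‖ ^ (2 : ℝ))
        (fun _ _ => Finset.sum_nonneg fun _ _ => by positivity) (Finset.mem_univ i))
      exact Finset.single_le_sum (f := fun j => ‖(A ^ k) i j‖ ^ (2 : ℝ))
        (fun _ _ => by positivity) (Finset.mem_univ j)
    have h5 := Real.rpow_le_rpow (by positivity) h4 (by norm_num : (0 : ℝ) ≤ 1 / 2)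
    rwa [← Real.rpow_mul (norm_nonneg _), show (2 : ℝ) * (1 / 2) = 1 by norm_num,
      Real.rpow_one] at h5
  have hr3 : (r : ℝ) < 1 := by exact_mod_cast hr2
  exact squeeze_zero_norm' h1 (tendsto_pow_atTop_nhds_zero_of_lt_one r.2 hr3)

lemma Schur.tendsto_pow_apply {A : Matrix ι ι ℝ} (hA : Schur A) (i j : ι) :
    Tendsto (fun k : ℕ => (A ^ k) i j) atTop (𝓝 0) := by
  have h := tendsto_pow_of_spectrum hA i j
  have h2 := (Complex.continuous_re.tendsto 0).comp h
  refine h2.congr fun k => ?_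
  have : (A.map (algebraMap ℝ ℂ)) ^ k = (A ^ k).map (algebraMap ℝ ℂ) :=
    (map_pow (algebraMap ℝ ℂ).mapMatrix A k).symm
  simp only [Function.comp, this, Matrix.map_apply]
  exact Complex.ofReal_re _

lemma Schur.tendsto_pow_mulVec {A : Matrix ι ι ℝ} (hA : Schur A) (x : ι → ℝ) :
    Tendsto (fun k : ℕ => A ^ k *ᵥ x) atTop (𝓝 0) := by
  refine tendsto_pi_nhds.2 fun i => ?_
  have : Tendsto (fun k : ℕ => ∑ j, (A ^ k) i j * x j) atTop (𝓝 (∑ j : ι, 0 * x j)) :=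
    tendsto_finsetSum _ fun j _ => (hA.tendsto_pow_apply i j).mul_const _
  simpa [Matrix.mulVec, dotProduct] using this

lemma pow_succ_mulVec (A : Matrix ι ι ℝ) (k : ℕ) (x : ι → ℝ) :
    A ^ (k + 1) *ᵥ x = A *ᵥ (A ^ k *ᵥ x) := by
  rw [pow_succ', Matrix.mulVec_mulVec]

/-- If all trajectories tend to zero, the matrix is stable: along an eigenpair the squared length
grows by the factor `α² + β²`. -/
lemma schur_of_tendsto {A : Matrix ι ι ℝ}
    (h : ∀ x : ι → ℝ, Tendsto (fun k : ℕ => A ^ k *ᵥ x) atTop (𝓝 0)) : Schur A := by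
  refine schur_of_isEigenPair fun α β a b hab h1 => ?_
  have key : ∀ k : ℕ, a ⬝ᵥ a + b ⬝ᵥ b ≤
      (A ^ k *ᵥ a) ⬝ᵥ (A ^ k *ᵥ a) + (A ^ k *ᵥ b) ⬝ᵥ (A ^ k *ᵥ b) ∧
        IsEigenPair A α β (A ^ k *ᵥ a) (A ^ k *ᵥ b) := by
    intro k
    induction k with
    | zero => simpa using hab
    | succ k ih =>
      obtain ⟨ih1, ih2⟩ := ih
      rw [pow_succ_mulVec, pow_succ_mulVec]
      set a' := A ^ k *ᵥ a
      set b' := A ^ k *ᵥ b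
      refine ⟨ih1.trans ?_, ?_, ?_⟩
      · rw [ih2.1, ih2.2]
        have e : (α • a' - β • b') ⬝ᵥ (α • a' - β • b') + (β • a' + α • b') ⬝ᵥ (β • a' + α • b') =
            (α ^ 2 + β ^ 2) * (a' ⬝ᵥ a' + b' ⬝ᵥ b') := by
          simp only [add_dotProduct, dotProduct_add, sub_dotProduct, dotProduct_sub,
            smul_dotProduct, dotProduct_smul, smul_eq_mul, dotProduct_comm b' a']
          ring
        rw [e]
        have := add_nonneg (dotProduct_self_nonneg' a') (dotProduct_self_nonneg' b')
        nlinarith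
      · conv_lhs => rw [ih2.1]
        rw [Matrix.mulVec_sub, Matrix.mulVec_smul, Matrix.mulVec_smul]
      · conv_lhs => rw [ih2.2]
        rw [Matrix.mulVec_add, Matrix.mulVec_smul, Matrix.mulVec_smul]
  have hlim : Tendsto (fun k : ℕ => (A ^ k *ᵥ a) ⬝ᵥ (A ^ k *ᵥ a) + (A ^ k *ᵥ b) ⬝ᵥ (A ^ k *ᵥ b))
      atTop (𝓝 0) := by
    have hc : Continuous fun v : (ι → ℝ) => v ⬝ᵥ v := by
      unfold dotProduct; fun_prop
    have := ((hc.tendsto 0).comp (h a)).add ((hc.tendsto 0).comp (h b))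
    simpa using this
  have hle := ge_of_tendsto' hlim fun k => (key k).1
  have ha := dotProduct_self_nonneg' a
  have hb := dotProduct_self_nonneg' b
  exact ⟨dotProduct_self_eq_zero' (by linarith), dotProduct_self_eq_zero' (by linarith)⟩

end Powers

/-! ### Sylvester equations and perturbed linear maps -/

section Sylvester

variable {ι κ : Type*} [Fintype ι] [DecidableEq ι] [Fintype κ] [DecidableEq κ]

lemma mul_aeval_eq_aeval_mul {A : Matrix ι ι ℝ} {S : Matrix κ κ ℝ} {X : Matrix ι κ ℝ}
    (h : A * X = X * S) (p : Polynomial ℝ) :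
    X * Polynomial.aeval S p = Polynomial.aeval A p * X := by
  have hk : ∀ k : ℕ, A ^ k * X = X * S ^ k := by
    intro k
    induction k with
    | zero => simp
    | succ k ih => rw [pow_succ', Matrix.mul_assoc, ih, ← Matrix.mul_assoc, h, Matrix.mul_assoc,
        ← pow_succ']
  rw [Polynomial.aeval_eq_sum_range, Polynomial.aeval_eq_sum_range, Matrix.mul_sum, Matrix.sum_mul]
  refine Finset.sum_congr rfl fun k _ => ?_
  rw [Matrix.mul_smul, Matrix.smul_mul, hk]

/-- A stable matrix and a matrix without stable eigenvalues are intertwined only by zero: with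
`p` the characteristic polynomial of `A`, `X p(S) = p(A) X = 0` and `p(S)` is invertible. -/
lemma eq_zero_of_mul_eq_mul {A : Matrix ι ι ℝ} {S : Matrix κ κ ℝ} {X : Matrix ι κ ℝ}
    (hA : Schur A) (hS : ∀ μ ∈ cspec S, 1 ≤ ‖μ‖) (h : A * X = X * S) : X = 0 := by
  rcases isEmpty_or_nonempty κ with hκ | hκ
  · ext i j; exact hκ.elim j
  have h1 := mul_aeval_eq_aeval_mul h A.charpoly
  rw [Matrix.aeval_self_charpoly, Matrix.zero_mul] at h1
  have hU : IsUnit (Polynomial.aeval S A.charpoly) := by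
    by_contra hU
    have hmap : Polynomial.aeval (S.map (algebraMap ℝ ℂ)) (A.charpoly.map (algebraMap ℝ ℂ)) =
        (Polynomial.aeval S A.charpoly).map (algebraMap ℝ ℂ) := by
      rw [Polynomial.aeval_map_algebraMap]
      exact Polynomial.aeval_algHom_apply (Algebra.ofId ℝ ℂ).mapMatrix S A.charpoly
    have h0 : (0 : ℂ) ∈ spectrum ℂ
        (Polynomial.aeval (S.map (algebraMap ℝ ℂ)) (A.charpoly.map (algebraMap ℝ ℂ))) := by
      rw [spectrum.zero_mem_iff, hmap]
      intro hu
      apply hU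
      rw [Matrix.isUnit_iff_isUnit_det] at hu ⊢
      rw [isUnit_iff_ne_zero] at hu ⊢
      intro hz
      apply hu
      have := (RingHom.map_det (algebraMap ℝ ℂ) (Polynomial.aeval S A.charpoly)).symm
      rw [hz, map_zero] at this
      exact this
    rw [spectrum.map_polynomial_aeval_of_nonempty _ _
      (spectrum.nonempty_of_isAlgClosed_of_finiteDimensional ℂ _)] at h0
    obtain ⟨μ, hμ, h0⟩ := h0
    have h2 : μ ∈ cspec A := by
      rw [cspec, Matrix.mem_spectrum_iff_isRoot_charpoly, Matrix.charpoly_map]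
      exact h0
    exact absurd (hA μ h2) (not_lt.2 (hS μ hμ))
  obtain ⟨u, hu⟩ := hU
  have h3 : X * (u : Matrix κ κ ℝ) * ((u⁻¹ : (Matrix κ κ ℝ)ˣ) : Matrix κ κ ℝ) = 0 := by
    rw [hu, h1, Matrix.zero_mul]
  rwa [Matrix.mul_assoc, Units.mul_inv, Matrix.mul_one] at h3

omit [DecidableEq ι] [DecidableEq κ] in
attribute [local instance] Matrix.frobeniusNormedSpace in
/-- An injective linear map between spaces of matrices is bounded below. -/
lemma exists_norm_le_of_injective {ι' κ' : Type*} [Fintype ι'] [Fintype κ']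
    (f : Matrix ι κ ℝ →ₗ[ℝ] Matrix ι' κ' ℝ) (hf : Function.Injective f) :
    ∃ c > 0, ∀ X, ‖X‖ ≤ c * ‖f X‖ := by
  obtain ⟨K, hK, h⟩ := f.exists_antilipschitzWith (LinearMap.ker_eq_bot.2 hf)
  refine ⟨K, hK, fun X => ?_⟩
  have := h.le_mul_dist X 0
  simpa [dist_eq_norm] using this

end Sylvester

/-! ### Lyapunov equations and stability margins -/

section Lyapunov

variable {ι : Type*} [Fintype ι] [DecidableEq ι]

omit [DecidableEq ι] in
lemma dotProduct_transpose_mul_mulVec {κ l : Type*} [Fintype κ] [Fintype l] (A : Matrix ι κ ℝ)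
    (X : Matrix ι ι ℝ) (B : Matrix ι l ℝ) (x : κ → ℝ) (y : l → ℝ) :
    x ⬝ᵥ ((Aᵀ * X * B) *ᵥ y) = (A *ᵥ x) ⬝ᵥ (X *ᵥ (B *ᵥ y)) := by
  rw [Matrix.mul_assoc, ← Matrix.mulVec_mulVec, ← Matrix.mulVec_mulVec, Matrix.dotProduct_mulVec,
    Matrix.vecMul_transpose]

lemma Schur.tendsto_pow {A : Matrix ι ι ℝ} (hA : Schur A) :
    Tendsto (fun k : ℕ => A ^ k) atTop (𝓝 0) :=
  tendsto_pi_nhds.2 fun i => tendsto_pi_nhds.2 fun j => hA.tendsto_pow_apply i j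

lemma Schur.eq_zero_of_lyapunov {A X : Matrix ι ι ℝ} (hA : Schur A) (h : X = Aᵀ * X * A) :
    X = 0 := by
  have hk : ∀ k : ℕ, (A ^ k)ᵀ * X * A ^ k = X := by
    intro k
    induction k with
    | zero => simp
    | succ k ih =>
      rw [pow_succ, Matrix.transpose_mul]
      calc Aᵀ * (A ^ k)ᵀ * X * (A ^ k * A) = Aᵀ * ((A ^ k)ᵀ * X * A ^ k) * A := by
            simp only [Matrix.mul_assoc]
        _ = X := by rw [ih, ← h]
  have hc : Continuous fun Z : Matrix ι ι ℝ => Zᵀ * X * Z := by fun_prop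
  have h2 := (hc.tendsto 0).comp hA.tendsto_pow
  have h3 : ((fun Z : Matrix ι ι ℝ => Zᵀ * X * Z) ∘ fun k : ℕ => A ^ k) = fun _ => X :=
    funext hk
  rw [h3] at h2
  simpa using tendsto_nhds_unique tendsto_const_nhds h2

/-- The linear map `X ↦ X - Aᵀ X A`. -/
def lyapunovMap (A : Matrix ι ι ℝ) : Matrix ι ι ℝ →ₗ[ℝ] Matrix ι ι ℝ where
  toFun X := X - Aᵀ * X * A
  map_add' X Y := by rw [Matrix.mul_add, Matrix.add_mul]; abel
  map_smul' r X := by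
    rw [Matrix.mul_smul, Matrix.smul_mul, RingHom.id_apply, smul_sub]

lemma Schur.lyapunovMap_injective {A : Matrix ι ι ℝ} (hA : Schur A) :
    Function.Injective (lyapunovMap A) :=
  (injective_iff_map_eq_zero _).2 fun _ hX => hA.eq_zero_of_lyapunov (sub_eq_zero.1 hX)

lemma Schur.exists_lyapunov {A : Matrix ι ι ℝ} (hA : Schur A) (Y : Matrix ι ι ℝ) :
    ∃ X, X = Aᵀ * X * A + Y := by
  obtain ⟨X, hX⟩ := (LinearMap.injective_iff_surjective.1 hA.lyapunovMap_injective) Y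
  exact ⟨X, (sub_eq_iff_eq_add'.1 hX)⟩

lemma Schur.lyapunov_unique {A X X' Y : Matrix ι ι ℝ} (hA : Schur A) (h : X = Aᵀ * X * A + Y)
    (h' : X' = Aᵀ * X' * A + Y) : X = X' :=
  hA.lyapunovMap_injective <| by
    change X - Aᵀ * X * A = X' - Aᵀ * X' * A
    rw [sub_eq_iff_eq_add'.2 h, sub_eq_iff_eq_add'.2 h']

lemma Schur.lyapunov_isSymm {A X Y : Matrix ι ι ℝ} (hA : Schur A) (h : X = Aᵀ * X * A + Y)
    (hY : Y.IsSymm) : X.IsSymm := by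
  refine hA.lyapunov_unique ?_ h
  conv_lhs => rw [h]
  rw [Matrix.transpose_add, hY.eq, Matrix.transpose_mul, Matrix.transpose_mul,
    Matrix.transpose_transpose, Matrix.mul_assoc]

lemma Schur.lyapunov_nonneg {A X Y : Matrix ι ι ℝ} (hA : Schur A) (h : X = Aᵀ * X * A + Y)
    (hY : ∀ x, 0 ≤ x ⬝ᵥ (Y *ᵥ x)) (x : ι → ℝ) : 0 ≤ x ⬝ᵥ (X *ᵥ x) := by
  have hstep : ∀ x, (A *ᵥ x) ⬝ᵥ (X *ᵥ (A *ᵥ x)) ≤ x ⬝ᵥ (X *ᵥ x) := by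
    intro x
    have e : x ⬝ᵥ (X *ᵥ x) = (A *ᵥ x) ⬝ᵥ (X *ᵥ (A *ᵥ x)) + x ⬝ᵥ (Y *ᵥ x) := by
      conv_lhs => rw [h]
      rw [Matrix.add_mulVec, dotProduct_add, dotProduct_transpose_mul_mulVec]
    linarith [hY x]
  have hk : ∀ k : ℕ, (A ^ k *ᵥ x) ⬝ᵥ (X *ᵥ (A ^ k *ᵥ x)) ≤ x ⬝ᵥ (X *ᵥ x) := by
    intro k
    induction k with
    | zero => simp
    | succ k ih => rw [pow_succ_mulVec]; exact (hstep _).trans ih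
  have hc : Continuous fun v : ι → ℝ => v ⬝ᵥ (X *ᵥ v) := by
    unfold Matrix.mulVec dotProduct; fun_prop
  have h2 := (hc.tendsto 0).comp (hA.tendsto_pow_mulVec x)
  simp only [zero_dotProduct] at h2
  exact le_of_tendsto' h2 hk

lemma le_add_of_sq_le {s X D m : ℝ} (hX : 0 ≤ X) (hD : 0 ≤ D) (hm : 0 ≤ m)
    (h : s ^ 2 ≤ m * X * D) : s ≤ X / 4 + m * D := by
  refine le_of_sq_le_sq ?_ (by positivity)
  nlinarith [sq_nonneg (X / 4 - m * D)]

/-- Square-summable stability: a stable system driven by `d` has a trajectory whose square sum is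
bounded by the initial state and the square sum of `d`. The Lyapunov function `xᵀ Π x` with
`Π = Aᵀ Π A + 1` decreases by `|x|²` at each undriven step. -/
lemma Schur.exists_sum_le {A : Matrix ι ι ℝ} (hA : Schur A) :
    ∃ c > 0, ∀ x d : ℕ → ι → ℝ, (∀ k, x (k + 1) = A *ᵥ x k + d k) → ∀ T,
      ∑ k ∈ Finset.range T, x k ⬝ᵥ x k ≤
        c * (x 0 ⬝ᵥ x 0 + ∑ k ∈ Finset.range T, d k ⬝ᵥ d k) := by
  obtain ⟨Pi, hPi⟩ := hA.exists_lyapunov 1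
  have hnn := hA.lyapunov_nonneg hPi (fun x => by
    rw [Matrix.one_mulVec]; exact dotProduct_self_nonneg' x)
  set p := ‖Pi‖ with hp
  have hp0 : 0 ≤ p := norm_nonneg _
  set m := p ^ 2 * ‖A‖ ^ 2 with hm
  have hm0 : 0 ≤ m := by positivity
  refine ⟨4 * m + 2 * p + 1, by positivity, fun x d hx T => ?_⟩
  have hstep : ∀ k, x (k + 1) ⬝ᵥ (Pi *ᵥ x (k + 1)) ≤
      x k ⬝ᵥ (Pi *ᵥ x k) - (x k ⬝ᵥ x k) / 2 + (2 * m + p) * (d k ⬝ᵥ d k) := by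
    intro k
    have hX := dotProduct_self_nonneg' (x k)
    have hD := dotProduct_self_nonneg' (d k)
    have e : x k ⬝ᵥ (Pi *ᵥ x k) =
        (A *ᵥ x k) ⬝ᵥ (Pi *ᵥ (A *ᵥ x k)) + x k ⬝ᵥ x k := by
      conv_lhs => rw [hPi]
      rw [Matrix.add_mulVec, dotProduct_add, dotProduct_transpose_mul_mulVec, Matrix.one_mulVec]
    have hAx := mulVec_dotProduct_self_le A (x k)
    have h1 : (A *ᵥ x k) ⬝ᵥ (Pi *ᵥ d k) ≤ x k ⬝ᵥ x k / 4 + m * (d k ⬝ᵥ d k) := by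
      refine le_add_of_sq_le hX hD hm0 ((dotProduct_mulVec_sq_le _ _ _).trans ?_)
      rw [hm]
      have := mul_le_mul_of_nonneg_right (mul_le_mul_of_nonneg_left hAx (sq_nonneg p)) hD
      linarith
    have h2 : d k ⬝ᵥ (Pi *ᵥ (A *ᵥ x k)) ≤ x k ⬝ᵥ x k / 4 + m * (d k ⬝ᵥ d k) := by
      refine le_add_of_sq_le hX hD hm0 ((dotProduct_mulVec_sq_le _ _ _).trans ?_)
      rw [hm]
      have := mul_le_mul_of_nonneg_left hAx (mul_nonneg (sq_nonneg p) hD)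
      linarith
    have h3 := (le_abs_self _).trans (abs_quadratic_le Pi (d k))
    rw [hx k, Matrix.mulVec_add]
    simp only [add_dotProduct, dotProduct_add]
    linarith
  have hsum : ∀ T, (∑ k ∈ Finset.range T, x k ⬝ᵥ x k) / 2 + x T ⬝ᵥ (Pi *ᵥ x T) ≤
      x 0 ⬝ᵥ (Pi *ᵥ x 0) + (2 * m + p) * ∑ k ∈ Finset.range T, d k ⬝ᵥ d k := by
    intro T
    induction T with
    | zero => simp
    | succ T ih =>
      rw [Finset.sum_range_succ, Finset.sum_range_succ]
      linarith [hstep T]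
  have h0 := (le_abs_self _).trans (abs_quadratic_le Pi (x 0))
  have hX := dotProduct_self_nonneg' (x 0)
  have hD : 0 ≤ ∑ k ∈ Finset.range T, d k ⬝ᵥ d k :=
    Finset.sum_nonneg fun _ _ => dotProduct_self_nonneg' _
  have := mul_nonneg hm0 hX
  linarith [hsum T, hnn (x T)]

/-- The square-sum bound holds with one constant for all matrices near a stable one. -/
lemma Schur.exists_sum_le_nhds {A : Matrix ι ι ℝ} (hA : Schur A) :
    ∃ δ > 0, ∃ c > 0, ∀ A' : Matrix ι ι ℝ, ‖A' - A‖ < δ →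
      ∀ x d : ℕ → ι → ℝ, (∀ k, x (k + 1) = A' *ᵥ x k + d k) → ∀ T,
      ∑ k ∈ Finset.range T, x k ⬝ᵥ x k ≤
        c * (x 0 ⬝ᵥ x 0 + ∑ k ∈ Finset.range T, d k ⬝ᵥ d k) := by
  obtain ⟨c, hc, h⟩ := hA.exists_sum_le
  refine ⟨1 / (2 * (c + 1)), by positivity, 4 * c, by positivity, fun A' hA' x d hx T => ?_⟩
  have h1 := h x (fun k => (A' - A) *ᵥ x k + d k) (fun k => by
    rw [hx k, Matrix.sub_mulVec]; abel) T
  set X := ∑ k ∈ Finset.range T, x k ⬝ᵥ x k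
  set D := ∑ k ∈ Finset.range T, d k ⬝ᵥ d k
  have hX : 0 ≤ X := Finset.sum_nonneg fun _ _ => dotProduct_self_nonneg' _
  have hD : 0 ≤ D := Finset.sum_nonneg fun _ _ => dotProduct_self_nonneg' _
  have hδ : ‖A' - A‖ ^ 2 ≤ (1 / (2 * (c + 1))) ^ 2 :=
    pow_le_pow_left₀ (norm_nonneg _) hA'.le 2
  have h2 : ∑ k ∈ Finset.range T, ((A' - A) *ᵥ x k + d k) ⬝ᵥ ((A' - A) *ᵥ x k + d k) ≤
      2 * (1 / (2 * (c + 1))) ^ 2 * X + 2 * D := by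
    rw [Finset.mul_sum, Finset.mul_sum, ← Finset.sum_add_distrib]
    refine Finset.sum_le_sum fun k _ => (add_dotProduct_self_le _ _).trans ?_
    have h3 := mulVec_dotProduct_self_le (A' - A) (x k)
    have h4 := mul_le_mul_of_nonneg_right hδ (dotProduct_self_nonneg' (x k))
    linarith
  have h5 : c * (2 * (1 / (2 * (c + 1))) ^ 2) ≤ 1 / 2 := by
    rw [div_pow, one_pow, mul_pow]
    rw [mul_one_div, mul_div_assoc', div_le_iff₀ (by positivity)]
    nlinarith
  have h6 := mul_le_mul_of_nonneg_right h5 hX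
  have h7 := mul_le_mul_of_nonneg_left h2 hc.le
  have h8 := mul_nonneg hc.le (dotProduct_self_nonneg' (x 0))
  nlinarith

lemma Schur.exists_nhds {A : Matrix ι ι ℝ} (hA : Schur A) :
    ∃ δ > 0, ∀ A' : Matrix ι ι ℝ, ‖A' - A‖ < δ → Schur A' := by
  obtain ⟨δ, hδ, c, hc, h⟩ := hA.exists_sum_le_nhds
  refine ⟨δ, hδ, fun A' hA' => schur_of_tendsto fun x => ?_⟩
  refine tendsto_zero_of_sum_dotProduct_self_le (c := c * (x ⬝ᵥ x)) fun T => ?_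
  have := h A' hA' (fun k => A' ^ k *ᵥ x) (fun _ => 0)
    (fun k => by rw [pow_succ_mulVec, add_zero]) T
  simpa using this

/-- Lyapunov operators of the matrices near a stable one are uniformly bounded below. -/
lemma Schur.exists_lyapunov_norm_le {A : Matrix ι ι ℝ} (hA : Schur A) :
    ∃ δ > 0, ∃ c > 0, ∀ A' : Matrix ι ι ℝ, ‖A' - A‖ < δ →
      ∀ X : Matrix ι ι ℝ, ‖X‖ ≤ c * ‖X - A'ᵀ * X * A'‖ := by
  obtain ⟨c, hc, h⟩ := exists_norm_le_of_injective (lyapunovMap A) hA.lyapunovMap_injective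
  set a := ‖A‖ with ha
  have ha0 : 0 ≤ a := norm_nonneg _
  refine ⟨min 1 (1 / (2 * c * (2 * a + 1))), by positivity, 2 * c, by positivity,
    fun A' hA' X => ?_⟩
  set t := ‖A' - A‖ with ht
  have ht0 : 0 ≤ t := norm_nonneg _
  have ht1 : t ≤ 1 := hA'.le.trans (min_le_left _ _)
  have ht2 : t * (2 * c * (2 * a + 1)) ≤ 1 :=
    (le_div_iff₀ (by positivity)).1 (hA'.le.trans (min_le_right _ _))
  have e : X - Aᵀ * X * A = (X - A'ᵀ * X * A') +
      ((A' - A)ᵀ * X * A + Aᵀ * X * (A' - A) + (A' - A)ᵀ * X * (A' - A)) := by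
    rw [Matrix.transpose_sub]
    noncomm_ring
  have h3 : ∀ Y Z : Matrix ι ι ℝ, ‖Yᵀ * X * Z‖ ≤ ‖Y‖ * ‖X‖ * ‖Z‖ := by
    intro Y Z
    refine (norm_mul_le' _ _).trans (mul_le_mul_of_nonneg_right ?_ (norm_nonneg _))
    refine (norm_mul_le' _ _).trans (le_of_eq ?_)
    rw [Matrix.frobenius_norm_transpose]
  have h4 : ‖X - Aᵀ * X * A‖ ≤ ‖X - A'ᵀ * X * A'‖ +
      (t * ‖X‖ * a + a * ‖X‖ * t + t * ‖X‖ * t) := by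
    rw [e]
    refine (norm_add_le _ _).trans (add_le_add le_rfl ?_)
    exact (norm_add₃_le).trans (add_le_add (add_le_add (h3 _ _) (h3 _ _)) (h3 _ _))
  have h5 := h X
  change ‖X‖ ≤ c * ‖X - Aᵀ * X * A‖ at h5
  have hX := norm_nonneg X
  have h6 := mul_le_mul_of_nonneg_left h4 hc.le
  have h7 : c * (t * ‖X‖ * a + a * ‖X‖ * t + t * ‖X‖ * t) ≤ ‖X‖ / 2 := by
    have h8 : t * t ≤ t := by nlinarith
    have h9 := mul_le_mul_of_nonneg_left h8 (mul_nonneg hc.le hX)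
    have h10 := mul_le_mul_of_nonneg_right ht2 hX
    nlinarith
  linarith

/-- Sylvester equations `A' X + Y = X S` are uniformly solvable near a stable `A`, when `S` has no
stable eigenvalue. -/
lemma Schur.exists_sylvester {κ : Type*} [Fintype κ] [DecidableEq κ] {A : Matrix ι ι ℝ}
    {S : Matrix κ κ ℝ} (hA : Schur A) (hS : ∀ μ ∈ cspec S, 1 ≤ ‖μ‖) :
    ∃ δ > 0, ∃ c > 0, ∀ A' : Matrix ι ι ℝ, ‖A' - A‖ < δ →
      ∀ Y : Matrix ι κ ℝ, ∃ X : Matrix ι κ ℝ, A' * X + Y = X * S ∧ ‖X‖ ≤ c * ‖Y‖ := by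
  let f (A' : Matrix ι ι ℝ) : Matrix ι κ ℝ →ₗ[ℝ] Matrix ι κ ℝ :=
    { toFun := fun X => X * S - A' * X
      map_add' := fun X Y => by rw [Matrix.mul_add, Matrix.add_mul]; abel
      map_smul' := fun r X => by
        rw [Matrix.mul_smul, Matrix.smul_mul, RingHom.id_apply, smul_sub] }
  have hf : ∀ A' X, f A' X = X * S - A' * X := fun _ _ => rfl
  have hinj : Function.Injective (f A) :=
    (injective_iff_map_eq_zero _).2 fun X hX =>
      eq_zero_of_mul_eq_mul hA hS (sub_eq_zero.1 hX).symm
  obtain ⟨c, hc, h⟩ := exists_norm_le_of_injective (f A) hinj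
  refine ⟨1 / (2 * c), by positivity, 2 * c, by positivity, fun A' hA' => ?_⟩
  have hb : ∀ X, ‖X‖ ≤ 2 * c * ‖f A' X‖ := by
    intro X
    have e : f A X = f A' X + (A' - A) * X := by
      rw [hf, hf, Matrix.sub_mul]; abel
    have h1 : ‖f A X‖ ≤ ‖f A' X‖ + ‖A' - A‖ * ‖X‖ := by
      rw [e]; exact (norm_add_le _ _).trans (add_le_add le_rfl (norm_mul_le' _ _))
    have h2 := mul_le_mul_of_nonneg_left h1 hc.le
    have h3 : ‖A' - A‖ * (2 * c) ≤ 1 := (le_div_iff₀ (by positivity)).1 hA'.le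
    have h4 := mul_le_mul_of_nonneg_right h3 (norm_nonneg X)
    linarith [h X]
  have hinj' : Function.Injective (f A') := (injective_iff_map_eq_zero _).2 fun X hX => by
    have := hb X
    rw [hX, norm_zero, mul_zero] at this
    exact norm_le_zero_iff.1 this
  intro Y
  obtain ⟨X, hX⟩ := LinearMap.injective_iff_surjective.1 hinj' Y
  refine ⟨X, ?_, hX ▸ hb X⟩
  rw [← hX, hf]; abel

end Lyapunov

/-! ### Coercive and positive semidefinite matrices -/

section Coercive

variable {ι κ : Type*} [Fintype ι] [Fintype κ]

lemma posSemidef_iff_real {P : Matrix ι ι ℝ} :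
    P.PosSemidef ↔ P.IsSymm ∧ ∀ x, 0 ≤ x ⬝ᵥ (P *ᵥ x) := by
  rw [Matrix.posSemidef_iff_dotProduct_mulVec]
  simp [Matrix.IsHermitian, Matrix.IsSymm, Matrix.conjTranspose_eq_transpose_of_trivial]

/-- The quadratic form of `S` is bounded below by `r |x|²` with `r > 0`. -/
def Coercive (r : ℝ) (S : Matrix ι ι ℝ) : Prop :=
  0 < r ∧ ∀ x, r * (x ⬝ᵥ x) ≤ x ⬝ᵥ (S *ᵥ x)

lemma Coercive.add_nonneg {r : ℝ} {S X : Matrix ι ι ℝ} (hS : Coercive r S)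
    (hX : ∀ x, 0 ≤ x ⬝ᵥ (X *ᵥ x)) : Coercive r (S + X) :=
  ⟨hS.1, fun x => by
    rw [Matrix.add_mulVec, dotProduct_add]; linarith [hS.2 x, hX x]⟩

lemma Coercive.nonneg {r : ℝ} {S : Matrix ι ι ℝ} (hS : Coercive r S) (x : ι → ℝ) :
    0 ≤ x ⬝ᵥ (S *ᵥ x) :=
  (mul_nonneg hS.1.le (dotProduct_self_nonneg' x)).trans (hS.2 x)

lemma Coercive.eq_zero {r : ℝ} {S : Matrix ι ι ℝ} (hS : Coercive r S) {x : ι → ℝ}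
    (h : x ⬝ᵥ (S *ᵥ x) ≤ 0) : x = 0 := by
  have := hS.2 x
  have h1 := hS.1
  refine dotProduct_self_eq_zero' ?_
  by_contra h2
  have := mul_pos h1 (not_le.1 h2)
  linarith

lemma Coercive.mulVec_le {r : ℝ} {S : Matrix ι ι ℝ} (hS : Coercive r S) (x : ι → ℝ) :
    r ^ 2 * (x ⬝ᵥ x) ≤ (S *ᵥ x) ⬝ᵥ (S *ᵥ x) := by
  have h1 := hS.2 x
  have h2 := dotProduct_sq_le x (S *ᵥ x)
  have hx := dotProduct_self_nonneg' x
  rcases hx.eq_or_lt with h0 | h0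
  · rw [← h0, mul_zero]; exact dotProduct_self_nonneg' _
  · have h3 : (r * (x ⬝ᵥ x)) ^ 2 ≤ (x ⬝ᵥ x) * ((S *ᵥ x) ⬝ᵥ (S *ᵥ x)) :=
      (pow_le_pow_left₀ (mul_nonneg hS.1.le hx) h1 2).trans h2
    have h4 : (x ⬝ᵥ x) * (r ^ 2 * (x ⬝ᵥ x)) ≤ (x ⬝ᵥ x) * ((S *ᵥ x) ⬝ᵥ (S *ᵥ x)) := by
      refine le_trans (le_of_eq (by ring)) h3
    exact le_of_mul_le_mul_left h4 h0

lemma Coercive.isUnit_det [DecidableEq ι] {r : ℝ} {S : Matrix ι ι ℝ} (hS : Coercive r S) :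
    IsUnit S.det := by
  rw [← Matrix.isUnit_iff_isUnit_det, ← Matrix.mulVec_injective_iff_isUnit]
  intro x y hxy
  have h0 : S *ᵥ (x - y) = 0 := by rw [Matrix.mulVec_sub]; exact sub_eq_zero.2 hxy
  exact sub_eq_zero.1 (hS.eq_zero (by rw [h0, dotProduct_zero]))

lemma norm_sq_eq_sum_col (A : Matrix ι κ ℝ) :
    ‖A‖ ^ 2 = ∑ j, (fun i => A i j) ⬝ᵥ (fun i => A i j) := by
  rw [norm_sq_eq_sum, Finset.sum_comm]
  simp only [dotProduct, pow_two]

lemma Coercive.norm_le {r : ℝ} {S : Matrix ι ι ℝ} (hS : Coercive r S) (Y : Matrix ι κ ℝ) :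
    r * ‖Y‖ ≤ ‖S * Y‖ := by
  refine le_of_sq_le_sq ?_ (norm_nonneg _)
  rw [mul_pow, norm_sq_eq_sum_col, norm_sq_eq_sum_col, Finset.mul_sum]
  refine Finset.sum_le_sum fun j _ => ?_
  exact hS.mulVec_le _

lemma _root_.Matrix.PosDef.exists_coercive {S : Matrix ι ι ℝ} (hS : S.PosDef) :
    ∃ r, Coercive r S := by
  classical
  rcases isEmpty_or_nonempty ι with h | h
  · exact ⟨1, one_pos, fun x => by simp [dotProduct]⟩
  have hpos : ∀ x : ι → ℝ, x ≠ 0 → 0 < x ⬝ᵥ (S *ᵥ x) := fun x hx => by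
    simpa using hS.dotProduct_mulVec_pos hx
  have hc1 : Continuous fun x : ι → ℝ => x ⬝ᵥ (S *ᵥ x) := by
    unfold Matrix.mulVec dotProduct; fun_prop
  have hc2 : Continuous fun x : ι → ℝ => x ⬝ᵥ x := by
    unfold dotProduct; fun_prop
  have hcomp : IsCompact {x : ι → ℝ | x ⬝ᵥ x = 1} := by
    refine Metric.isCompact_of_isClosed_isBounded (isClosed_eq hc2 continuous_const) ?_
    refine (Metric.isBounded_closedBall (x := (0 : ι → ℝ)) (r := 1)).subset fun x hx => ?_
    rw [mem_closedBall_zero_iff, pi_norm_le_iff_of_nonneg zero_le_one]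
    intro i
    have := sq_apply_le_dotProduct_self x i
    rw [Set.mem_ofPred_eq] at hx
    rw [Real.norm_eq_abs]
    exact abs_le_of_sq_le_sq (by rw [one_pow, ← hx]; exact this) zero_le_one
  obtain ⟨i⟩ := h
  obtain ⟨x0, hx0, hmin⟩ := hcomp.exists_isMinOn (f := fun x => x ⬝ᵥ (S *ᵥ x))
    ⟨Pi.single i 1, by simp⟩ hc1.continuousOn
  have hx0' : x0 ≠ 0 := by rintro rfl; simp at hx0
  refine ⟨x0 ⬝ᵥ (S *ᵥ x0), hpos x0 hx0', fun x => ?_⟩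
  by_cases hx : x = 0
  · simp [hx]
  have hxx : 0 < x ⬝ᵥ x :=
    lt_of_le_of_ne (dotProduct_self_nonneg' x) fun h => hx (dotProduct_self_eq_zero.1 h.symm)
  set t := Real.sqrt (x ⬝ᵥ x)
  have ht : t * t = x ⬝ᵥ x := Real.mul_self_sqrt hxx.le
  have ht0 : 0 < t := Real.sqrt_pos.2 hxx
  have h1 : x0 ⬝ᵥ (S *ᵥ x0) ≤ (t⁻¹ • x) ⬝ᵥ (S *ᵥ (t⁻¹ • x)) := by
    refine hmin ?_
    simp only [Set.mem_ofPred_eq, smul_dotProduct, dotProduct_smul, smul_eq_mul, ← ht]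
    field_simp
  simp only [Matrix.mulVec_smul, smul_dotProduct, dotProduct_smul, smul_eq_mul] at h1
  rw [← ht]
  calc x0 ⬝ᵥ (S *ᵥ x0) * (t * t) ≤ (t⁻¹ * (t⁻¹ * (x ⬝ᵥ (S *ᵥ x)))) * (t * t) :=
        mul_le_mul_of_nonneg_right h1 (by positivity)
    _ = x ⬝ᵥ (S *ᵥ x) := by field_simp

omit [Fintype κ] in
lemma eq_of_quadratic_eq [DecidableEq ι] {X Y : Matrix ι ι ℝ} (hX : X.IsSymm) (hY : Y.IsSymm)
    (h : ∀ x, x ⬝ᵥ (X *ᵥ x) = x ⬝ᵥ (Y *ᵥ x)) : X = Y := by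
  have e : ∀ Z : Matrix ι ι ℝ, Z.IsSymm → ∀ i j, 2 * Z i j =
      (Pi.single i 1 + Pi.single j 1 : ι → ℝ) ⬝ᵥ (Z *ᵥ (Pi.single i 1 + Pi.single j 1)) -
        (Pi.single i 1 : ι → ℝ) ⬝ᵥ (Z *ᵥ Pi.single i 1) -
        (Pi.single j 1 : ι → ℝ) ⬝ᵥ (Z *ᵥ Pi.single j 1) := by
    intro Z hZ i j
    have := hZ.apply i j
    simp [Matrix.mulVec_add, add_dotProduct, this]
    ring
  ext i j
  have h1 := e X hX i j
  have h2 := e Y hY i j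
  rw [h, h, h, ← h2] at h1
  linarith

end Coercive

/-! ### Policy evaluation and policy improvement -/

section LQ

variable {ι κ : Type*} [Fintype ι] [DecidableEq ι] [Fintype κ] [DecidableEq κ]

/-- One step of policy evaluation for the gain `K`: the value function `xᵀ P x` is replaced by the
cost of one step with input `-K x` followed by `P`. -/
def evalStep (A : Matrix ι ι ℝ) (B : Matrix ι κ ℝ) (W : Matrix ι ι ℝ) (R : Matrix κ κ ℝ)
    (K : Matrix κ ι ℝ) (P : Matrix ι ι ℝ) : Matrix ι ι ℝ :=
  (A - B * K)ᵀ * P * (A - B * K) + (W + Kᵀ * R * K)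

/-- The gain that minimizes the cost of one step followed by the value function `xᵀ P x`. -/
noncomputable def greedy (A : Matrix ι ι ℝ) (B : Matrix ι κ ℝ) (R : Matrix κ κ ℝ)
    (P : Matrix ι ι ℝ) : Matrix κ ι ℝ :=
  (R + Bᵀ * P * B)⁻¹ * Bᵀ * P * A

variable {A : Matrix ι ι ℝ} {B : Matrix ι κ ℝ} {W : Matrix ι ι ℝ} {R : Matrix κ κ ℝ}
  {K : Matrix κ ι ℝ} {P : Matrix ι ι ℝ} {r : ℝ}

omit [DecidableEq ι] [DecidableEq κ] in
lemma coercive_add (hR : Coercive r R) (hP : P.PosSemidef) : Coercive r (R + Bᵀ * P * B) :=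
  hR.add_nonneg fun x => by
    rw [dotProduct_transpose_mul_mulVec]
    exact (posSemidef_iff_real.1 hP).2 _

omit [DecidableEq ι] in
lemma mul_greedy (hS : IsUnit (R + Bᵀ * P * B).det) :
    (R + Bᵀ * P * B) * greedy A B R P = Bᵀ * P * A := by
  rw [greedy, Matrix.mul_assoc _ _ A, Matrix.mul_assoc _ Bᵀ,
    Matrix.mul_nonsing_inv_cancel_left _ _ hS, ← Matrix.mul_assoc]

omit [DecidableEq ι] [Fintype κ] [DecidableEq κ] in
lemma isSymm_add_mul (hR : R.IsSymm) (hP : P.IsSymm) : (R + Bᵀ * P * B).IsSymm := by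
  rw [Matrix.IsSymm, Matrix.transpose_add, hR.eq, Matrix.transpose_mul, Matrix.transpose_mul,
    Matrix.transpose_transpose, hP.eq, Matrix.mul_assoc]

omit [DecidableEq ι] [DecidableEq κ] in
lemma evalStep_expand {G : Matrix κ ι ℝ} (hR : R.IsSymm) (hP : P.IsSymm)
    (hG : (R + Bᵀ * P * B) * G = Bᵀ * P * A) :
    evalStep A B W R K P = Aᵀ * P * A + W - Gᵀ * ((R + Bᵀ * P * B) * K)
      - Kᵀ * ((R + Bᵀ * P * B) * G) + Kᵀ * ((R + Bᵀ * P * B) * K) := by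
  have hG' : Gᵀ * (R + Bᵀ * P * B) = Aᵀ * P * B := by
    have := congrArg Matrix.transpose hG
    rw [Matrix.transpose_mul, (isSymm_add_mul hR hP).eq] at this
    rw [this, Matrix.transpose_mul, Matrix.transpose_mul, Matrix.transpose_transpose, hP.eq,
      Matrix.mul_assoc]
  rw [hG, ← Matrix.mul_assoc Gᵀ, hG', evalStep]
  simp only [Matrix.transpose_sub, Matrix.transpose_mul, Matrix.sub_mul, Matrix.mul_sub,
    Matrix.add_mul, Matrix.mul_add, Matrix.mul_assoc]
  abel

omit [DecidableEq ι] [DecidableEq κ] in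
/-- Completion of squares: the loss of a gain `K` against the greedy gain `G` in one step. -/
lemma evalStep_eq_add {G : Matrix κ ι ℝ} (hR : R.IsSymm) (hP : P.IsSymm)
    (hG : (R + Bᵀ * P * B) * G = Bᵀ * P * A) :
    evalStep A B W R K P =
      evalStep A B W R G P + (K - G)ᵀ * (R + Bᵀ * P * B) * (K - G) := by
  rw [evalStep_expand hR hP hG, evalStep_expand hR hP hG]
  simp only [Matrix.transpose_sub, Matrix.sub_mul, Matrix.mul_sub, Matrix.mul_assoc]
  abel

/-- The standing assumptions on the weights: `W` is positive semidefinite, `R` is symmetric and its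
form is bounded below by `r |u|²`. -/
structure Weights (W : Matrix ι ι ℝ) (R : Matrix κ κ ℝ) (r : ℝ) : Prop where
  state : W.PosSemidef
  symm : R.IsSymm
  coercive : Coercive r R

namespace Weights

omit [DecidableEq ι] in
lemma mul_greedy (h : Weights W R r) (hP : P.PosSemidef) :
    (R + Bᵀ * P * B) * greedy A B R P = Bᵀ * P * A :=
  OutputTracking.mul_greedy (coercive_add h.coercive hP).isUnit_det

omit [DecidableEq ι] in
lemma evalStep_greedy (h : Weights W R r) (hP : P.PosSemidef) (K : Matrix κ ι ℝ) :
    evalStep A B W R K P = evalStep A B W R (greedy A B R P) P +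
      (K - greedy A B R P)ᵀ * (R + Bᵀ * P * B) * (K - greedy A B R P) :=
  evalStep_eq_add h.symm (posSemidef_iff_real.1 hP).1 (h.mul_greedy hP)

omit [DecidableEq ι] [DecidableEq κ] in
lemma loss_nonneg (h : Weights W R r) (hP : P.PosSemidef) (D : Matrix κ ι ℝ) (x : ι → ℝ) :
    0 ≤ x ⬝ᵥ ((Dᵀ * (R + Bᵀ * P * B) * D) *ᵥ x) := by
  rw [dotProduct_transpose_mul_mulVec]
  exact (coercive_add h.coercive hP).nonneg _

omit [DecidableEq ι] [DecidableEq κ] in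
lemma stage_posSemidef (h : Weights W R r) (K : Matrix κ ι ℝ) : (W + Kᵀ * R * K).PosSemidef := by
  rw [posSemidef_iff_real]
  have hW := posSemidef_iff_real.1 h.state
  refine ⟨?_, fun x => ?_⟩
  · rw [Matrix.IsSymm, Matrix.transpose_add, hW.1.eq, Matrix.transpose_mul, Matrix.transpose_mul,
      Matrix.transpose_transpose, h.symm.eq, Matrix.mul_assoc]
  · rw [Matrix.add_mulVec, dotProduct_add, dotProduct_transpose_mul_mulVec]
    exact add_nonneg (hW.2 x) (h.coercive.nonneg _)

omit [DecidableEq κ] in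
lemma posSemidef_of_eval (h : Weights W R r) (hK : Schur (A - B * K))
    (hP : P = evalStep A B W R K P) : P.PosSemidef := by
  have hs := posSemidef_iff_real.1 (h.stage_posSemidef K)
  exact posSemidef_iff_real.2 ⟨hK.lyapunov_isSymm hP hs.1, hK.lyapunov_nonneg hP hs.2⟩

end Weights

omit [DecidableEq κ] in
lemma exists_eval (W : Matrix ι ι ℝ) (R : Matrix κ κ ℝ) (hK : Schur (A - B * K)) :
    ∃ P, P = evalStep A B W R K P :=
  hK.exists_lyapunov _

omit [DecidableEq ι] in
/-- Along an eigenpair that is not stable, a Lyapunov equation with semidefinite data is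
degenerate. -/
lemma quadratic_eq_zero_of_isEigenPair {X Y : Matrix ι ι ℝ} (h : X = Aᵀ * X * A + Y)
    (hX : ∀ x, 0 ≤ x ⬝ᵥ (X *ᵥ x)) (hY : ∀ x, 0 ≤ x ⬝ᵥ (Y *ᵥ x)) {α β : ℝ} {a b : ι → ℝ}
    (hab : IsEigenPair A α β a b) (h1 : 1 ≤ α ^ 2 + β ^ 2) :
    a ⬝ᵥ (Y *ᵥ a) ≤ 0 ∧ b ⬝ᵥ (Y *ᵥ b) ≤ 0 := by
  have e : ∀ x, x ⬝ᵥ (X *ᵥ x) = (A *ᵥ x) ⬝ᵥ (X *ᵥ (A *ᵥ x)) + x ⬝ᵥ (Y *ᵥ x) := by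
    intro x
    conv_lhs => rw [h]
    rw [Matrix.add_mulVec, dotProduct_add, dotProduct_transpose_mul_mulVec]
  have e2 : (A *ᵥ a) ⬝ᵥ (X *ᵥ (A *ᵥ a)) + (A *ᵥ b) ⬝ᵥ (X *ᵥ (A *ᵥ b)) =
      (α ^ 2 + β ^ 2) * (a ⬝ᵥ (X *ᵥ a) + b ⬝ᵥ (X *ᵥ b)) := by
    rw [hab.1, hab.2]
    simp only [Matrix.mulVec_sub, Matrix.mulVec_add, Matrix.mulVec_smul, add_dotProduct,
      dotProduct_add, sub_dotProduct, dotProduct_sub, smul_dotProduct, dotProduct_smul, smul_eq_mul]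
    ring
  have ha := e a
  have hb := e b
  have hs := add_nonneg (hX a) (hX b)
  have hge : (a ⬝ᵥ (X *ᵥ a) + b ⬝ᵥ (X *ᵥ b)) ≤
      (α ^ 2 + β ^ 2) * (a ⬝ᵥ (X *ᵥ a) + b ⬝ᵥ (X *ᵥ b)) := le_mul_of_one_le_left hs h1
  exact ⟨by linarith [hY b], by linarith [hY a]⟩

/-- Policy improvement keeps the closed loop stable. -/
lemma Weights.schur_greedy (h : Weights W R r) (hK : Schur (A - B * K))
    (hP : P = evalStep A B W R K P) : Schur (A - B * greedy A B R P) := by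
  have hPs := h.posSemidef_of_eval hK hP
  set G := greedy A B R P with hG
  have e := h.evalStep_greedy (A := A) (B := B) hPs K
  rw [← hP, evalStep, add_assoc] at e
  refine schur_of_isEigenPair fun α β a b hab h1 => ?_
  have hst := (posSemidef_iff_real.1 (h.stage_posSemidef G)).2
  have h0 := quadratic_eq_zero_of_isEigenPair e (posSemidef_iff_real.1 hPs).2 (fun x => by
    rw [Matrix.add_mulVec, dotProduct_add]
    exact add_nonneg (hst x) (h.loss_nonneg hPs _ x)) hab h1
  have hz : ∀ x, x ⬝ᵥ ((W + Gᵀ * R * G + (K - G)ᵀ * (R + Bᵀ * P * B) * (K - G)) *ᵥ x) ≤ 0 →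
      (K - G) *ᵥ x = 0 := by
    intro x hx
    rw [Matrix.add_mulVec, dotProduct_add, dotProduct_transpose_mul_mulVec] at hx
    exact (coercive_add h.coercive hPs).eq_zero (by linarith [hst x])
  have hA : ∀ x, (K - G) *ᵥ x = 0 → (A - B * K) *ᵥ x = (A - B * G) *ᵥ x := by
    intro x hx
    rw [Matrix.sub_mulVec, sub_eq_zero] at hx
    rw [Matrix.sub_mulVec, Matrix.sub_mulVec, ← Matrix.mulVec_mulVec, ← Matrix.mulVec_mulVec, hx]
  refine hK.eq_zero_of_isEigenPair ⟨?_, ?_⟩ h1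
  · rw [hA _ (hz a h0.1)]; exact hab.1
  · rw [hA _ (hz b h0.2)]; exact hab.2

omit [DecidableEq ι] [DecidableEq κ] in
lemma evalStep_sub {P P' : Matrix ι ι ℝ} :
    evalStep A B W R K P - evalStep A B W R K P' =
      (A - B * K)ᵀ * (P - P') * (A - B * K) := by
  rw [evalStep, evalStep, Matrix.mul_sub _ P P', Matrix.sub_mul _ _ (A - B * K)]
  abel

/-- The value function of a stabilizing gain exceeds every semidefinite fixed point of the Bellman
operator. -/
lemma Weights.le_of_eval {P' : Matrix ι ι ℝ} (h : Weights W R r) (hK : Schur (A - B * K))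
    (hP : P = evalStep A B W R K P) (hP's : P'.PosSemidef)
    (hP' : P' = evalStep A B W R (greedy A B R P') P') (x : ι → ℝ) :
    x ⬝ᵥ (P' *ᵥ x) ≤ x ⬝ᵥ (P *ᵥ x) := by
  have e := h.evalStep_greedy (A := A) (B := B) hP's K
  rw [← hP'] at e
  have e2 : P - P' = (A - B * K)ᵀ * (P - P') * (A - B * K) +
      (K - greedy A B R P')ᵀ * (R + Bᵀ * P' * B) * (K - greedy A B R P') := by
    rw [← evalStep_sub (W := W) (R := R), ← hP, e]; abel
  have := hK.lyapunov_nonneg e2 (h.loss_nonneg hP's _) x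
  rw [Matrix.sub_mulVec, dotProduct_sub] at this
  linarith

lemma Weights.eval_greedy_le {P' : Matrix ι ι ℝ} (h : Weights W R r) (hK : Schur (A - B * K))
    (hP : P = evalStep A B W R K P) (hP' : P' = evalStep A B W R (greedy A B R P) P')
    (x : ι → ℝ) : x ⬝ᵥ (P' *ᵥ x) ≤ x ⬝ᵥ (P *ᵥ x) := by
  have hPs := h.posSemidef_of_eval hK hP
  have e := h.evalStep_greedy (A := A) (B := B) hPs K
  rw [← hP] at e
  have e2 : P - P' = (A - B * greedy A B R P)ᵀ * (P - P') * (A - B * greedy A B R P) +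
      (K - greedy A B R P)ᵀ * (R + Bᵀ * P * B) * (K - greedy A B R P) := by
    rw [← evalStep_sub (W := W) (R := R), ← hP']
    conv_lhs => rw [e]
    abel
  have := (h.schur_greedy hK hP).lyapunov_nonneg e2 (h.loss_nonneg hPs _) x
  rw [Matrix.sub_mulVec, dotProduct_sub] at this
  linarith

/-- The Bellman operator has at most one semidefinite fixed point with stable closed loop. -/
lemma Weights.fixedPoint_unique {P' : Matrix ι ι ℝ} (h : Weights W R r)
    (hPs : P.PosSemidef) (hP : P = evalStep A B W R (greedy A B R P) P)
    (hK : Schur (A - B * greedy A B R P)) (hP's : P'.PosSemidef)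
    (hP' : P' = evalStep A B W R (greedy A B R P') P')
    (hK' : Schur (A - B * greedy A B R P')) : P = P' :=
  eq_of_quadratic_eq (posSemidef_iff_real.1 hPs).1 (posSemidef_iff_real.1 hP's).1 fun x =>
    le_antisymm (h.le_of_eval hK' hP' hPs hP x) (h.le_of_eval hK hP hP's hP' x)

omit [DecidableEq ι] in
lemma Weights.norm_greedy_sub_le {P' : Matrix ι ι ℝ} (h : Weights W R r) (hP : P.PosSemidef)
    (hP' : P'.PosSemidef) :
    r * ‖greedy A B R P - greedy A B R P'‖ ≤
      ‖B‖ * ‖P - P'‖ * ‖A - B * greedy A B R P'‖ := by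
  refine ((coercive_add (B := B) h.coercive hP).norm_le _).trans ?_
  have e : (R + Bᵀ * P * B) * (greedy A B R P - greedy A B R P') =
      Bᵀ * (P - P') * (A - B * greedy A B R P') := by
    have h2 := h.mul_greedy (A := A) (B := B) hP'
    rw [Matrix.mul_sub, h.mul_greedy hP]
    set G := greedy A B R P'
    have h3 : R * G = Bᵀ * P' * A - Bᵀ * P' * B * G := by
      rw [← h2, Matrix.add_mul]; abel
    rw [Matrix.add_mul, h3]
    simp only [Matrix.sub_mul, Matrix.mul_sub, Matrix.mul_assoc]
    abel
  rw [e]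
  refine (norm_mul_le' _ _).trans (mul_le_mul_of_nonneg_right ?_ (norm_nonneg _))
  refine (norm_mul_le' _ _).trans (le_of_eq ?_)
  rw [Matrix.frobenius_norm_transpose]

omit [DecidableEq ι] in
lemma Weights.tendsto_greedy (h : Weights W R r) {Ps : ℕ → Matrix ι ι ℝ}
    (hPs : ∀ j, (Ps j).PosSemidef) (hP : P.PosSemidef) (hlim : Tendsto Ps atTop (𝓝 P)) :
    Tendsto (fun j => greedy A B R (Ps j)) atTop (𝓝 (greedy A B R P)) := by
  have hlim := (tendsto_iff_norm_sub_tendsto_zero (E := Matrix ι ι ℝ)).1 hlim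
  refine (tendsto_iff_norm_sub_tendsto_zero (E := Matrix κ ι ℝ)).2 ?_
  have h1 : ∀ j, ‖greedy A B R (Ps j) - greedy A B R P‖ ≤
      (‖B‖ * ‖A - B * greedy A B R P‖ / r) * ‖Ps j - P‖ := by
    intro j
    have := h.norm_greedy_sub_le (A := A) (B := B) (hPs j) hP
    rw [div_mul_eq_mul_div, le_div_iff₀ h.coercive.1]
    linarith
  refine squeeze_zero (fun _ => norm_nonneg _) h1 ?_
  simpa using hlim.const_mul (‖B‖ * ‖A - B * greedy A B R P‖ / r)

lemma tendsto_of_quadratic_antitone {Ps : ℕ → Matrix ι ι ℝ} (hPs : ∀ j, (Ps j).PosSemidef)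
    (hmono : ∀ j x, x ⬝ᵥ (Ps (j + 1) *ᵥ x) ≤ x ⬝ᵥ (Ps j *ᵥ x)) :
    ∃ P : Matrix ι ι ℝ, P.PosSemidef ∧ Tendsto Ps atTop (𝓝 P) := by
  have hq : ∀ x : ι → ℝ, ∃ l, Tendsto (fun j => x ⬝ᵥ (Ps j *ᵥ x)) atTop (𝓝 l) := fun x =>
    ⟨_, tendsto_atTop_ciInf (antitone_nat_of_succ_le fun j => hmono j x)
      ⟨0, by rintro _ ⟨j, rfl⟩; exact (posSemidef_iff_real.1 (hPs j)).2 x⟩⟩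
  choose q hq using hq
  have e : ∀ j i l, (Ps j) i l =
      ((Pi.single i 1 + Pi.single l 1 : ι → ℝ) ⬝ᵥ (Ps j *ᵥ (Pi.single i 1 + Pi.single l 1)) -
        (Pi.single i 1 : ι → ℝ) ⬝ᵥ (Ps j *ᵥ Pi.single i 1) -
        (Pi.single l 1 : ι → ℝ) ⬝ᵥ (Ps j *ᵥ Pi.single l 1)) / 2 := by
    intro j i l
    have := (posSemidef_iff_real.1 (hPs j)).1.apply i l
    simp [Matrix.mulVec_add, add_dotProduct, this]
    ring
  set P : Matrix ι ι ℝ := Matrix.of fun i l => (q (Pi.single i 1 + Pi.single l 1) -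
    q (Pi.single i 1) - q (Pi.single l 1)) / 2
  have hlim : Tendsto Ps atTop (𝓝 P) := by
    refine tendsto_pi_nhds.2 fun i => tendsto_pi_nhds.2 fun l => ?_
    refine Tendsto.congr (fun j => (e j i l).symm) ?_
    exact (((hq _).sub (hq _)).sub (hq _)).div_const 2
  refine ⟨P, posSemidef_iff_real.2 ⟨?_, fun x => ?_⟩, hlim⟩
  · ext i l
    simp only [P, Matrix.transpose_apply, Matrix.of_apply, add_comm (Pi.single l 1 : ι → ℝ)]
    ring
  · have hc : Continuous fun Z : Matrix ι ι ℝ => x ⬝ᵥ (Z *ᵥ x) := by fun_prop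
    exact ge_of_tendsto' ((hc.tendsto P).comp hlim) fun j => (posSemidef_iff_real.1 (hPs j)).2 x

/-- `Ks, Ps` is a run of exact policy iteration. -/
structure IsPolicyIteration (A : Matrix ι ι ℝ) (B : Matrix ι κ ℝ) (W : Matrix ι ι ℝ)
    (R : Matrix κ κ ℝ) (Ks : ℕ → Matrix κ ι ℝ) (Ps : ℕ → Matrix ι ι ℝ) : Prop where
  schur_zero : Schur (A - B * Ks 0)
  eval : ∀ j, Ps j = evalStep A B W R (Ks j) (Ps j)
  improve : ∀ j, Ks (j + 1) = greedy A B R (Ps j)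

namespace IsPolicyIteration

variable {Ks : ℕ → Matrix κ ι ℝ} {Ps : ℕ → Matrix ι ι ℝ}

lemma schur (h : Weights W R r) (hI : IsPolicyIteration A B W R Ks Ps) (j : ℕ) :
    Schur (A - B * Ks j) := by
  induction j with
  | zero => exact hI.schur_zero
  | succ j ih => rw [hI.improve]; exact h.schur_greedy ih (hI.eval j)

lemma posSemidef (h : Weights W R r) (hI : IsPolicyIteration A B W R Ks Ps) (j : ℕ) :
    (Ps j).PosSemidef :=
  h.posSemidef_of_eval (hI.schur h j) (hI.eval j)

/-- Policy iteration decreases the value functions; the limit is a fixed point. -/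
lemma exists_tendsto (h : Weights W R r) (hI : IsPolicyIteration A B W R Ks Ps) :
    ∃ P : Matrix ι ι ℝ, P.PosSemidef ∧ P = evalStep A B W R (greedy A B R P) P ∧
      Tendsto Ps atTop (𝓝 P) := by
  obtain ⟨P, hP, hlim⟩ := tendsto_of_quadratic_antitone (hI.posSemidef h) fun j x =>
    h.eval_greedy_le (hI.schur h j) (hI.eval j) (by rw [← hI.improve]; exact hI.eval (j + 1)) x
  refine ⟨P, hP, ?_, hlim⟩
  have hg := h.tendsto_greedy (A := A) (B := B) (hI.posSemidef h) hP hlim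
  have h1 : Tendsto (fun j => Ps (j + 1)) atTop (𝓝 P) := hlim.comp (tendsto_add_atTop_nat 1)
  have hc : Continuous fun Z : Matrix κ ι ℝ × Matrix ι ι ℝ => evalStep A B W R Z.1 Z.2 := by
    unfold evalStep; fun_prop
  have h2 := (hc.tendsto (greedy A B R P, P)).comp (hg.prodMk_nhds h1)
  refine tendsto_nhds_unique h1 (h2.congr fun j => ?_)
  change evalStep A B W R (greedy A B R (Ps j)) (Ps (j + 1)) = Ps (j + 1)
  rw [← hI.improve]
  exact (hI.eval (j + 1)).symm

/-- Policy iteration converges to any stabilizing fixed point. -/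
lemma tendsto (h : Weights W R r) (hI : IsPolicyIteration A B W R Ks Ps) (hPs : P.PosSemidef)
    (hP : P = evalStep A B W R (greedy A B R P) P) (hK : Schur (A - B * greedy A B R P)) :
    Tendsto Ks atTop (𝓝 (greedy A B R P)) := by
  obtain ⟨P', hP's, hP', hlim⟩ := hI.exists_tendsto h
  have e : P' = P := by
    refine eq_of_quadratic_eq (posSemidef_iff_real.1 hP's).1 (posSemidef_iff_real.1 hPs).1
      fun x => le_antisymm (h.le_of_eval hK hP hP's hP' x) ?_
    have hc : Continuous fun Z : Matrix ι ι ℝ => x ⬝ᵥ (Z *ᵥ x) := by fun_prop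
    exact ge_of_tendsto' ((hc.tendsto P').comp hlim) fun j =>
      h.le_of_eval (hI.schur h j) (hI.eval j) hPs hP x
  rw [e] at hlim
  have hg := h.tendsto_greedy (A := A) (B := B) (hI.posSemidef h) hPs hlim
  rw [← tendsto_add_atTop_iff_nat 1]
  exact hg.congr fun j => (hI.improve j).symm

end IsPolicyIteration

lemma exists_isPolicyIteration (h : Weights W R r) {K0 : Matrix κ ι ℝ}
    (hK0 : Schur (A - B * K0)) :
    ∃ Ks Ps, Ks 0 = K0 ∧ IsPolicyIteration A B W R Ks Ps := by
  classical
  have hex : ∀ K : Matrix κ ι ℝ, ∃ P : Matrix ι ι ℝ,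
      Schur (A - B * K) → P = evalStep A B W R K P := by
    intro K
    by_cases hK : Schur (A - B * K)
    · obtain ⟨P, hP⟩ := exists_eval W R hK
      exact ⟨P, fun _ => hP⟩
    · exact ⟨0, fun h => absurd h hK⟩
  choose V hV using hex
  let Ks : ℕ → Matrix κ ι ℝ := fun j => Nat.rec K0 (fun _ K => greedy A B R (V K)) j
  have hS : ∀ j, Schur (A - B * Ks j) := by
    intro j
    induction j with
    | zero => exact hK0
    | succ j ih => exact h.schur_greedy ih (hV _ ih)
  exact ⟨Ks, fun j => V (Ks j), rfl, hK0, fun j => hV _ (hS j), fun j => rfl⟩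

omit [DecidableEq ι] [DecidableEq κ] in
lemma norm_transpose_mul_mul_le (D E : Matrix κ ι ℝ) (S : Matrix κ κ ℝ) :
    ‖Dᵀ * S * E‖ ≤ ‖D‖ * ‖S‖ * ‖E‖ := by
  refine (norm_mul_le' _ _).trans (mul_le_mul_of_nonneg_right ?_ (norm_nonneg _))
  refine (norm_mul_le' _ _).trans (le_of_eq ?_)
  rw [Matrix.frobenius_norm_transpose]

/-- Local behaviour of policy evaluation at a stabilizing gain `K`. The estimate of `P' - P` is
linear in `K' - K` in general, and quadratic if `K` is its own improvement. -/
lemma Weights.exists_eval_nhds (h : Weights W R r) (hK : Schur (A - B * K))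
    (hP : P = evalStep A B W R K P) :
    ∃ δ > 0, ∃ c > 0, ∀ K' : Matrix κ ι ℝ, ‖K' - K‖ < δ → Schur (A - B * K') ∧
      (∀ X : Matrix ι ι ℝ, ‖X‖ ≤ c * ‖X - (A - B * K')ᵀ * X * (A - B * K')‖) ∧
      ∀ P', P' = evalStep A B W R K' P' →
        ‖P' - P‖ ≤ c * (‖K' - K‖ ^ 2 + ‖K - greedy A B R P‖ * ‖K' - K‖) := by
  have hPs := h.posSemidef_of_eval hK hP
  obtain ⟨δ1, hδ1, h1⟩ := hK.exists_nhds
  obtain ⟨δ2, hδ2, c, hc, h2⟩ := hK.exists_lyapunov_norm_le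
  set G := greedy A B R P
  set S := R + Bᵀ * P * B
  refine ⟨min δ1 δ2 / (‖B‖ + 1), by positivity, c * (1 + 2 * ‖S‖), by positivity,
    fun K' hK' => ?_⟩
  have hn : ‖(A - B * K') - (A - B * K)‖ < min δ1 δ2 := by
    have e : (A - B * K') - (A - B * K) = -(B * (K' - K)) := by
      rw [Matrix.mul_sub]; abel
    rw [e, norm_neg]
    refine (norm_mul_le' _ _).trans_lt ?_
    have := (lt_div_iff₀ (by positivity)).1 hK'
    nlinarith [norm_nonneg (K' - K), norm_nonneg B]
  have hA1 := h1 _ (hn.trans_le (min_le_left _ _))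
  have hA2 := h2 _ (hn.trans_le (min_le_right _ _))
  refine ⟨hA1, fun X => (hA2 X).trans ?_, fun P' hP' => ?_⟩
  · refine mul_le_mul_of_nonneg_right ?_ (norm_nonneg _)
    have := norm_nonneg S
    nlinarith
  · have e1 := h.evalStep_greedy (A := A) (B := B) hPs K'
    have e2 := h.evalStep_greedy (A := A) (B := B) hPs K
    rw [← hP] at e2
    have e3 := evalStep_sub (A := A) (B := B) (W := W) (R := R) (K := K') (P := P') (P' := P)
    rw [← hP'] at e3
    -- both sides are compared with the Bellman minimum at `P`, attained by the greedy gain `G`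
    have e4 : P' - P - (A - B * K')ᵀ * (P' - P) * (A - B * K') =
        (K' - K)ᵀ * S * (K' - K) + (K' - K)ᵀ * S * (K - G) + (K - G)ᵀ * S * (K' - K) := by
      have e6 : P' - P - (A - B * K')ᵀ * (P' - P) * (A - B * K') = evalStep A B W R K' P - P := by
        rw [← e3]; abel
      rw [e6]
      refine (congrArg₂ (· - ·) e1 e2).trans ?_
      simp only [Matrix.transpose_sub, Matrix.sub_mul, Matrix.mul_sub]
      abel
    refine (hA2 _).trans ?_
    rw [e4]
    have h5 : ‖(K' - K)ᵀ * S * (K' - K) + (K' - K)ᵀ * S * (K - G) + (K - G)ᵀ * S * (K' - K)‖ ≤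
        ‖K' - K‖ * ‖S‖ * ‖K' - K‖ + ‖K' - K‖ * ‖S‖ * ‖K - G‖ + ‖K - G‖ * ‖S‖ * ‖K' - K‖ :=
      norm_add₃_le.trans (add_le_add (add_le_add (norm_transpose_mul_mul_le _ _ _)
        (norm_transpose_mul_mul_le _ _ _)) (norm_transpose_mul_mul_le _ _ _))
    refine (mul_le_mul_of_nonneg_left h5 hc.le).trans ?_
    rw [mul_assoc c]
    refine mul_le_mul_of_nonneg_left ?_ hc.le
    have p1 := norm_nonneg S
    have p2 := norm_nonneg (K' - K)
    have p3 := mul_nonneg (norm_nonneg (K - G)) p2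
    have p4 := mul_nonneg p2 p2
    have p5 := mul_nonneg p1 p4
    nlinarith

omit [DecidableEq ι] in
/-- The cost of one step with an arbitrary input, at a fixed point of the Bellman operator. -/
lemma Weights.stage_eq (h : Weights W R r) (hPs : P.PosSemidef)
    (hP : P = evalStep A B W R (greedy A B R P) P) (x : ι → ℝ) (u : κ → ℝ) :
    x ⬝ᵥ (W *ᵥ x) + u ⬝ᵥ (R *ᵥ u) =
      x ⬝ᵥ (P *ᵥ x) - (A *ᵥ x + B *ᵥ u) ⬝ᵥ (P *ᵥ (A *ᵥ x + B *ᵥ u)) +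
      (u + greedy A B R P *ᵥ x) ⬝ᵥ ((R + Bᵀ * P * B) *ᵥ (u + greedy A B R P *ᵥ x)) := by
  have hsymm := (posSemidef_iff_real.1 hPs).1
  have hG := h.mul_greedy (A := A) (B := B) hPs
  have e := evalStep_expand (W := W) (K := greedy A B R P) h.symm hsymm hG
  rw [← hP] at e
  set G := greedy A B R P
  set S := R + Bᵀ * P * B with hSdef
  have hSs : Sᵀ = S := (isSymm_add_mul h.symm hsymm).eq
  have e1 : x ⬝ᵥ (P *ᵥ x) = (A *ᵥ x) ⬝ᵥ (P *ᵥ (A *ᵥ x)) + x ⬝ᵥ (W *ᵥ x) -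
      (G *ᵥ x) ⬝ᵥ (S *ᵥ (G *ᵥ x)) := by
    have e' : P = Aᵀ * P * A + W - Gᵀ * S * G := by
      conv_lhs => rw [e]
      rw [Matrix.mul_assoc Gᵀ]; abel
    conv_lhs => rw [e']
    rw [Matrix.sub_mulVec, Matrix.add_mulVec, dotProduct_sub, dotProduct_add,
      dotProduct_transpose_mul_mulVec, dotProduct_transpose_mul_mulVec]
  have e2 : u ⬝ᵥ (S *ᵥ (G *ᵥ x)) = (B *ᵥ u) ⬝ᵥ (P *ᵥ (A *ᵥ x)) := by
    rw [Matrix.mulVec_mulVec, hG, dotProduct_transpose_mul_mulVec]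
  have hcomm : ∀ (M : Matrix ι ι ℝ), Mᵀ = M → ∀ v w, v ⬝ᵥ (M *ᵥ w) = w ⬝ᵥ (M *ᵥ v) := by
    intro M hM v w
    rw [Matrix.dotProduct_mulVec, ← Matrix.mulVec_transpose, hM, dotProduct_comm]
  have e3 : (G *ᵥ x) ⬝ᵥ (S *ᵥ u) = (A *ᵥ x) ⬝ᵥ (P *ᵥ (B *ᵥ u)) := by
    rw [Matrix.dotProduct_mulVec, ← Matrix.mulVec_transpose, hSs, dotProduct_comm, e2]
    exact hcomm P hsymm _ _
  have e4 : u ⬝ᵥ (S *ᵥ u) = u ⬝ᵥ (R *ᵥ u) + (B *ᵥ u) ⬝ᵥ (P *ᵥ (B *ᵥ u)) := by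
    rw [hSdef, Matrix.add_mulVec, dotProduct_add, dotProduct_transpose_mul_mulVec]
  simp only [Matrix.mulVec_add, add_dotProduct, dotProduct_add]
  linarith

omit [DecidableEq ι] in
/-- The algebraic Riccati equation is the fixed-point equation of the Bellman operator. -/
lemma Weights.riccati_iff (h : Weights W R r) (hPs : P.PosSemidef) :
    Aᵀ * P * B * (R + Bᵀ * P * B)⁻¹ * Bᵀ * P * A = W + Aᵀ * P * A - P ↔
      P = evalStep A B W R (greedy A B R P) P := by
  have hsymm := (posSemidef_iff_real.1 hPs).1
  have hG := h.mul_greedy (A := A) (B := B) hPs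
  have e := evalStep_expand (W := W) (K := greedy A B R P) h.symm hsymm hG
  have e2 : (greedy A B R P)ᵀ * ((R + Bᵀ * P * B) * greedy A B R P) =
      Aᵀ * P * B * (R + Bᵀ * P * B)⁻¹ * Bᵀ * P * A := by
    rw [hG, greedy]
    rw [Matrix.transpose_mul, Matrix.transpose_mul, Matrix.transpose_mul, hsymm.eq,
      Matrix.transpose_nonsing_inv, (isSymm_add_mul h.symm hsymm).eq, Matrix.transpose_transpose]
    simp only [Matrix.mul_assoc]
  rw [e, e2]
  set Z := Aᵀ * P * B * (R + Bᵀ * P * B)⁻¹ * Bᵀ * P * A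
  constructor
  · intro h1; rw [h1]; abel
  · intro h1
    have h2 : P = W + Aᵀ * P * A - Z := by
      conv_lhs => rw [h1]
      abel
    have : P + Z = W + Aᵀ * P * A := by
      conv_lhs => rw [h2]
      abel
    rw [← this]; abel

end LQ

/-! ### Observability and reachability -/

section Observability

lemma eq_zero_of_rank_eq_card {𝕜 ι κ : Type*} [Field 𝕜] [Fintype ι] [Fintype κ]
    {M : Matrix κ ι 𝕜} (h : M.rank = Fintype.card ι) {v : ι → 𝕜} (hv : M *ᵥ v = 0) : v = 0 := by
  have h1 := M.mulVecLin.finrank_range_add_finrank_ker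
  rw [Module.finrank_fintype_fun_eq_card] at h1
  have h2 : Module.finrank 𝕜 (LinearMap.ker M.mulVecLin) = 0 := by
    rw [Matrix.rank] at h; omega
  have h3 : v ∈ LinearMap.ker M.mulVecLin := by simpa using hv
  rw [Submodule.finrank_eq_zero.1 h2] at h3
  simpa using h3

variable {ι κ : Type*} [Fintype ι] [DecidableEq ι] [Fintype κ]

/-- Observability in the form of the Popov–Belevitch–Hautus test: no complex eigenvector of `A`
lies in the kernel of `C`. -/
def PairObservable (A : Matrix ι ι ℝ) (C : Matrix κ ι ℝ) : Prop :=
  ∀ (α β : ℝ) (a b : ι → ℝ), IsEigenPair A α β a b → C *ᵥ a = 0 → C *ᵥ b = 0 → a = 0 ∧ b = 0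

lemma Controllable.eq_zero {A : Matrix ι ι ℝ} {B : Matrix ι κ ℝ} (h : Controllable A B)
    {v : ι → ℝ} (hv : ∀ k : ℕ, v ᵥ* (A ^ k * B) = 0) : v = 0 := by
  rw [Controllable, ← Matrix.rank_transpose] at h
  refine eq_zero_of_rank_eq_card h ?_
  rw [Matrix.mulVec_transpose]
  funext kj
  exact congrFun (hv kj.1) kj.2

lemma Observable.eq_zero {A : Matrix ι ι ℝ} {C : Matrix κ ι ℝ} (h : Observable A C)
    {v : ι → ℝ} (hv : ∀ k : ℕ, C *ᵥ (A ^ k *ᵥ v) = 0) : v = 0 := by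
  refine Controllable.eq_zero h fun k => ?_
  rw [← Matrix.transpose_pow, ← Matrix.transpose_mul, Matrix.vecMul_transpose,
    ← Matrix.mulVec_mulVec]
  exact hv k

lemma Observable.pairObservable {A : Matrix ι ι ℝ} {C : Matrix κ ι ℝ} (h : Observable A C) :
    PairObservable A C := by
  intro α β a b hab ha hb
  have key : ∀ k : ℕ, C *ᵥ (A ^ k *ᵥ a) = 0 ∧ C *ᵥ (A ^ k *ᵥ b) = 0 := by
    intro k
    induction k with
    | zero => simpa using ⟨ha, hb⟩
    | succ k ih =>
      rw [pow_succ, ← Matrix.mulVec_mulVec, ← Matrix.mulVec_mulVec, hab.1, hab.2]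
      simp [Matrix.mulVec_sub, Matrix.mulVec_add, Matrix.mulVec_smul, ih.1, ih.2]
  exact ⟨h.eq_zero fun k => (key k).1, h.eq_zero fun k => (key k).2⟩

lemma Controllable.pairObservable_transpose {A : Matrix ι ι ℝ} {B : Matrix ι κ ℝ}
    (h : Controllable A B) : PairObservable Aᵀ Bᵀ :=
  Observable.pairObservable <| by
    rwa [Observable, Matrix.transpose_transpose, Matrix.transpose_transpose]

/-- A nonzero invariant subspace contains an eigenpair. -/
lemma exists_isEigenPair_mem (A : Matrix ι ι ℝ) {U : Submodule ℝ (ι → ℝ)} (hU : U ≠ ⊥)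
    (hA : ∀ u ∈ U, A *ᵥ u ∈ U) :
    ∃ (α β : ℝ) (a b : ι → ℝ), a ∈ U ∧ b ∈ U ∧ ¬(a = 0 ∧ b = 0) ∧ IsEigenPair A α β a b := by
  let V : Submodule ℂ (ι → ℂ) :=
    { carrier := {v | (fun i => (v i).re) ∈ U ∧ (fun i => (v i).im) ∈ U}
      add_mem' := fun {v w} hv hw => ⟨U.add_mem hv.1 hw.1, U.add_mem hv.2 hw.2⟩
      zero_mem' := ⟨U.zero_mem, U.zero_mem⟩
      smul_mem' := fun c v hv => by
        constructor
        · have := U.sub_mem (U.smul_mem c.re hv.1) (U.smul_mem c.im hv.2)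
          convert this using 1
          funext i
          simp
        · have := U.add_mem (U.smul_mem c.re hv.2) (U.smul_mem c.im hv.1)
          convert this using 1
          funext i
          simp }
  have hmem : ∀ v : ι → ℂ, v ∈ V ↔ (fun i => (v i).re) ∈ U ∧ (fun i => (v i).im) ∈ U :=
    fun v => Iff.rfl
  have hmap : ∀ v ∈ V, (Matrix.toLin' (A.map (algebraMap ℝ ℂ))) v ∈ V := by
    intro v hv
    have e := map_ofReal_mulVec A (fun i => (v i).re) (fun i => (v i).im)
    rw [Matrix.toLin'_apply]
    have e2 : (fun i => (⟨(v i).re, (v i).im⟩ : ℂ)) = v := rfl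
    rw [e2] at e
    rw [e, hmem]
    exact ⟨hA _ hv.1, hA _ hv.2⟩
  have hne : V ≠ ⊥ := by
    obtain ⟨u, hu, hu0⟩ := (Submodule.ne_bot_iff U).1 hU
    refine (Submodule.ne_bot_iff V).2 ⟨fun i => (u i : ℂ), ⟨?_, ?_⟩, ?_⟩
    · simpa using hu
    · exact U.zero_mem
    · intro h
      exact hu0 (funext fun i => by simpa using congrFun h i)
  have : Nontrivial V := Submodule.nontrivial_iff_ne_bot.2 hne
  obtain ⟨μ, hμ⟩ := Module.End.exists_eigenvalue
    ((Matrix.toLin' (A.map (algebraMap ℝ ℂ))).restrict hmap)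
  obtain ⟨v, hv⟩ := hμ.exists_hasEigenvector
  have hv2 := congrArg Subtype.val hv.apply_eq_smul
  refine ⟨μ.re, μ.im, fun i => (v.1 i).re, fun i => (v.1 i).im, v.2.1, v.2.2, ?_, ?_⟩
  · rintro ⟨h1, h2⟩
    exact hv.2 (Subtype.ext (funext fun i => Complex.ext (congrFun h1 i) (congrFun h2 i)))
  · rw [isEigenPair_iff]
    exact hv2

/-- `(A, B)` is reachable: the only invariant subspace that contains the range of `B` is the whole
space. -/
def Reachable (A : Matrix ι ι ℝ) (B : Matrix ι κ ℝ) : Prop :=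
  ∀ W : Submodule ℝ (ι → ℝ), (∀ w ∈ W, A *ᵥ w ∈ W) → (∀ u, B *ᵥ u ∈ W) → W = ⊤

/-- The dual Hautus test: an invariant proper subspace containing the range of `B` would have a
nonzero annihilator, which contains an eigenpair of `Aᵀ`. -/
lemma PairObservable.reachable {A : Matrix ι ι ℝ} {B : Matrix ι κ ℝ}
    (h : PairObservable Aᵀ Bᵀ) : Reachable A B := by
  intro W hW hB
  by_contra hne
  let U : Submodule ℝ (ι → ℝ) :=
    { carrier := {v | ∀ w ∈ W, v ⬝ᵥ w = 0}
      add_mem' := fun {v v'} hv hv' w hw => by rw [add_dotProduct, hv w hw, hv' w hw, add_zero]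
      zero_mem' := fun w _ => zero_dotProduct w
      smul_mem' := fun c v hv w hw => by rw [smul_dotProduct, hv w hw, smul_zero] }
  have hU : U ≠ ⊥ := by
    obtain ⟨f, hf0, hf⟩ := Submodule.exists_le_ker_of_lt_top W (lt_top_iff_ne_top.2 hne)
    have hfv : ∀ w, (fun i => f (Pi.single i 1)) ⬝ᵥ w = f w := by
      intro w
      conv_rhs => rw [pi_eq_sum_univ' w, map_sum]
      simp [dotProduct, mul_comm]
    refine (Submodule.ne_bot_iff U).2 ⟨fun i => f (Pi.single i 1), fun w hw => ?_, fun h0 => ?_⟩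
    · rw [hfv]; exact hf hw
    · exact hf0 (LinearMap.ext fun w => by rw [← hfv, h0, zero_dotProduct]; rfl)
  obtain ⟨α, β, a, b, ha, hb, h0, hab⟩ := exists_isEigenPair_mem Aᵀ hU fun u hu w hw => by
    rw [Matrix.mulVec_transpose, ← Matrix.dotProduct_mulVec]
    exact hu _ (hW w hw)
  have hz : ∀ v ∈ U, Bᵀ *ᵥ v = 0 := by
    intro v hv
    refine dotProduct_self_eq_zero.1 ?_
    conv_lhs => rw [Matrix.mulVec_transpose, ← Matrix.dotProduct_mulVec]
    exact hv _ (hB _)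
  exact h0 (h α β a b hab (hz a ha) (hz b hb))

end Observability

/-! ### Reduction to a single input -/

section Heymann

variable {ι κ : Type*} [Fintype ι] [DecidableEq ι] [Fintype κ]

/-- By feedback, any number of Krylov vectors of a reachable system can be made linearly
independent. If the last vector is dependent on the earlier ones, these span an invariant subspace;
some `B u` lies outside, and a rank-one feedback, invisible to the vectors before the last one, adds
it to the next vector. -/
lemma Reachable.exists_linearIndependent {A : Matrix ι ι ℝ} {B : Matrix ι κ ℝ}
    (h : Reachable A B) (k : ℕ) (hk : k ≤ Fintype.card ι) :
    ∃ (F : Matrix κ ι ℝ) (v : κ → ℝ),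
      LinearIndependent ℝ fun i : Fin k => (A + B * F) ^ (i : ℕ) *ᵥ (B *ᵥ v) := by
  induction k with
  | zero => exact ⟨0, 0, linearIndependent_empty_type⟩
  | succ k ih =>
    obtain ⟨F, v, hli⟩ := ih (by omega)
    set AF := A + B * F with hAF
    set x : Fin k → ι → ℝ := fun i => AF ^ (i : ℕ) *ᵥ (B *ᵥ v) with hx
    set W := Submodule.span ℝ (Set.range x) with hW
    have hsnoc : ∀ (F' : Matrix κ ι ℝ) (v' : κ → ℝ),
        (∀ i : Fin k, (A + B * F') ^ (i : ℕ) *ᵥ (B *ᵥ v') = x i) →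
        (A + B * F') ^ k *ᵥ (B *ᵥ v') ∉ W →
        LinearIndependent ℝ fun i : Fin (k + 1) => (A + B * F') ^ (i : ℕ) *ᵥ (B *ᵥ v') := by
      intro F' v' h1 h2
      have e : (fun i : Fin (k + 1) => (A + B * F') ^ (i : ℕ) *ᵥ (B *ᵥ v')) =
          Fin.snoc x ((A + B * F') ^ k *ᵥ (B *ᵥ v')) := by
        funext i
        refine Fin.lastCases ?_ (fun i => ?_) i
        · simp
        · simp [h1]
      rw [e]
      exact hli.finSnoc h2
    -- unless the next vector depends on the earlier ones, the feedback need not be changed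
    by_cases hmem : AF ^ k *ᵥ (B *ᵥ v) ∈ W
    swap
    · exact ⟨F, v, hsnoc F v (fun i => rfl) hmem⟩
    have hinv : ∀ w ∈ W, AF *ᵥ w ∈ W := by
      intro w hw
      induction hw using Submodule.span_induction with
      | mem w hw =>
        obtain ⟨i, rfl⟩ := hw
        simp only [hx]
        rw [← pow_succ_mulVec]
        by_cases hi : (i : ℕ) + 1 = k
        · rw [hi]; exact hmem
        · exact Submodule.subset_span ⟨⟨i + 1, by omega⟩, rfl⟩
      | zero => rw [Matrix.mulVec_zero]; exact W.zero_mem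
      | add a b _ _ ha hb => rw [Matrix.mulVec_add]; exact W.add_mem ha hb
      | smul c a _ ha => rw [Matrix.mulVec_smul]; exact W.smul_mem c ha
    obtain ⟨u, hu⟩ : ∃ u, B *ᵥ u ∉ W := by
      by_contra hall
      push Not at hall
      have htop := h W (fun w hw => by
        have e : A *ᵥ w = AF *ᵥ w - B *ᵥ (F *ᵥ w) := by
          rw [hAF, Matrix.add_mulVec, Matrix.mulVec_mulVec]; abel
        rw [e]
        exact W.sub_mem (hinv w hw) (hall _)) hall
      have h1 : Module.finrank ℝ W ≤ k := by
        simpa [Set.finrank] using finrank_range_le_card (R := ℝ) x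
      rw [htop, finrank_top, Module.finrank_fintype_fun_eq_card] at h1
      omega
    rcases Nat.eq_zero_or_pos k with hk0 | hk0
    · subst hk0
      exact ⟨F, u, hsnoc F u (fun i => i.elim0) (by simpa using hu)⟩
    let last : Fin k := ⟨k - 1, by omega⟩
    -- `f` is the coordinate along the last Krylov vector; the feedback `u fᵀ` acts there only
    obtain ⟨f, hf⟩ := LinearMap.exists_extend ((Finsupp.lapply last).comp
      (hli.repr : Submodule.span ℝ (Set.range x) →ₗ[ℝ] Fin k →₀ ℝ))
    have hfx : ∀ i, f (x i) = if i = last then 1 else 0 := by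
      intro i
      have hxi : x i ∈ Submodule.span ℝ (Set.range x) := Submodule.subset_span ⟨i, rfl⟩
      have e := LinearMap.congr_fun hf ⟨x i, hxi⟩
      rw [LinearMap.comp_apply, Submodule.subtype_apply] at e
      rw [e, LinearMap.comp_apply, hli.repr_eq_single i ⟨x i, hxi⟩ rfl]
      simp [Finsupp.single_apply]
    set g : ι → ℝ := fun i => f (Pi.single i 1) with hg
    have hfv : ∀ w, g ⬝ᵥ w = f w := by
      intro w
      conv_rhs => rw [pi_eq_sum_univ' w, map_sum]
      simp [hg, dotProduct, mul_comm]
    have hF' : ∀ w, (A + B * (F + Matrix.vecMulVec u g)) *ᵥ w = AF *ᵥ w + f w • (B *ᵥ u) := by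
      intro w
      have : Matrix.vecMulVec u g *ᵥ w = f w • u := by
        funext i
        rw [← hfv]
        simp only [Matrix.mulVec, Matrix.vecMulVec_apply, dotProduct, Finset.sum_mul,
          Pi.smul_apply, smul_eq_mul]
        exact Finset.sum_congr rfl fun _ _ => by ring
      rw [hAF, Matrix.mul_add, ← add_assoc, Matrix.add_mulVec, ← Matrix.mulVec_mulVec, this,
        Matrix.mulVec_smul]
    have hpow : ∀ i : ℕ, i < k →
        (A + B * (F + Matrix.vecMulVec u g)) ^ i *ᵥ (B *ᵥ v) = AF ^ i *ᵥ (B *ᵥ v) := by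
      intro i
      induction i with
      | zero => intro _; simp
      | succ i ih =>
        intro hi
        rw [pow_succ_mulVec, ih (by omega), hF', ← pow_succ_mulVec]
        have := hfx ⟨i, by omega⟩
        rw [if_neg (fun he => by
          have := congrArg Fin.val he
          simp [last] at this
          omega)] at this
        simp only [hx] at this
        rw [this, zero_smul, add_zero]
    refine ⟨F + Matrix.vecMulVec u g, v, hsnoc _ v (fun i => hpow i i.2) fun hmem' => hu ?_⟩
    obtain ⟨k', rfl⟩ : ∃ k', k = k' + 1 := ⟨k - 1, by omega⟩
    rw [pow_succ_mulVec, hpow k' (by omega), hF', ← pow_succ_mulVec] at hmem'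
    have := hfx last
    rw [if_pos rfl] at this
    simp only [hx, last, Nat.add_sub_cancel] at this
    rw [this, one_smul] at hmem'
    exact (W.add_mem_iff_right hmem).1 hmem'

/-- Heymann's lemma: a reachable system becomes reachable from a single input by feedback. -/
lemma Reachable.exists_single {A : Matrix ι ι ℝ} {B : Matrix ι κ ℝ} (h : Reachable A B) :
    ∃ (F : Matrix κ ι ℝ) (v : κ → ℝ), ∀ W : Submodule ℝ (ι → ℝ),
      (∀ w ∈ W, (A + B * F) *ᵥ w ∈ W) → B *ᵥ v ∈ W → W = ⊤ := by
  obtain ⟨F, v, hli⟩ := h.exists_linearIndependent _ le_rfl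
  refine ⟨F, v, fun W hW hv => ?_⟩
  have htop := hli.span_eq_top_of_card_eq_finrank' (by simp)
  rw [eq_top_iff, ← htop, Submodule.span_le]
  rintro _ ⟨i, rfl⟩
  have : ∀ i : ℕ, (A + B * F) ^ i *ᵥ (B *ᵥ v) ∈ W := by
    intro i
    induction i with
    | zero => simpa using hv
    | succ i ih => rw [pow_succ_mulVec]; exact hW _ ih
  exact this i

end Heymann

/-! ### Companion matrices and the parameterization matrix -/

section Companion

variable {N : ℕ}

/-- The characteristic polynomial of a companion matrix is read off by applying the
Cayley–Hamilton theorem to the first unit row vector, whose Krylov vectors are the unit vectors. -/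
lemma coeff_charpoly_companion (c : Fin N → ℝ) (l : Fin N) :
    (companion c).charpoly.coeff l = c (Fin.rev l) := by
  let e : ℕ → Fin N → ℝ := fun k l => if (l : ℕ) = k then 1 else 0
  have hN : 0 < N := l.pos
  have hcol : ∀ (k : ℕ) (hk : k < N) j, (e k ᵥ* companion c) j = companion c ⟨k, hk⟩ j := by
    intro k hk j
    rw [Matrix.vecMul, dotProduct, Finset.sum_eq_single ⟨k, hk⟩]
    · simp [e]
    · intro i _ hi
      have : (i : ℕ) ≠ k := fun h => hi (Fin.ext h)
      simp [e, this]
    · simp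
  have hpow : ∀ k : ℕ, k < N → e 0 ᵥ* companion c ^ k = e k := by
    intro k
    induction k with
    | zero => intro _; simp
    | succ k ih =>
      intro hk
      rw [pow_succ, ← Matrix.vecMul_vecMul, ih (by omega)]
      funext j
      rw [hcol k (by omega) j]
      have h1 : k + 1 ≠ N := by omega
      simp only [companion, Matrix.of_apply, h1, if_false, e]
      exact if_congr eq_comm rfl rfl
  have hlast : e 0 ᵥ* companion c ^ N = fun j => -c (Fin.rev j) := by
    obtain ⟨k, rfl⟩ : ∃ k, N = k + 1 := ⟨N - 1, by omega⟩
    rw [pow_succ, ← Matrix.vecMul_vecMul, hpow k (by omega)]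
    funext j
    rw [hcol k (by omega) j]
    simp [companion]
  have hCH := Matrix.aeval_self_charpoly (companion c)
  have : Nonempty (Fin N) := ⟨l⟩
  have hdeg : (companion c).charpoly.natDegree = N := by
    simp [Matrix.charpoly_natDegree_eq_dim]
  rw [Polynomial.aeval_eq_sum_range, hdeg, Finset.sum_range_succ] at hCH
  have hlead : (companion c).charpoly.coeff N = 1 := by
    have := (Matrix.charpoly_monic (companion c)).coeff_natDegree
    rwa [hdeg] at this
  have h1 := congrFun (congrArg (fun Z => e 0 ᵥ* Z) hCH) l
  simp only [Matrix.vecMul_add, hlast, hlead, one_smul, Matrix.vecMul_zero,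
    Pi.add_apply, Pi.zero_apply] at h1
  have h2 : (e 0 ᵥ* ∑ i ∈ Finset.range N, (companion c).charpoly.coeff i • companion c ^ i) =
      ∑ i ∈ Finset.range N, (companion c).charpoly.coeff i • e i := by
    rw [Matrix.vecMul_sum]
    refine Finset.sum_congr rfl fun i hi => ?_
    rw [Matrix.vecMul_smul, hpow i (Finset.mem_range.1 hi)]
  rw [h2, Finset.sum_apply, Finset.sum_eq_single (l : ℕ)] at h1
  · simp [e] at h1
    linarith
  · intro i _ hi
    simp [e, hi.symm]
  · intro h; exact absurd (Finset.mem_range.2 l.2) h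

/-- The input matrix of a bank of `a` filters: the `j`-th input enters the last coordinate of the
`j`-th filter. -/
def filterInput (a N : ℕ) : Matrix (Fin a × Fin N) (Fin a) ℝ :=
  Matrix.of fun il j => if il.1 = j then lastVec N il.2 else 0

lemma filterStep_eq {a : ℕ} (c : Fin N → ℝ) (ζ : Fin a × Fin N → ℝ) (v : Fin a → ℝ) :
    filterStep c ζ v = ((1 : Matrix (Fin a) (Fin a) ℝ) ⊗ₖ companion c) *ᵥ ζ +
      filterInput a N *ᵥ v := by
  rw [filterStep]
  congr 1
  funext il
  simp [filterInput, Matrix.mulVec, dotProduct, mul_comm]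

variable {ι : Type*} [Fintype ι] [DecidableEq ι] {a : ℕ}

/-- The coefficient vectors of `adj(zI - A) W` satisfy `e_{l-1} - A e_l = p_l W`, with `p` the
characteristic polynomial of `A`. -/
lemma coeff_adjugate_charmatrix (Ao : Matrix ι ι ℝ) (W : Matrix ι (Fin a) ℝ) (i : ι) (j : Fin a) :
    (∀ l : ℕ, (((Matrix.charmatrix Ao).adjugate * W.map Polynomial.C) i j).coeff l -
      ∑ k, Ao i k * (((Matrix.charmatrix Ao).adjugate * W.map Polynomial.C) k j).coeff (l + 1) =
        Ao.charpoly.coeff (l + 1) * W i j) ∧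
    - ∑ k, Ao i k * (((Matrix.charmatrix Ao).adjugate * W.map Polynomial.C) k j).coeff 0 =
        Ao.charpoly.coeff 0 * W i j := by
  set E := (Matrix.charmatrix Ao).adjugate * W.map Polynomial.C with hE
  have h : Matrix.charmatrix Ao * E = Ao.charpoly • W.map Polynomial.C := by
    rw [hE, ← Matrix.mul_assoc, Matrix.mul_adjugate, Matrix.smul_mul, Matrix.one_mul]
    rfl
  have hij := congrFun (congrFun h i) j
  have e : (Matrix.charmatrix Ao * E) i j =
      Polynomial.X * E i j - ∑ k, Polynomial.C (Ao i k) * E k j := by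
    rw [Matrix.charmatrix, Matrix.sub_mul, Matrix.sub_apply]
    congr 1
    · simp [Matrix.scalar_apply]
  rw [e, Matrix.smul_apply, Matrix.map_apply, smul_eq_mul] at hij
  constructor
  · intro l
    have := congrArg (fun q => Polynomial.coeff q (l + 1)) hij
    simpa [Polynomial.coeff_X_mul, Polynomial.finsetSum_coeff] using this
  · have := congrArg (fun q => Polynomial.coeff q 0) hij
    simpa [Polynomial.finsetSum_coeff] using this

/-- The coefficients of `adj(zI - A) W` stop before degree `N`, and the last one is `W`. -/
lemma coeff_adjugate_charmatrix_top (hN : Fintype.card ι = N) (Ao : Matrix ι ι ℝ)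
    (W : Matrix ι (Fin a) ℝ) (i : ι) (j : Fin a) (l : ℕ) (hl : l + 1 = N) :
    (((Matrix.charmatrix Ao).adjugate * W.map Polynomial.C) i j).coeff l = W i j := by
  have hrec := fun i => (coeff_adjugate_charmatrix Ao W i j).1
  set E := (Matrix.charmatrix Ao).adjugate * W.map Polynomial.C with hE
  have hdeg : Ao.charpoly.natDegree = N := by
    rw [Matrix.charpoly_natDegree_eq_dim, hN]
  have hz : ∀ k t : ℕ, N ≤ t → (Finset.univ.sup fun i => (E i j).natDegree) < t + k →
      ∀ i, (E i j).coeff t = 0 := by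
    intro k
    induction k with
    | zero =>
      intro t _ ht i
      refine Polynomial.coeff_eq_zero_of_natDegree_lt (lt_of_le_of_lt ?_ ht)
      exact Finset.le_sup (f := fun i => (E i j).natDegree) (Finset.mem_univ i)
    | succ k ih =>
      intro t ht hk i
      have h1 := hrec i t
      have h2 := ih (t + 1) (by omega) (by omega)
      simp only [h2, mul_zero, Finset.sum_const_zero, sub_zero] at h1
      rw [h1, Polynomial.coeff_eq_zero_of_natDegree_lt (by omega), zero_mul]
  have h1 := hrec i l
  have h2 := hz ((Finset.univ.sup fun i => (E i j).natDegree) + 1) (l + 1) hl.ge (by omega)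
  simp only [h2, mul_zero, Finset.sum_const_zero, sub_zero] at h1
  rw [h1, hl]
  have hlead := (Matrix.charpoly_monic Ao).coeff_natDegree
  rw [hdeg] at hlead
  rw [hlead, one_mul]

lemma paramBlock_mul_filterInput (hN : Fintype.card ι = N) (Ao : Matrix ι ι ℝ)
    (W : Matrix ι (Fin a) ℝ) : paramBlock N Ao W * filterInput a N = W := by
  ext i j
  have hpos : 0 < N := hN ▸ Fintype.card_pos_iff.2 ⟨i⟩
  rw [Matrix.mul_apply, Fintype.sum_prod_type, Finset.sum_eq_single j]
  · rw [Finset.sum_eq_single ⟨N - 1, by omega⟩]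
    · have h1 : N - 1 + 1 = N := by omega
      simp only [paramBlock, filterInput, Matrix.of_apply, lastVec, h1, if_true, mul_one]
      exact coeff_adjugate_charmatrix_top hN Ao W i j _ h1
    · intro l _ hl
      have : (l : ℕ) + 1 ≠ N := fun h => hl (Fin.ext (by simp; omega))
      simp [filterInput, lastVec, this]
    · simp
  · intro j' _ hj'
    simp [filterInput, hj']
  · simp

/-- The parameterization matrix intertwines the filters with `A`, when the companion matrix has the
characteristic polynomial of `A`. -/
lemma paramBlock_mul_kronecker (hN : Fintype.card ι = N) (Ao : Matrix ι ι ℝ)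
    (W : Matrix ι (Fin a) ℝ) {c : Fin N → ℝ} (hc : Ao.charpoly = (companion c).charpoly) :
    paramBlock N Ao W * ((1 : Matrix (Fin a) (Fin a) ℝ) ⊗ₖ companion c) =
      Ao * paramBlock N Ao W := by
  ext i ⟨j, l⟩
  have hl := l.2
  have htop := coeff_adjugate_charmatrix_top hN Ao W i j
  have hrec := coeff_adjugate_charmatrix Ao W i j
  have hp : Ao.charpoly.coeff l = c (Fin.rev l) := by rw [hc, coeff_charpoly_companion]
  rw [Matrix.mul_apply, Fintype.sum_prod_type, Finset.sum_eq_single j]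
  rotate_left
  · intro j' _ hj'
    simp [hj']
  · simp
  simp only [Matrix.kronecker_apply, Matrix.one_apply_eq, one_mul]
  rw [Matrix.mul_apply]
  simp only [paramBlock, Matrix.of_apply]
  set E := (Matrix.charmatrix Ao).adjugate * W.map Polynomial.C with hE
  have hcomp : ∀ l' : Fin N, companion c l' l =
      (if l' = ⟨N - 1, by omega⟩ then -c (Fin.rev l) else 0) +
        (if (l' : ℕ) + 1 = l then 1 else 0) := by
    intro l'
    have hl' := l'.2
    simp only [companion, Matrix.of_apply]
    by_cases h1 : (l' : ℕ) + 1 = N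
    · have h2 : l' = ⟨N - 1, by omega⟩ := Fin.ext (by simp; omega)
      rw [if_pos h1, if_pos h2, if_neg (by omega), add_zero]
    · have h2 : l' ≠ ⟨N - 1, by omega⟩ := fun h => h1 (by rw [h]; simp; omega)
      rw [if_neg h1, if_neg h2, zero_add]
  simp only [hcomp, mul_add, Finset.sum_add_distrib, mul_ite, mul_zero, mul_one]
  rw [Finset.sum_ite_eq' Finset.univ, if_pos (Finset.mem_univ _), htop (N - 1) (by omega), ← hp]
  rcases Nat.eq_zero_or_pos (l : ℕ) with h0 | h0
  · rw [Finset.sum_eq_zero (fun l' _ => if_neg (by omega)), h0, add_zero, mul_neg, mul_comm,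
      ← hrec.2, neg_neg]
  · rw [Finset.sum_eq_single ⟨(l : ℕ) - 1, by omega⟩]
    · have h1 : (l : ℕ) - 1 + 1 = l := by omega
      have h2 := hrec.1 ((l : ℕ) - 1)
      rw [h1] at h2
      simp only [h1, if_true]
      linarith
    · intro l' _ hl'
      rw [if_neg]
      intro h
      exact hl' (Fin.ext (by simp; omega))
    · simp

/-- A reachable system is brought to any companion form by state feedback. After reduction to a
single input `b`, the coefficient vectors of `adj(zI - A) b` form a basis in which `A` is a companion
matrix and `b` the last unit vector. -/
lemma Reachable.exists_charpoly_eq {κ : Type*} [Fintype κ] {A : Matrix ι ι ℝ} {B : Matrix ι κ ℝ}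
    (h : Reachable A B) (hN : Fintype.card ι = N) (c : Fin N → ℝ) :
    ∃ K : Matrix κ ι ℝ, (A - B * K).charpoly = (companion c).charpoly := by
  obtain ⟨F, v, hcyc⟩ := h.exists_single
  set AF := A + B * F with hAF
  set b := B *ᵥ v with hb
  set W : Matrix ι (Fin 1) ℝ := Matrix.of fun i _ => b i with hW
  let ca : Fin N → ℝ := fun l => AF.charpoly.coeff (Fin.rev l : Fin N)
  let M : Matrix ι (Fin N) ℝ := Matrix.of fun i l => paramBlock N AF W i (0, l)
  have hdeg : ∀ (A' : Matrix ι ι ℝ), A'.charpoly.natDegree = N := fun A' => by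
    rw [Matrix.charpoly_natDegree_eq_dim, hN]
  have hca : AF.charpoly = (companion ca).charpoly := by
    ext k
    rcases lt_trichotomy k N with hk | hk | hk
    · have := coeff_charpoly_companion ca ⟨k, hk⟩
      rw [this]
      simp only [ca, Fin.rev_rev]
    · have h1 := (Matrix.charpoly_monic AF).coeff_natDegree
      have h2 := (Matrix.charpoly_monic (companion ca)).coeff_natDegree
      rw [Matrix.charpoly_natDegree_eq_dim, hN] at h1
      rw [Matrix.charpoly_natDegree_eq_dim, Fintype.card_fin] at h2
      rw [hk, h1, h2]
    · rw [Polynomial.coeff_eq_zero_of_natDegree_lt (by rwa [hdeg]),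
        Polynomial.coeff_eq_zero_of_natDegree_lt (by
          rwa [Matrix.charpoly_natDegree_eq_dim, Fintype.card_fin])]
  -- the parameterization matrix of the single input intertwines `AF` with its companion matrix
  have hM1 : M * companion ca = AF * M := by
    have h1 := paramBlock_mul_kronecker hN AF W hca
    ext i l
    have := congrFun (congrFun h1 i) (0, l)
    rw [Matrix.mul_apply, Fintype.sum_prod_type] at this
    simpa [M, Matrix.mul_apply] using this
  have hM2 : M *ᵥ lastVec N = b := by
    have h1 := paramBlock_mul_filterInput hN AF W
    funext i
    have := congrFun (congrFun h1 i) 0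
    rw [Matrix.mul_apply, Fintype.sum_prod_type] at this
    simpa [M, Matrix.mulVec, dotProduct, filterInput, W] using this
  -- the range of `M` is invariant and contains `b`, so reachability makes `M` invertible
  have hsurj : ∀ w, ∃ x, M *ᵥ x = w := by
    have htop := hcyc (LinearMap.range M.mulVecLin) (by
      rintro _ ⟨x, rfl⟩
      refine ⟨companion ca *ᵥ x, ?_⟩
      simp only [Matrix.mulVecLin_apply, Matrix.mulVec_mulVec, hM1]) ⟨lastVec N, hM2⟩
    intro w
    have : w ∈ LinearMap.range M.mulVecLin := htop ▸ Submodule.mem_top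
    obtain ⟨x, hx⟩ := this
    exact ⟨x, hx⟩
  choose g hg using hsurj
  let H : Matrix (Fin N) ι ℝ := Matrix.of fun l i => g (Pi.single i 1) l
  have hMH : M * H = 1 := by
    ext i i'
    have := congrFun (hg (Pi.single i' 1)) i
    rw [Matrix.one_apply]
    simpa [Matrix.mul_apply, H, Matrix.mulVec, dotProduct, Pi.single_apply] using this
  have hHM : H * M = 1 :=
    (Matrix.mul_eq_one_comm_of_card_eq _ _ _ (by rw [hN, Fintype.card_fin])).1 hMH
  -- companion matrices differ in their last row only, that is, by a feedback through `lastVec`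
  let g' : Matrix (Fin 1) (Fin N) ℝ := Matrix.of fun _ l => c (Fin.rev l) - ca (Fin.rev l)
  have hcomp : companion c = companion ca - Matrix.of (fun l (_ : Fin 1) => lastVec N l) * g' := by
    ext l l'
    rw [Matrix.sub_apply, Matrix.mul_apply]
    simp only [companion, Matrix.of_apply, lastVec, g', Finset.univ_unique,
      Finset.sum_singleton]
    split_ifs <;> ring
  refine ⟨-F + Matrix.of (fun k (_ : Fin 1) => v k) * g' * H, ?_⟩
  have hML : M * Matrix.of (fun l (_ : Fin 1) => lastVec N l) =
      B * Matrix.of fun k (_ : Fin 1) => v k := by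
    ext i j
    exact congrFun hM2 i
  have key : A - B * (-F + Matrix.of (fun k (_ : Fin 1) => v k) * g' * H) =
      M * (companion c * H) := by
    have e1 : AF = M * companion ca * H := by
      rw [hM1, Matrix.mul_assoc, hMH, Matrix.mul_one]
    have e2 : A = AF - B * F := by rw [hAF]; abel
    rw [hcomp, Matrix.sub_mul, Matrix.mul_sub, ← Matrix.mul_assoc M, ← e1, e2, Matrix.mul_add,
      Matrix.mul_neg, ← Matrix.mul_assoc M, ← Matrix.mul_assoc M, hML, ← Matrix.mul_assoc B,
      ← Matrix.mul_assoc B]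
    abel
  rw [key, Matrix.charpoly_mul_comm_of_le]
  · rw [Matrix.mul_assoc, hHM, Matrix.mul_one, hN, Fintype.card_fin, Nat.sub_self, pow_zero,
      one_mul]
  · rw [hN, Fintype.card_fin]

end Companion

/-! ### The augmented system -/

section Augmented

lemma IsEigenPair.map {ι κ : Type*} [Fintype ι] [Fintype κ] {A : Matrix ι ι ℝ} {A' : Matrix κ κ ℝ}
    {M : Matrix κ ι ℝ} {α β : ℝ} {a b : ι → ℝ} (hab : IsEigenPair A α β a b)
    (h : M * A = A' * M) : IsEigenPair A' α β (M *ᵥ a) (M *ᵥ b) := by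
  constructor
  · rw [Matrix.mulVec_mulVec, ← h, ← Matrix.mulVec_mulVec, hab.1, Matrix.mulVec_sub,
      Matrix.mulVec_smul, Matrix.mulVec_smul]
  · rw [Matrix.mulVec_mulVec, ← h, ← Matrix.mulVec_mulVec, hab.2, Matrix.mulVec_add,
      Matrix.mulVec_smul, Matrix.mulVec_smul]

/-- The Hautus test for the interconnection of a plant with an internal model. The condition `hinj`
says that no eigenvalue of `F` is a transmission zero of `(A, B, C)`. -/
lemma pairObservable_fromBlocks {ι ρ κ l : Type*} [Fintype ι] [Fintype ρ] [DecidableEq ι]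
    [DecidableEq ρ] [Fintype κ] [Fintype l] {A : Matrix ι ι ℝ} {B : Matrix ι κ ℝ}
    {C : Matrix l ι ℝ} {F : Matrix ρ ρ ℝ} (G : Matrix ρ l ℝ) {T : Matrix κ ρ ℝ}
    (hAC : PairObservable A C) (hFT : PairObservable F T)
    (hinj : ∀ (α β : ℝ), (⟨α, β⟩ : ℂ) ∈ cspec F → ∀ (x x' : ι → ℝ) (u u' : κ → ℝ),
      A *ᵥ x + B *ᵥ u = α • x - β • x' → A *ᵥ x' + B *ᵥ u' = β • x + α • x' →
      C *ᵥ x = 0 → C *ᵥ x' = 0 → (x = 0 ∧ x' = 0) ∧ u = 0 ∧ u' = 0) :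
    PairObservable (Matrix.fromBlocks A (-(B * T)) (-(G * C)) F) (Matrix.fromCols C 0) := by
  intro α β a b hab ha hb
  obtain ⟨x, z, rfl⟩ : ∃ x z, a = Sum.elim x z := ⟨a ∘ Sum.inl, a ∘ Sum.inr, by simp⟩
  obtain ⟨x', z', rfl⟩ : ∃ x z, b = Sum.elim x z := ⟨b ∘ Sum.inl, b ∘ Sum.inr, by simp⟩
  rw [Matrix.fromCols_mulVec, Matrix.zero_mulVec, add_zero, Sum.elim_comp_inl] at ha hb
  have h1 := hab.1
  have h2 := hab.2
  rw [Matrix.fromBlocks_mulVec] at h1 h2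
  simp only [Sum.elim_comp_inl, Sum.elim_comp_inr, Matrix.neg_mulVec, ← Matrix.mulVec_mulVec,
    ha, hb, Matrix.mulVec_zero, neg_zero, zero_add] at h1 h2
  have h1x : A *ᵥ x + -(B *ᵥ (T *ᵥ z)) = α • x - β • x' := by
    funext i; exact congrFun h1 (Sum.inl i)
  have h1z : F *ᵥ z = α • z - β • z' := by
    funext i; exact congrFun h1 (Sum.inr i)
  have h2x : A *ᵥ x' + -(B *ᵥ (T *ᵥ z')) = β • x + α • x' := by
    funext i; exact congrFun h2 (Sum.inl i)
  have h2z : F *ᵥ z' = β • z + α • z' := by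
    funext i; exact congrFun h2 (Sum.inr i)
  have hzz : z = 0 ∧ z' = 0 := by
    by_contra h0
    have hμ := mem_cspec_of_isEigenPair (A := F) ⟨h1z, h2z⟩ h0
    have h3 := hinj α β hμ x x' (-(T *ᵥ z)) (-(T *ᵥ z')) (by rw [Matrix.mulVec_neg, h1x])
      (by rw [Matrix.mulVec_neg, h2x]) ha hb
    exact h0 (hFT α β z z' ⟨h1z, h2z⟩ (neg_eq_zero.1 h3.2.1) (neg_eq_zero.1 h3.2.2))
  obtain ⟨rfl, rfl⟩ := hzz
  simp only [Matrix.mulVec_zero, neg_zero, add_zero] at h1x h2x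
  obtain ⟨rfl, rfl⟩ := hAC α β x x' ⟨h1x, h2x⟩ ha hb
  constructor <;> exact Sum.elim_zero_zero

/-- A rank condition on the Rosenbrock matrix, in real and imaginary parts. -/
lemma eq_zero_of_rosenbrock {ι κ l : Type*} [Fintype ι] [DecidableEq ι] [Fintype κ] [Fintype l]
    {A : Matrix ι ι ℝ} {B : Matrix ι κ ℝ} {C : Matrix l ι ℝ} {α β : ℝ}
    (h : (Matrix.fromBlocks
        (A.map (algebraMap ℝ ℂ) - (⟨α, β⟩ : ℂ) • (1 : Matrix ι ι ℂ))
        (B.map (algebraMap ℝ ℂ)) (C.map (algebraMap ℝ ℂ)) (0 : Matrix l κ ℂ)).rank =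
          Fintype.card (ι ⊕ κ))
    {x x' : ι → ℝ} {u u' : κ → ℝ}
    (h1 : A *ᵥ x + B *ᵥ u = α • x - β • x') (h2 : A *ᵥ x' + B *ᵥ u' = β • x + α • x')
    (h3 : C *ᵥ x = 0) (h4 : C *ᵥ x' = 0) : (x = 0 ∧ x' = 0) ∧ u = 0 ∧ u' = 0 := by
  have key := eq_zero_of_rank_eq_card h
    (v := Sum.elim (fun i => (⟨x i, x' i⟩ : ℂ)) (fun i => (⟨u i, u' i⟩ : ℂ))) (by
      rw [Matrix.fromBlocks_mulVec, Sum.elim_comp_inl, Sum.elim_comp_inr, Matrix.sub_mulVec,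
        map_ofReal_mulVec A, map_ofReal_mulVec B, map_ofReal_mulVec C, Matrix.smul_mulVec,
        Matrix.one_mulVec, Matrix.zero_mulVec, add_zero, h3, h4]
      funext i
      rcases i with i | i
      · have e1 := congrFun h1 i
        have e2 := congrFun h2 i
        simp only [Pi.add_apply, Pi.sub_apply, Pi.smul_apply, smul_eq_mul] at e1 e2
        simp only [Sum.elim_inl, Pi.add_apply, Pi.sub_apply, Pi.smul_apply, smul_eq_mul,
          Pi.zero_apply]
        apply Complex.ext
        · simp only [Complex.add_re, Complex.sub_re, Complex.mul_re, Complex.zero_re]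
          linarith
        · simp only [Complex.add_im, Complex.sub_im, Complex.mul_im, Complex.zero_im]
          linarith
      · rfl)
  refine ⟨⟨funext fun i => ?_, funext fun i => ?_⟩, funext fun i => ?_, funext fun i => ?_⟩
  · simpa using congrArg Complex.re (congrFun key (Sum.inl i))
  · simpa using congrArg Complex.im (congrFun key (Sum.inl i))
  · simpa using congrArg Complex.re (congrFun key (Sum.inr i))
  · simpa using congrArg Complex.im (congrFun key (Sum.inr i))

end Augmented

/-! ### Internal models -/

section InternalModel

variable {p q d : ℕ}

lemma blockDiagonal_mulVec (β : Fin p → Matrix (Fin d) (Fin d) ℝ) (v : Fin d × Fin p → ℝ)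
    (a : Fin d) (i : Fin p) :
    (Matrix.blockDiagonal β *ᵥ v) (a, i) = (β i *ᵥ fun a => v (a, i)) a := by
  simp only [Matrix.mulVec, dotProduct, Matrix.blockDiagonal_apply, Fintype.sum_prod_type]
  refine Finset.sum_congr rfl fun a' _ => ?_
  rw [Finset.sum_eq_single i]
  · simp
  · intro j _ hj
    simp [hj.symm]
  · simp

lemma isEigenPair_block {β : Fin p → Matrix (Fin d) (Fin d) ℝ} {α γ : ℝ}
    {a b : Fin d × Fin p → ℝ} (h : IsEigenPair (Matrix.blockDiagonal β) α γ a b) (i : Fin p) :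
    IsEigenPair (β i) α γ (fun x => a (x, i)) (fun x => b (x, i)) := by
  constructor
  · funext x
    have := congrFun h.1 (x, i)
    rwa [blockDiagonal_mulVec] at this
  · funext x
    have := congrFun h.2 (x, i)
    rwa [blockDiagonal_mulVec] at this

variable {S : Matrix (Fin q) (Fin q) ℝ} {F : Matrix (Fin d × Fin p) (Fin d × Fin p) ℝ}
  {G : Matrix (Fin d × Fin p) (Fin p) ℝ}

lemma IsInternalModel.mem_cspec (h : IsInternalModel S F G) {μ : ℂ} (hμ : μ ∈ cspec F) :
    μ ∈ cspec S := by
  obtain ⟨β, σ, hβ, rfl, -⟩ := h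
  obtain ⟨a, b, h0, hab⟩ := exists_isEigenPair_of_mem_cspec hμ
  by_contra hS
  refine h0 ⟨funext fun x => ?_, funext fun x => ?_⟩
  all_goals
    by_contra hx
    refine hS ((hβ x.2).2.2 ?_)
    refine mem_cspec_of_isEigenPair (isEigenPair_block hab x.2) fun hz => hx ?_
  · exact congrFun hz.1 x.1
  · exact congrFun hz.2 x.1

lemma IsInternalModel.pairObservable_transpose (h : IsInternalModel S F G) :
    PairObservable Fᵀ Gᵀ := by
  obtain ⟨β, σ, hβ, rfl, rfl⟩ := h
  intro α γ a b hab ha hb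
  rw [Matrix.blockDiagonal_transpose] at hab
  have hG : ∀ (v : Fin d × Fin p → ℝ),
      (Matrix.of fun (a : Fin d × Fin p) (j : Fin p) => if a.2 = j then σ j a.1 else 0)ᵀ *ᵥ v = 0 →
      ∀ i, (Matrix.of fun a (_ : Unit) => σ i a)ᵀ *ᵥ (fun x => v (x, i)) = 0 := by
    intro v hv i
    funext _
    have := congrFun hv i
    simp only [Matrix.mulVec, dotProduct, Matrix.transpose_apply, Matrix.of_apply,
      Fintype.sum_prod_type, ite_mul, zero_mul, Finset.sum_ite_eq', Finset.mem_univ, if_true]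
      at this ⊢
    exact this
  have key : ∀ i, (fun x => a (x, i)) = 0 ∧ (fun x => b (x, i)) = 0 := fun i =>
    (hβ i).1.pairObservable_transpose α γ _ _ (isEigenPair_block hab i) (hG a ha i) (hG b hb i)
  exact ⟨funext fun x => congrFun (key x.2).1 x.1, funext fun x => congrFun (key x.2).2 x.1⟩

/-- One copy of the internal model: a Sylvester equation `β X - X S = σ ρ` has no solution unless
`ρ = 0`. Let `w` satisfy `w β^k σ = 0` for `k + 1 < d` and `w β^(d-1) σ = 1`. Then
`w β^k X - w X S^k` vanishes for `k < d` and equals `ρ` for `k = d`; summing with the coefficients of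
the characteristic polynomial of `β`, which annihilates `β` and `S`, gives `ρ = 0`. -/
lemma eq_zero_of_sylvester {β : Matrix (Fin d) (Fin d) ℝ} {σ : Fin d → ℝ}
    (hβ : Controllable β (Matrix.of fun a (_ : Unit) => σ a)) (hdvd : minpoly ℝ S ∣ β.charpoly)
    {X : Matrix (Fin d) (Fin q) ℝ} {ρ : Fin q → ℝ}
    (h : β * X - X * S = Matrix.vecMulVec σ ρ) : ρ = 0 := by
  have hSφ : Polynomial.aeval S β.charpoly = 0 := by
    obtain ⟨r, hr⟩ := hdvd
    rw [hr, map_mul, minpoly.aeval, zero_mul]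
  rcases Nat.eq_zero_or_pos d with hd | hd
  · subst hd
    have h1 : β.charpoly = 1 := by
      rw [Matrix.charpoly, Matrix.det_isEmpty]
    rw [h1, map_one] at hSφ
    have := congrArg (fun Z => ρ ᵥ* Z) hSφ
    simpa using this
  set D := ctrbMatrix β (Matrix.of fun a (_ : Unit) => σ a) with hD
  have hinj : Function.Injective (D.vecMulLinear) := by
    refine (injective_iff_map_eq_zero _).2 fun v hv => ?_
    have h1 : Dᵀ.rank = Fintype.card (Fin d) := by rw [Matrix.rank_transpose]; exact hβ
    refine eq_zero_of_rank_eq_card h1 ?_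
    rw [Matrix.mulVec_transpose]
    exact hv
  have hsurj := (LinearMap.injective_iff_surjective_of_finrank_eq_finrank (by simp)).1 hinj
  obtain ⟨w, hw⟩ := hsurj fun kj => if (kj.1 : ℕ) + 1 = d then 1 else 0
  have hwk : ∀ k : ℕ, k < d → (w ᵥ* β ^ k) ⬝ᵥ σ = if k + 1 = d then 1 else 0 := by
    intro k hk
    have h1 := congrFun hw (⟨k, by simpa using hk⟩, ())
    rw [← h1, ← Matrix.dotProduct_mulVec, Matrix.vecMulLinear_apply]
    rfl
  let y : ℕ → Fin q → ℝ := fun k => (w ᵥ* β ^ k) ᵥ* X - (w ᵥ* X) ᵥ* S ^ k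
  have hy : ∀ k, y (k + 1) = y k ᵥ* S + ((w ᵥ* β ^ k) ⬝ᵥ σ) • ρ := by
    intro k
    have e : β * X = X * S + Matrix.vecMulVec σ ρ := by rw [← h]; abel
    have e2 : (w ᵥ* β ^ k) ᵥ* Matrix.vecMulVec σ ρ = ((w ᵥ* β ^ k) ⬝ᵥ σ) • ρ := by
      rw [Matrix.vecMul_vecMulVec]
    simp only [y]
    rw [pow_succ, pow_succ, ← Matrix.vecMul_vecMul w, Matrix.vecMul_vecMul _ β X, e,
      Matrix.vecMul_add, e2, Matrix.sub_vecMul, Matrix.vecMul_vecMul _ X S,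
      Matrix.vecMul_vecMul _ (S ^ k) S]
    abel
  have hy0 : ∀ k, k < d → y k = 0 := by
    intro k
    induction k with
    | zero => intro _; simp [y]
    | succ k ih =>
      intro hk
      rw [hy, ih (by omega), hwk k (by omega), if_neg (by omega), Matrix.zero_vecMul, zero_smul,
        add_zero]
  have hyd : y d = ρ := by
    obtain ⟨k, rfl⟩ : ∃ k, d = k + 1 := ⟨d - 1, by omega⟩
    rw [hy, hy0 k (by omega), hwk k (by omega), if_pos rfl, Matrix.zero_vecMul, one_smul,
      zero_add]
  have : Nonempty (Fin d) := ⟨⟨0, hd⟩⟩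
  have hdeg : β.charpoly.natDegree = d := by
    simp [Matrix.charpoly_natDegree_eq_dim]
  have hlead := (Matrix.charpoly_monic β).coeff_natDegree
  rw [hdeg] at hlead
  have hsum : ∑ k ∈ Finset.range (d + 1), β.charpoly.coeff k • y k = 0 := by
    have h1 := Matrix.aeval_self_charpoly β
    rw [Polynomial.aeval_eq_sum_range, hdeg] at h1 hSφ
    have h2 := congrArg (fun Z => (w ᵥ* Z) ᵥ* X) h1
    have h3 := congrArg (fun Z => (w ᵥ* X) ᵥ* Z) hSφ
    simp only [Matrix.vecMul_sum, Matrix.sum_vecMul, Matrix.vecMul_smul, Matrix.smul_vecMul,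
      Matrix.vecMul_zero, Matrix.zero_vecMul] at h2 h3
    simp only [y, smul_sub, Finset.sum_sub_distrib, h2, h3, sub_zero]
  rw [Finset.sum_range_succ, Finset.sum_eq_zero, zero_add, hlead, one_smul, hyd] at hsum
  · exact hsum
  · intro k hk
    rw [hy0 k (Finset.mem_range.1 hk), smul_zero]

/-- The internal model principle: a steady state of the internal model forces its input to
vanish. -/
lemma IsInternalModel.eq_zero (h : IsInternalModel S F G) {X : Matrix (Fin d × Fin p) (Fin q) ℝ}
    {Δ : Matrix (Fin p) (Fin q) ℝ} (hX : F * X - X * S = G * Δ) : Δ = 0 := by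
  obtain ⟨β, σ, hβ, rfl, rfl⟩ := h
  ext i j
  refine congrFun (eq_zero_of_sylvester (hβ i).1 (hβ i).2.1
    (X := Matrix.of fun a j => X (a, i) j) (ρ := Δ i) ?_) j
  ext a j
  have := congrFun (congrFun hX (a, i)) j
  rw [Matrix.sub_apply, Matrix.mul_apply, Matrix.mul_apply, Matrix.mul_apply] at this
  rw [Matrix.sub_apply, Matrix.mul_apply, Matrix.mul_apply, Matrix.vecMulVec_apply]
  simp only [Matrix.blockDiagonal_apply, Fintype.sum_prod_type, Matrix.of_apply, ite_mul, zero_mul,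
    Finset.sum_ite_eq, Finset.mem_univ, if_true] at this ⊢
  exact this

end InternalModel

/-! ### Optimality of the Riccati gain -/

section Optimal

variable {ι κ o : Type*} [Fintype ι] [DecidableEq ι] [Fintype κ] [DecidableEq κ] [Fintype o]
  {A P : Matrix ι ι ℝ} {B : Matrix ι κ ℝ} {C : Matrix o ι ℝ} {Q : Matrix o o ℝ}
  {R : Matrix κ κ ℝ} {r rq : ℝ}

omit [DecidableEq ι] [DecidableEq κ] in
lemma Weights.stage_nonneg {W : Matrix ι ι ℝ} (h : Weights W R r) (x : ι → ℝ) (u : κ → ℝ) :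
    0 ≤ x ⬝ᵥ (W *ᵥ x) + u ⬝ᵥ (R *ᵥ u) :=
  add_nonneg ((posSemidef_iff_real.1 h.state).2 x) (h.coercive.nonneg u)

omit [DecidableEq ι] in
/-- The cost over a finite horizon. -/
lemma Weights.sum_stage_eq {W : Matrix ι ι ℝ} (h : Weights W R r) (hPs : P.PosSemidef)
    (hP : P = evalStep A B W R (greedy A B R P) P) {e : ℕ → ι → ℝ} {u : ℕ → κ → ℝ}
    (he : ∀ k, e (k + 1) = A *ᵥ e k + B *ᵥ u k) (T : ℕ) :
    ∑ k ∈ Finset.range T, (e k ⬝ᵥ (W *ᵥ e k) + u k ⬝ᵥ (R *ᵥ u k)) =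
      e 0 ⬝ᵥ (P *ᵥ e 0) - e T ⬝ᵥ (P *ᵥ e T) +
      ∑ k ∈ Finset.range T, (u k + greedy A B R P *ᵥ e k) ⬝ᵥ
        ((R + Bᵀ * P * B) *ᵥ (u k + greedy A B R P *ᵥ e k)) := by
  induction T with
  | zero => simp
  | succ T ih =>
    rw [Finset.sum_range_succ, Finset.sum_range_succ, ih, h.stage_eq hPs hP, ← he]
    ring

omit [DecidableEq ι] [DecidableEq κ] in
lemma posSemidef_output (hQ : Q.PosSemidef) : (Cᵀ * Q * C).PosSemidef := by
  rw [posSemidef_iff_real] at hQ ⊢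
  refine ⟨?_, fun x => ?_⟩
  · rw [Matrix.IsSymm, Matrix.transpose_mul, Matrix.transpose_mul, Matrix.transpose_transpose,
      hQ.1.eq, Matrix.mul_assoc]
  · rw [dotProduct_transpose_mul_mulVec]
    exact hQ.2 _

/-- For an observable output, a semidefinite fixed point of the Bellman operator has a stable closed
loop. -/
lemma Weights.schur_of_fixedPoint (h : Weights (Cᵀ * Q * C) R r) (hQ : Coercive rq Q)
    (hAC : PairObservable A C) (hPs : P.PosSemidef)
    (hP : P = evalStep A B (Cᵀ * Q * C) R (greedy A B R P) P) :
    Schur (A - B * greedy A B R P) := by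
  set G := greedy A B R P
  refine schur_of_isEigenPair fun α β a b hab h1 => ?_
  have h0 := quadratic_eq_zero_of_isEigenPair hP (posSemidef_iff_real.1 hPs).2
    (posSemidef_iff_real.1 (h.stage_posSemidef G)).2 hab h1
  have hz : ∀ x, x ⬝ᵥ ((Cᵀ * Q * C + Gᵀ * R * G) *ᵥ x) ≤ 0 →
      C *ᵥ x = 0 ∧ (A - B * G) *ᵥ x = A *ᵥ x := by
    intro x hx
    rw [Matrix.add_mulVec, dotProduct_add, dotProduct_transpose_mul_mulVec,
      dotProduct_transpose_mul_mulVec] at hx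
    have h2 := hQ.nonneg (C *ᵥ x)
    have h3 := h.coercive.nonneg (G *ᵥ x)
    refine ⟨hQ.eq_zero (by linarith), ?_⟩
    rw [Matrix.sub_mulVec, ← Matrix.mulVec_mulVec, h.coercive.eq_zero (x := G *ᵥ x) (by linarith),
      Matrix.mulVec_zero, sub_zero]
  obtain ⟨ha1, ha2⟩ := hz a h0.1
  obtain ⟨hb1, hb2⟩ := hz b h0.2
  exact hAC α β a b ⟨ha2 ▸ hab.1, hb2 ▸ hab.2⟩ ha1 hb1

omit [DecidableEq κ] in
/-- A finite cost forces the state to zero: the output and the input are then square summable, and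
an observer `A - L C` reconstructs the state from them. -/
lemma tendsto_of_sum_stage_le (hR : Coercive r R) (hQ : Coercive rq Q) {L : Matrix ι o ℝ}
    (hL : Schur (A - L * C)) {e : ℕ → ι → ℝ} {u : ℕ → κ → ℝ}
    (he : ∀ k, e (k + 1) = A *ᵥ e k + B *ᵥ u k) {c : ℝ}
    (hc : ∀ T, ∑ k ∈ Finset.range T,
      (e k ⬝ᵥ ((Cᵀ * Q * C) *ᵥ e k) + u k ⬝ᵥ (R *ᵥ u k)) ≤ c) :
    Tendsto e atTop (𝓝 0) := by
  obtain ⟨c', hc', hsum⟩ := hL.exists_sum_le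
  have h1 := hsum e (fun k => L *ᵥ (C *ᵥ e k) + B *ᵥ u k) fun k => by
    rw [he, Matrix.sub_mulVec, Matrix.mulVec_mulVec]; abel
  set t := 2 * ‖L‖ ^ 2 / rq + 2 * ‖B‖ ^ 2 / r with ht
  have hr := hR.1
  have hrq := hQ.1
  have hd : ∀ k, (L *ᵥ (C *ᵥ e k) + B *ᵥ u k) ⬝ᵥ (L *ᵥ (C *ᵥ e k) + B *ᵥ u k) ≤
      t * (e k ⬝ᵥ ((Cᵀ * Q * C) *ᵥ e k) + u k ⬝ᵥ (R *ᵥ u k)) := by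
    intro k
    rw [dotProduct_transpose_mul_mulVec]
    have p1 := mulVec_dotProduct_self_le L (C *ᵥ e k)
    have p2 := mulVec_dotProduct_self_le B (u k)
    have p3 := hQ.2 (C *ᵥ e k)
    have p4 := hR.2 (u k)
    have p5 := add_dotProduct_self_le (L *ᵥ (C *ᵥ e k)) (B *ᵥ u k)
    have n1 := hQ.nonneg (C *ᵥ e k)
    have n2 := hR.nonneg (u k)
    have q1 : ‖L‖ ^ 2 * ((C *ᵥ e k) ⬝ᵥ (C *ᵥ e k)) ≤
        ‖L‖ ^ 2 / rq * ((C *ᵥ e k) ⬝ᵥ (Q *ᵥ (C *ᵥ e k))) := by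
      rw [div_mul_eq_mul_div, le_div_iff₀ hrq]
      have := mul_le_mul_of_nonneg_left p3 (sq_nonneg ‖L‖)
      linarith
    have q2 : ‖B‖ ^ 2 * (u k ⬝ᵥ u k) ≤ ‖B‖ ^ 2 / r * (u k ⬝ᵥ (R *ᵥ u k)) := by
      rw [div_mul_eq_mul_div, le_div_iff₀ hr]
      have := mul_le_mul_of_nonneg_left p4 (sq_nonneg ‖B‖)
      linarith
    have m1 : 0 ≤ ‖L‖ ^ 2 / rq * (u k ⬝ᵥ (R *ᵥ u k)) := by positivity
    have m2 : 0 ≤ ‖B‖ ^ 2 / r * ((C *ᵥ e k) ⬝ᵥ (Q *ᵥ (C *ᵥ e k))) := by positivity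
    rw [ht, mul_div_assoc, mul_div_assoc]
    nlinarith
  have ht0 : 0 ≤ t := by positivity
  refine tendsto_zero_of_sum_dotProduct_self_le (c := c' * (e 0 ⬝ᵥ e 0 + t * c)) fun T => ?_
  refine (h1 T).trans (mul_le_mul_of_nonneg_left (add_le_add le_rfl ?_) hc'.le)
  refine (Finset.sum_le_sum fun k _ => hd k).trans ?_
  rw [← Finset.mul_sum]
  exact mul_le_mul_of_nonneg_left (hc T) ht0

omit [DecidableEq ι] in
lemma tendsto_quadratic {e : ℕ → ι → ℝ} (h : Tendsto e atTop (𝓝 0)) (P : Matrix ι ι ℝ) :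
    Tendsto (fun k => e k ⬝ᵥ (P *ᵥ e k)) atTop (𝓝 0) := by
  have hc : Continuous fun v : ι → ℝ => v ⬝ᵥ (P *ᵥ v) := by
    unfold Matrix.mulVec dotProduct; fun_prop
  have := (hc.tendsto 0).comp h
  simp only [zero_dotProduct] at this
  exact this

omit [DecidableEq ι] in
/-- The value `xᵀ P x` bounds the infinite-horizon cost from above under the greedy gain. -/
lemma Weights.tsum_le {W : Matrix ι ι ℝ} (h : Weights W R r) (hPs : P.PosSemidef)
    (hP : P = evalStep A B W R (greedy A B R P) P) {e : ℕ → ι → ℝ} {u : ℕ → κ → ℝ}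
    (he : ∀ k, e (k + 1) = A *ᵥ e k + B *ᵥ u k) (hu : ∀ k, u k = -(greedy A B R P *ᵥ e k)) :
    ∑' k, ENNReal.ofReal (e k ⬝ᵥ (W *ᵥ e k) + u k ⬝ᵥ (R *ᵥ u k)) ≤
      ENNReal.ofReal (e 0 ⬝ᵥ (P *ᵥ e 0)) := by
  refine ENNReal.tsum_le_of_sum_range_le fun T => ?_
  rw [← ENNReal.ofReal_sum_of_nonneg fun k _ => h.stage_nonneg _ _]
  refine ENNReal.ofReal_le_ofReal ?_
  rw [h.sum_stage_eq hPs hP he]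
  have hz : ∀ k, u k + greedy A B R P *ᵥ e k = 0 := fun k => by rw [hu k]; simp
  simp only [hz, zero_dotProduct, Finset.sum_const_zero, add_zero]
  linarith [(posSemidef_iff_real.1 hPs).2 (e T)]

/-- The value `xᵀ P x` bounds the infinite-horizon cost from below for every input sequence. -/
lemma Weights.le_tsum (h : Weights (Cᵀ * Q * C) R r) (hQ : Coercive rq Q) (hPs : P.PosSemidef)
    (hP : P = evalStep A B (Cᵀ * Q * C) R (greedy A B R P) P) {L : Matrix ι o ℝ}
    (hL : Schur (A - L * C)) {e : ℕ → ι → ℝ} {u : ℕ → κ → ℝ}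
    (he : ∀ k, e (k + 1) = A *ᵥ e k + B *ᵥ u k) :
    ENNReal.ofReal (e 0 ⬝ᵥ (P *ᵥ e 0)) ≤
      ∑' k, ENNReal.ofReal (e k ⬝ᵥ ((Cᵀ * Q * C) *ᵥ e k) + u k ⬝ᵥ (R *ᵥ u k)) := by
  set V := ∑' k, ENNReal.ofReal (e k ⬝ᵥ ((Cᵀ * Q * C) *ᵥ e k) + u k ⬝ᵥ (R *ᵥ u k)) with hV
  by_cases htop : V = ⊤
  · rw [htop]; exact le_top
  have hle : ∀ T, ∑ k ∈ Finset.range T,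
      (e k ⬝ᵥ ((Cᵀ * Q * C) *ᵥ e k) + u k ⬝ᵥ (R *ᵥ u k)) ≤ V.toReal := by
    intro T
    rw [← ENNReal.ofReal_le_iff_le_toReal htop,
      ENNReal.ofReal_sum_of_nonneg fun k _ => h.stage_nonneg _ _]
    exact ENNReal.sum_le_tsum _
  have hlim := tendsto_quadratic (tendsto_of_sum_stage_le h.coercive hQ hL he hle) P
  have hlim2 : Tendsto (fun T => e 0 ⬝ᵥ (P *ᵥ e 0) - e T ⬝ᵥ (P *ᵥ e T)) atTop
      (𝓝 (e 0 ⬝ᵥ (P *ᵥ e 0))) := by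
    simpa using hlim.const_sub (e 0 ⬝ᵥ (P *ᵥ e 0))
  rw [ENNReal.ofReal_le_iff_le_toReal htop]
  refine le_of_tendsto' hlim2 fun T => le_trans ?_ (hle T)
  rw [h.sum_stage_eq hPs hP he]
  have := Finset.sum_nonneg fun k (_ : k ∈ Finset.range T) =>
    (coercive_add (B := B) h.coercive hPs).nonneg (u k + greedy A B R P *ᵥ e k)
  linarith

omit [DecidableEq ι] in
/-- A feedback whose cost does not exceed the value `xᵀ P x` is the greedy one. -/
lemma Weights.eq_greedy {W : Matrix ι ι ℝ} (h : Weights W R r) (hPs : P.PosSemidef)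
    (hP : P = evalStep A B W R (greedy A B R P) P) {K : Matrix κ ι ℝ} {e : ℕ → ι → ℝ}
    (he : ∀ k, e (k + 1) = A *ᵥ e k + B *ᵥ (-(K *ᵥ e k))) (h0 : Tendsto e atTop (𝓝 0))
    (hle : ∑' k, ENNReal.ofReal
      (e k ⬝ᵥ (W *ᵥ e k) + (-(K *ᵥ e k)) ⬝ᵥ (R *ᵥ (-(K *ᵥ e k)))) ≤
        ENNReal.ofReal (e 0 ⬝ᵥ (P *ᵥ e 0))) :
    K *ᵥ e 0 = greedy A B R P *ᵥ e 0 := by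
  have hS := coercive_add (B := B) h.coercive hPs
  set v := -(K *ᵥ e 0) + greedy A B R P *ᵥ e 0 with hv
  have hle2 : ∀ T, e 0 ⬝ᵥ (P *ᵥ e 0) - e (T + 1) ⬝ᵥ (P *ᵥ e (T + 1)) +
      v ⬝ᵥ ((R + Bᵀ * P * B) *ᵥ v) ≤ e 0 ⬝ᵥ (P *ᵥ e 0) := by
    intro T
    have h1 := (ENNReal.sum_le_tsum (Finset.range (T + 1))).trans hle
    rw [← ENNReal.ofReal_sum_of_nonneg fun k _ => h.stage_nonneg _ _,
      ENNReal.ofReal_le_ofReal_iff ((posSemidef_iff_real.1 hPs).2 _), h.sum_stage_eq hPs hP he] at h1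
    refine le_trans (add_le_add le_rfl ?_) h1
    exact Finset.single_le_sum (f := fun k => (-(K *ᵥ e k) + greedy A B R P *ᵥ e k) ⬝ᵥ
      ((R + Bᵀ * P * B) *ᵥ (-(K *ᵥ e k) + greedy A B R P *ᵥ e k)))
      (fun k _ => hS.nonneg _) (Finset.mem_range.2 (Nat.succ_pos T))
  have hlim := (tendsto_add_atTop_iff_nat 1).2 (tendsto_quadratic h0 P)
  have hlim2 : Tendsto (fun T => e 0 ⬝ᵥ (P *ᵥ e 0) - e (T + 1) ⬝ᵥ (P *ᵥ e (T + 1)) +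
      v ⬝ᵥ ((R + Bᵀ * P * B) *ᵥ v)) atTop
      (𝓝 (e 0 ⬝ᵥ (P *ᵥ e 0) + v ⬝ᵥ ((R + Bᵀ * P * B) *ᵥ v))) := by
    simpa using (hlim.const_sub (e 0 ⬝ᵥ (P *ᵥ e 0))).add_const (v ⬝ᵥ ((R + Bᵀ * P * B) *ᵥ v))
  have h3 := le_of_tendsto' hlim2 hle2
  have h4 : v = 0 := hS.eq_zero (by linarith)
  rw [hv, neg_add_eq_zero] at h4
  exact h4

end Optimal

/-! ### Filters that reconstruct the state -/

section Filter

variable {ι κ o ζ : Type*} [Fintype ι] [DecidableEq ι] [Fintype κ] [Fintype o]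
  [Fintype ζ] [DecidableEq ζ]

/-- A stable bank of filters `ζ⁺ = Φ ζ + b_u u + b_y y + b_t ϑ` from which the state of
`r⁺ = A r + B u + G ϑ`, `y = C r`, is reconstructed asymptotically as `M ζ`: the matrix `M`
intertwines the filters with the observer `A - L C`. -/
structure IsReconstructor (A : Matrix ι ι ℝ) (B : Matrix ι κ ℝ) (G : Matrix ι o ℝ)
    (C : Matrix o ι ℝ) (L : Matrix ι o ℝ) (Φ : Matrix ζ ζ ℝ) (bu : Matrix ζ κ ℝ)
    (bY : Matrix ζ o ℝ) (bt : Matrix ζ o ℝ) (M : Matrix ι ζ ℝ) : Prop where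
  schur : Schur Φ
  schur_observer : Schur (A - L * C)
  mul_filter : M * Φ = (A - L * C) * M
  mul_bu : M * bu = B
  mul_bY : M * bY = L
  mul_bt : M * bt = G

variable {A : Matrix ι ι ℝ} {B : Matrix ι κ ℝ} {G : Matrix ι o ℝ} {C : Matrix o ι ℝ}
  {L : Matrix ι o ℝ} {Φ : Matrix ζ ζ ℝ} {bu : Matrix ζ κ ℝ} {bY : Matrix ζ o ℝ}
  {bt : Matrix ζ o ℝ} {M : Matrix ι ζ ℝ}

namespace IsReconstructor

lemma error_succ (h : IsReconstructor A B G C L Φ bu bY bt M) {r : ι → ℝ} {z : ζ → ℝ} {u : κ → ℝ}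
    {th : o → ℝ} :
    A *ᵥ r + B *ᵥ u + G *ᵥ th - M *ᵥ (Φ *ᵥ z + bu *ᵥ u + bY *ᵥ (C *ᵥ r) + bt *ᵥ th) =
      (A - L * C) *ᵥ (r - M *ᵥ z) := by
  simp only [Matrix.mulVec_add, Matrix.mulVec_mulVec, h.mul_filter, h.mul_bu, h.mul_bt,
    Matrix.mulVec_sub, ← Matrix.mul_assoc, h.mul_bY]
  rw [Matrix.sub_mulVec A]
  abel

/-- The reconstruction error obeys the observer dynamics. -/
lemma error_eq (h : IsReconstructor A B G C L Φ bu bY bt M) {r : ℕ → ι → ℝ} {z : ℕ → ζ → ℝ}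
    {u : ℕ → κ → ℝ} {th : ℕ → o → ℝ}
    (hr : ∀ k, r (k + 1) = A *ᵥ r k + B *ᵥ u k + G *ᵥ th k)
    (hz : ∀ k, z (k + 1) = Φ *ᵥ z k + bu *ᵥ u k + bY *ᵥ (C *ᵥ r k) + bt *ᵥ th k) (k : ℕ) :
    r k - M *ᵥ z k = (A - L * C) ^ k *ᵥ (r 0 - M *ᵥ z 0) := by
  induction k with
  | zero => simp
  | succ k ih => rw [hr, hz, h.error_succ, ih, pow_succ_mulVec]

/-- The filters in closed loop with the reconstructed output `C M ζ` form a system with state matrix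
`Φ + b_y C M`, whose feedback gains `K M` are stabilizing when `K` is. -/
lemma schur_zeta (h : IsReconstructor A B G C L Φ bu bY bt M) {K : Matrix κ ι ℝ}
    (hK : Schur (A - B * K)) : Schur (Φ + bY * (C * M) - bu * (K * M)) := by
  refine schur_of_isEigenPair fun α β a b hab h1 => ?_
  have hmap : M * (Φ + bY * (C * M) - bu * (K * M)) = (A - B * K) * M := by
    rw [Matrix.mul_sub, Matrix.mul_add, h.mul_filter, ← Matrix.mul_assoc M bY, h.mul_bY,
      ← Matrix.mul_assoc M bu, h.mul_bu]
    simp only [Matrix.sub_mul, Matrix.mul_assoc]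
    abel
  obtain ⟨ha, hb⟩ := hK.eq_zero_of_isEigenPair (hab.map hmap) h1
  have hΦ : ∀ x, M *ᵥ x = 0 → (Φ + bY * (C * M) - bu * (K * M)) *ᵥ x = Φ *ᵥ x := by
    intro x hx
    rw [Matrix.sub_mulVec, Matrix.add_mulVec, ← Matrix.mulVec_mulVec, ← Matrix.mulVec_mulVec,
      ← Matrix.mulVec_mulVec, ← Matrix.mulVec_mulVec, hx]
    simp
  exact h.schur.eq_zero_of_isEigenPair ⟨hΦ a ha ▸ hab.1, hΦ b hb ▸ hab.2⟩ h1

/-- The closed-loop matrix of plant and filters with the feedback `u = -K ζ`. -/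
def closedLoop (A : Matrix ι ι ℝ) (B : Matrix ι κ ℝ) (C : Matrix o ι ℝ) (Φ : Matrix ζ ζ ℝ)
    (bu : Matrix ζ κ ℝ) (bY : Matrix ζ o ℝ) (K : Matrix κ ζ ℝ) : Matrix (ι ⊕ ζ) (ι ⊕ ζ) ℝ :=
  Matrix.fromBlocks A (-(B * K)) (bY * C) (Φ - bu * K)

lemma schur_closedLoop (h : IsReconstructor A B G C L Φ bu bY bt M) {K : Matrix κ ι ℝ}
    (hK : Schur (A - B * K)) : Schur (closedLoop A B C Φ bu bY (K * M)) := by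
  refine schur_of_isEigenPair fun α β a b hab h1 => ?_
  -- the reconstruction error `r - M ζ` follows the stable observer
  have h2 : Matrix.fromCols (1 : Matrix ι ι ℝ) (-M) * closedLoop A B C Φ bu bY (K * M) =
      (A - L * C) * Matrix.fromCols (1 : Matrix ι ι ℝ) (-M) := by
    rw [closedLoop, Matrix.fromCols_mul_fromBlocks, Matrix.mul_fromCols]
    congr 1
    · rw [Matrix.neg_mul, ← Matrix.mul_assoc M, h.mul_bY]; simp [sub_eq_add_neg]
    · rw [Matrix.neg_mul, Matrix.mul_sub, h.mul_filter, ← Matrix.mul_assoc M, h.mul_bu]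
      simp only [Matrix.one_mul, Matrix.mul_neg]
      abel
  obtain ⟨ha, hb⟩ := h.schur_observer.eq_zero_of_isEigenPair (hab.map h2) h1
  obtain ⟨x, z, rfl⟩ : ∃ x z, a = Sum.elim x z := ⟨a ∘ Sum.inl, a ∘ Sum.inr, by simp⟩
  obtain ⟨x', z', rfl⟩ : ∃ x z, b = Sum.elim x z := ⟨b ∘ Sum.inl, b ∘ Sum.inr, by simp⟩
  simp only [Matrix.fromCols_mulVec, Sum.elim_comp_inl, Sum.elim_comp_inr, Matrix.one_mulVec,
    Matrix.neg_mulVec, add_neg_eq_zero] at ha hb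
  subst ha hb
  have h3 := hab.1
  have h4 := hab.2
  simp only [closedLoop, Matrix.fromBlocks_mulVec, Sum.elim_comp_inl, Sum.elim_comp_inr] at h3 h4
  have e : ∀ v, (bY * C) *ᵥ (M *ᵥ v) + (Φ - bu * (K * M)) *ᵥ v =
      (Φ + bY * (C * M) - bu * (K * M)) *ᵥ v := by
    intro v
    rw [Matrix.mulVec_mulVec, ← Matrix.add_mulVec, Matrix.mul_assoc]
    congr 1
    abel
  obtain ⟨rfl, rfl⟩ := (h.schur_zeta hK).eq_zero_of_isEigenPair (α := α) (β := β) (a := z) (b := z')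
    ⟨(e z).symm.trans (funext fun i => congrFun h3 (Sum.inr i)),
      (e z').symm.trans (funext fun i => congrFun h4 (Sum.inr i))⟩ h1
  simp only [Matrix.mulVec_zero]
  constructor <;> exact Sum.elim_zero_zero

omit [DecidableEq ι] [DecidableEq ζ] in
lemma norm_closedLoop_sub_le (A : Matrix ι ι ℝ) (B : Matrix ι κ ℝ) (C : Matrix o ι ℝ)
    (Φ : Matrix ζ ζ ℝ) (bu : Matrix ζ κ ℝ) (bY : Matrix ζ o ℝ) (K K' : Matrix κ ζ ℝ) :
    ‖closedLoop A B C Φ bu bY K - closedLoop A B C Φ bu bY K'‖ ≤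
      ‖Matrix.fromRows B bu‖ * ‖K - K'‖ := by
  have e : closedLoop A B C Φ bu bY K - closedLoop A B C Φ bu bY K' =
      -(Matrix.fromRows B bu * Matrix.fromCols (0 : Matrix κ ι ℝ) (K - K')) := by
    rw [Matrix.fromRows_mul_fromCols, closedLoop, closedLoop, Matrix.fromBlocks_neg,
      sub_eq_add_neg, Matrix.fromBlocks_neg, Matrix.fromBlocks_add]
    simp only [Matrix.mul_sub, Matrix.mul_zero]
    congr 1 <;> abel
  have e2 : ‖Matrix.fromCols (0 : Matrix κ ι ℝ) (K - K')‖ = ‖K - K'‖ := by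
    have : ‖Matrix.fromCols (0 : Matrix κ ι ℝ) (K - K')‖ ^ 2 = ‖K - K'‖ ^ 2 := by
      rw [norm_sq_eq_sum, norm_sq_eq_sum]
      simp [Fintype.sum_sum_type]
    exact (sq_eq_sq₀ (norm_nonneg _) (norm_nonneg _)).1 this
  rw [e, norm_neg, ← e2]
  exact norm_mul_le' _ _

end IsReconstructor

end Filter

/-! ### Steady states and the cost of the output-feedback controller -/

section Tracking

variable {ι κ o τ ζ : Type*} [Fintype ι] [DecidableEq ι] [Fintype κ] [DecidableEq κ] [Fintype o]
  [Fintype τ] [DecidableEq τ] [Fintype ζ] [DecidableEq ζ]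
  {A : Matrix ι ι ℝ} {B : Matrix ι κ ℝ} {G : Matrix ι o ℝ} {C : Matrix o ι ℝ}
  {L : Matrix ι o ℝ} {Φ : Matrix ζ ζ ℝ} {bu : Matrix ζ κ ℝ} {bY : Matrix ζ o ℝ}
  {bt : Matrix ζ o ℝ} {M : Matrix ι ζ ℝ} {S : Matrix τ τ ℝ} {R : Matrix o τ ℝ}

omit [Fintype ι] [DecidableEq ι] [Fintype ζ] [DecidableEq ζ] [DecidableEq τ] in
lemma elim_dotProduct_self [Fintype ι] [Fintype ζ] (x : ι → ℝ) (z : ζ → ℝ) :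
    Sum.elim x z ⬝ᵥ Sum.elim x z = x ⬝ᵥ x + z ⬝ᵥ z := by
  simp [dotProduct, Fintype.sum_sum_type]

omit [DecidableEq κ] in
/-- For gains near `K M` with `K` stabilizing, plant and filters have a common steady state
`(X x_d, Z x_d)` with `X = M Z`, and the deviation from it is square summable, uniformly in the
gain. -/
lemma IsReconstructor.exists_steadyState (h : IsReconstructor A B G C L Φ bu bY bt M)
    {K : Matrix κ ι ℝ} (hK : Schur (A - B * K)) (hS : ∀ μ ∈ cspec S, 1 ≤ ‖μ‖)
    (R : Matrix o τ ℝ) :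
    ∃ δ > 0, ∃ c > 0, ∀ Kh : Matrix κ ζ ℝ, ‖Kh - K * M‖ < δ →
      ∃ (X : Matrix ι τ ℝ) (Z : Matrix ζ τ ℝ), A * X + B * (-(Kh * Z)) + G * R = X * S ∧
        X = M * Z ∧ ∀ (xd : ℕ → τ → ℝ) (r : ℕ → ι → ℝ) (z : ℕ → ζ → ℝ),
          (∀ k, xd (k + 1) = S *ᵥ xd k) →
          (∀ k, r (k + 1) = A *ᵥ r k + B *ᵥ (-(Kh *ᵥ z k)) + G *ᵥ (R *ᵥ xd k)) →
          (∀ k, z (k + 1) = Φ *ᵥ z k + bu *ᵥ (-(Kh *ᵥ z k)) + bY *ᵥ (C *ᵥ r k) +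
            bt *ᵥ (R *ᵥ xd k)) →
          (∀ k, (r (k + 1) - X *ᵥ xd (k + 1)) = A *ᵥ (r k - X *ᵥ xd k) +
            B *ᵥ (-(Kh *ᵥ (z k - Z *ᵥ xd k)))) ∧
          ∀ T, ∑ k ∈ Finset.range T, ((r k - X *ᵥ xd k) ⬝ᵥ (r k - X *ᵥ xd k) +
            (z k - Z *ᵥ xd k) ⬝ᵥ (z k - Z *ᵥ xd k)) ≤
              c * (xd 0 ⬝ᵥ xd 0 + r 0 ⬝ᵥ r 0 + z 0 ⬝ᵥ z 0) := by
  -- the joint closed loop of plant and filters is stable at `K M`, hence uniformly so nearby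
  have hcl := h.schur_closedLoop hK
  obtain ⟨δ1, hδ1, c1, hc1, h1⟩ := hcl.exists_sum_le_nhds
  obtain ⟨δ2, hδ2, c2, hc2, h2⟩ := hcl.exists_sylvester hS
  set Y : Matrix (ι ⊕ ζ) τ ℝ := Matrix.fromRows (G * R) (bt * R) with hY
  set t := (c2 * ‖Y‖) ^ 2 with ht
  refine ⟨min δ1 δ2 / (‖Matrix.fromRows B bu‖ + 1), by positivity, c1 * (2 + 2 * t), by positivity,
    fun Kh hKh => ?_⟩
  have hn : ‖closedLoop A B C Φ bu bY Kh - closedLoop A B C Φ bu bY (K * M)‖ < min δ1 δ2 := by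
    refine (norm_closedLoop_sub_le A B C Φ bu bY Kh (K * M)).trans_lt ?_
    have := (lt_div_iff₀ (by positivity)).1 hKh
    nlinarith [norm_nonneg (Kh - K * M), norm_nonneg (Matrix.fromRows B bu)]
  obtain ⟨XZ, hXZ, hXZn⟩ := h2 _ (hn.trans_le (min_le_right _ _)) Y
  have h1 := h1 _ (hn.trans_le (min_le_left _ _))
  obtain ⟨X, Z, rfl⟩ : ∃ X Z, XZ = Matrix.fromRows X Z := ⟨XZ.toRows₁, XZ.toRows₂, by simp⟩
  have hrows : Matrix.fromRows (A * X + B * (-(Kh * Z)) + G * R)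
      (bY * C * X + (Φ - bu * Kh) * Z + bt * R) = Matrix.fromRows (X * S) (Z * S) := by
    rw [← Matrix.fromRows_mul, ← hXZ, closedLoop, Matrix.fromBlocks_mul_fromRows, hY]
    ext i j
    rcases i with i | i <;> simp [Matrix.mul_assoc]
  have hX : A * X + B * (-(Kh * Z)) + G * R = X * S := by
    simpa using congrArg Matrix.toRows₁ hrows
  have hZ : bY * C * X + (Φ - bu * Kh) * Z + bt * R = Z * S := by
    simpa using congrArg Matrix.toRows₂ hrows
  refine ⟨X, Z, hX, ?_, fun xd r z hxd hr hz => ?_⟩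
  · -- `X - M Z` intertwines the observer with `S`
    refine sub_eq_zero.1 (eq_zero_of_mul_eq_mul h.schur_observer hS (S := S) ?_)
    rw [Matrix.sub_mul X, ← hX, Matrix.mul_assoc M, ← hZ]
    have e1 : M * (bY * C * X + (Φ - bu * Kh) * Z + bt * R) =
        L * C * X + ((A - L * C) * M - B * Kh) * Z + G * R := by
      rw [Matrix.mul_add, Matrix.mul_add, ← Matrix.mul_assoc M (bY * C), ← Matrix.mul_assoc M bY,
        h.mul_bY, ← Matrix.mul_assoc M (Φ - bu * Kh), Matrix.mul_sub M, h.mul_filter,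
        ← Matrix.mul_assoc M bu, h.mul_bu, ← Matrix.mul_assoc M bt, h.mul_bt]
    rw [e1]
    simp only [Matrix.sub_mul, Matrix.mul_sub, Matrix.mul_assoc, Matrix.mul_neg]
    abel
  · have hXv : ∀ v, X *ᵥ (S *ᵥ v) = A *ᵥ (X *ᵥ v) + B *ᵥ (-(Kh *ᵥ (Z *ᵥ v))) + G *ᵥ (R *ᵥ v) := by
      intro v
      rw [Matrix.mulVec_mulVec, ← hX]
      simp only [Matrix.add_mulVec, Matrix.mul_neg, Matrix.neg_mulVec, Matrix.mulVec_neg,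
        Matrix.mulVec_mulVec]
    have hZv : ∀ v, Z *ᵥ (S *ᵥ v) = (bY * C) *ᵥ (X *ᵥ v) + (Φ - bu * Kh) *ᵥ (Z *ᵥ v) +
        bt *ᵥ (R *ᵥ v) := by
      intro v
      rw [Matrix.mulVec_mulVec, ← hZ]
      simp only [Matrix.add_mulVec, Matrix.mulVec_mulVec]
    have he : ∀ k, (r (k + 1) - X *ᵥ xd (k + 1)) = A *ᵥ (r k - X *ᵥ xd k) +
        B *ᵥ (-(Kh *ᵥ (z k - Z *ᵥ xd k))) := by
      intro k
      rw [hr, hxd, hXv]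
      simp only [Matrix.mulVec_sub, Matrix.mulVec_neg]
      abel
    have hf : ∀ k, (z (k + 1) - Z *ᵥ xd (k + 1)) = (bY * C) *ᵥ (r k - X *ᵥ xd k) +
        (Φ - bu * Kh) *ᵥ (z k - Z *ᵥ xd k) := by
      intro k
      rw [hz, hxd, hZv]
      simp only [Matrix.mulVec_sub, Matrix.mulVec_neg, Matrix.sub_mulVec, Matrix.mulVec_mulVec]
      abel
    refine ⟨he, fun T => ?_⟩
    have h3 := h1 (fun k => Sum.elim (r k - X *ᵥ xd k) (z k - Z *ᵥ xd k)) (fun _ => 0) (fun k => by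
      rw [he, hf, closedLoop, Matrix.fromBlocks_mulVec, Sum.elim_comp_inl, Sum.elim_comp_inr,
        add_zero]
      congr 1
      rw [Matrix.neg_mulVec, Matrix.mulVec_neg, Matrix.mulVec_mulVec _ B Kh]) T
    simp only [elim_dotProduct_self, zero_dotProduct, Finset.sum_const_zero, add_zero] at h3
    refine h3.trans ?_
    rw [mul_assoc]
    refine mul_le_mul_of_nonneg_left ?_ hc1.le
    have p1 := sub_dotProduct_self_le (r 0) (X *ᵥ xd 0)
    have p2 := sub_dotProduct_self_le (z 0) (Z *ᵥ xd 0)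
    have p3 : (X *ᵥ xd 0) ⬝ᵥ (X *ᵥ xd 0) + (Z *ᵥ xd 0) ⬝ᵥ (Z *ᵥ xd 0) ≤ t * (xd 0 ⬝ᵥ xd 0) := by
      have p4 := mulVec_dotProduct_self_le (Matrix.fromRows X Z) (xd 0)
      rw [Matrix.fromRows_mulVec, elim_dotProduct_self] at p4
      refine p4.trans (mul_le_mul_of_nonneg_right ?_ (dotProduct_self_nonneg' _))
      exact pow_le_pow_left₀ (norm_nonneg _) hXZn 2
    have q1 := dotProduct_self_nonneg' (xd 0)
    have q2 := dotProduct_self_nonneg' (r 0)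
    have q3 := dotProduct_self_nonneg' (z 0)
    have ht0 : 0 ≤ t := sq_nonneg _
    have := mul_nonneg ht0 (add_nonneg q2 q3)
    nlinarith

/-- Tracking and near-optimality for all gains near `K M`, where `K` is the Riccati gain. The loss
against the optimal cost is the square sum of `u_e + K e = K ω - (K̂ - K M) f`, where `ω` is the
reconstruction error and `f` the deviation of the filters from their steady state. -/
lemma IsReconstructor.exists_cost_le (h : IsReconstructor A B G C L Φ bu bY bt M)
    {W : Matrix ι ι ℝ} {Rb : Matrix κ κ ℝ} {ru : ℝ} (hw : Weights W Rb ru) {P : Matrix ι ι ℝ}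
    (hPs : P.PosSemidef) (hP : P = evalStep A B W Rb (greedy A B Rb P) P)
    (hK : Schur (A - B * greedy A B Rb P)) (hS : ∀ μ ∈ cspec S, 1 ≤ ‖μ‖) (R : Matrix o τ ℝ) :
    ∃ γ : ℝ, 0 ≤ γ ∧ ∃ δ > 0, ∃ c > 0, ∀ Kh : Matrix κ ζ ℝ, ‖Kh - greedy A B Rb P * M‖ < δ →
      ∃ (X : Matrix ι τ ℝ) (Z : Matrix ζ τ ℝ), A * X + B * (-(Kh * Z)) + G * R = X * S ∧
        X = M * Z ∧ ∀ (xd : ℕ → τ → ℝ) (r : ℕ → ι → ℝ) (z : ℕ → ζ → ℝ),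
          (∀ k, xd (k + 1) = S *ᵥ xd k) →
          (∀ k, r (k + 1) = A *ᵥ r k + B *ᵥ (-(Kh *ᵥ z k)) + G *ᵥ (R *ᵥ xd k)) →
          (∀ k, z (k + 1) = Φ *ᵥ z k + bu *ᵥ (-(Kh *ᵥ z k)) + bY *ᵥ (C *ᵥ r k) +
            bt *ᵥ (R *ᵥ xd k)) →
          (∀ k, (r (k + 1) - X *ᵥ xd (k + 1)) = A *ᵥ (r k - X *ᵥ xd k) +
            B *ᵥ (-(Kh *ᵥ (z k - Z *ᵥ xd k)))) ∧
          Tendsto (fun k => r k - X *ᵥ xd k) atTop (𝓝 0) ∧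
          ∑' k, ENNReal.ofReal ((r k - X *ᵥ xd k) ⬝ᵥ (W *ᵥ (r k - X *ᵥ xd k)) +
            (-(Kh *ᵥ (z k - Z *ᵥ xd k))) ⬝ᵥ (Rb *ᵥ (-(Kh *ᵥ (z k - Z *ᵥ xd k))))) ≤
            ENNReal.ofReal ((r 0 - X *ᵥ xd 0) ⬝ᵥ (P *ᵥ (r 0 - X *ᵥ xd 0)) +
              γ * ((r 0 - M *ᵥ z 0) ⬝ᵥ (r 0 - M *ᵥ z 0)) +
              c * ‖Kh - greedy A B Rb P * M‖ ^ 2 *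
                (xd 0 ⬝ᵥ xd 0 + r 0 ⬝ᵥ r 0 + z 0 ⬝ᵥ z 0)) := by
  set K := greedy A B Rb P with hKdef
  set H := Rb + Bᵀ * P * B with hH
  obtain ⟨c0, hc0, hsum⟩ := h.schur_observer.exists_sum_le
  obtain ⟨δ, hδ, c, hc, hst⟩ := h.exists_steadyState hK hS R
  refine ⟨‖H‖ * (2 * ‖K‖ ^ 2 * c0), by positivity, δ, hδ, (‖H‖ + 1) * (2 * c), by positivity,
    fun Kh hKh => ?_⟩
  obtain ⟨X, Z, hX, hXZ, htr⟩ := hst Kh hKh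
  refine ⟨X, Z, hX, hXZ, fun xd r z hxd hr hz => ?_⟩
  obtain ⟨he, hb⟩ := htr xd r z hxd hr hz
  set D := Kh - K * M with hD
  set J := xd 0 ⬝ᵥ xd 0 + r 0 ⬝ᵥ r 0 + z 0 ⬝ᵥ z 0 with hJ
  have hJ0 : 0 ≤ J := add_nonneg (add_nonneg (dotProduct_self_nonneg' _)
    (dotProduct_self_nonneg' _)) (dotProduct_self_nonneg' _)
  refine ⟨he, ?_, ?_⟩
  · refine tendsto_zero_of_sum_dotProduct_self_le (c := c * J) fun T => le_trans ?_ (hb T)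
    exact Finset.sum_le_sum fun k _ => le_add_of_nonneg_right (dotProduct_self_nonneg' _)
  refine ENNReal.tsum_le_of_sum_range_le fun T => ?_
  rw [← ENNReal.ofReal_sum_of_nonneg fun k _ => hw.stage_nonneg _ _]
  refine ENNReal.ofReal_le_ofReal ?_
  rw [hw.sum_stage_eq hPs hP (e := fun k => r k - X *ᵥ xd k)
    (u := fun k => -(Kh *ᵥ (z k - Z *ᵥ xd k))) he T, ← hKdef, ← hH]
  have hω := h.error_eq hr hz
  set ω : ℕ → ι → ℝ := fun k => r k - M *ᵥ z k with hωdef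
  have hωs : ∀ T, ∑ k ∈ Finset.range T, ω k ⬝ᵥ ω k ≤ c0 * (ω 0 ⬝ᵥ ω 0) := by
    intro T
    have := hsum ω (fun _ => 0) (fun k => by
      simp only [hωdef]
      rw [hω (k + 1), pow_succ_mulVec, ← hω k, add_zero]) T
    simpa using this
  -- `X = M Z` turns the loss into a reconstruction term and a gain error term
  have hloss : ∀ k, -(Kh *ᵥ (z k - Z *ᵥ xd k)) + K *ᵥ (r k - X *ᵥ xd k) =
      K *ᵥ ω k - D *ᵥ (z k - Z *ᵥ xd k) := by
    intro k
    simp only [hωdef, hD, hXZ, Matrix.mulVec_sub, Matrix.sub_mulVec, ← Matrix.mulVec_mulVec]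
    abel
  have hterm : ∀ k, (-(Kh *ᵥ (z k - Z *ᵥ xd k)) + K *ᵥ (r k - X *ᵥ xd k)) ⬝ᵥ
      (H *ᵥ (-(Kh *ᵥ (z k - Z *ᵥ xd k)) + K *ᵥ (r k - X *ᵥ xd k))) ≤
      ‖H‖ * (2 * ‖K‖ ^ 2 * (ω k ⬝ᵥ ω k)) + ‖H‖ * (2 * ‖D‖ ^ 2 *
        ((r k - X *ᵥ xd k) ⬝ᵥ (r k - X *ᵥ xd k) +
          (z k - Z *ᵥ xd k) ⬝ᵥ (z k - Z *ᵥ xd k))) := by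
    intro k
    rw [hloss]
    refine ((le_abs_self _).trans (abs_quadratic_le H _)).trans ?_
    rw [← mul_add]
    refine mul_le_mul_of_nonneg_left ?_ (norm_nonneg _)
    refine (sub_dotProduct_self_le _ _).trans ?_
    have p1 := mulVec_dotProduct_self_le K (ω k)
    have p2 := mulVec_dotProduct_self_le D (z k - Z *ᵥ xd k)
    have p3 := mul_nonneg (sq_nonneg ‖D‖) (dotProduct_self_nonneg' (r k - X *ᵥ xd k))
    linarith
  have htot := Finset.sum_le_sum fun k (_ : k ∈ Finset.range T) => hterm k
  rw [Finset.sum_add_distrib, ← Finset.mul_sum, ← Finset.mul_sum, ← Finset.mul_sum,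
    ← Finset.mul_sum] at htot
  have q1 : ‖H‖ * (2 * ‖K‖ ^ 2 * ∑ k ∈ Finset.range T, ω k ⬝ᵥ ω k) ≤
      ‖H‖ * (2 * ‖K‖ ^ 2 * (c0 * (ω 0 ⬝ᵥ ω 0))) :=
    mul_le_mul_of_nonneg_left (mul_le_mul_of_nonneg_left (hωs T) (by positivity)) (norm_nonneg _)
  have q2 := mul_le_mul_of_nonneg_left (mul_le_mul_of_nonneg_left (hb T)
    (by positivity : 0 ≤ 2 * ‖D‖ ^ 2)) (norm_nonneg H)
  have q3 : 0 ≤ 2 * c * ‖D‖ ^ 2 * J := by positivity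
  have q4 := (posSemidef_iff_real.1 hPs).2 (r T - X *ᵥ xd T)
  have q5 : (‖H‖ + 1) * (2 * c) * ‖D‖ ^ 2 * J =
      ‖H‖ * (2 * ‖D‖ ^ 2 * (c * J)) + 2 * c * ‖D‖ ^ 2 * J := by ring
  have q6 : ‖H‖ * (2 * ‖K‖ ^ 2 * c0) * (ω 0 ⬝ᵥ ω 0) =
      ‖H‖ * (2 * ‖K‖ ^ 2 * (c0 * (ω 0 ⬝ᵥ ω 0))) := by ring
  rw [q5, q6]
  linarith

end Tracking

/-! ### The filters of the output-feedback controller -/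

section FilterBank

variable {m p N : ℕ}

/-- The state matrix of the bank of the three filters. -/
def filterMat (m p : ℕ) (c : Fin N → ℝ) : Matrix (ZIdx m p N) (ZIdx m p N) ℝ :=
  Matrix.fromBlocks ((1 : Matrix (Fin m) (Fin m) ℝ) ⊗ₖ companion c) 0 0
    (Matrix.fromBlocks ((1 : Matrix (Fin p) (Fin p) ℝ) ⊗ₖ companion c) 0 0
      ((1 : Matrix (Fin p) (Fin p) ℝ) ⊗ₖ companion c))

/-- The input matrix of the filter bank for the signal `ū`. -/
def inputU (m p N : ℕ) : Matrix (ZIdx m p N) (Fin m) ℝ :=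
  Matrix.fromRows (filterInput m N) 0

/-- The input matrix of the filter bank for the signal `y`. -/
def inputY (m p N : ℕ) : Matrix (ZIdx m p N) (Fin p) ℝ :=
  Matrix.fromRows 0 (Matrix.fromRows (filterInput p N) 0)

/-- The input matrix of the filter bank for the signal `ϑ`. -/
def inputTh (m p N : ℕ) : Matrix (ZIdx m p N) (Fin p) ℝ :=
  Matrix.fromRows 0 (Matrix.fromRows 0 (filterInput p N))

lemma Schur.fromBlocks_diagonal {ι κ : Type*} [Fintype ι] [DecidableEq ι] [Fintype κ]
    [DecidableEq κ] {A : Matrix ι ι ℝ} {D : Matrix κ κ ℝ} (hA : Schur A) (hD : Schur D) :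
    Schur (Matrix.fromBlocks A 0 0 D) := by
  intro μ hμ
  rw [cspec, Matrix.mem_spectrum_iff_isRoot_charpoly, Matrix.charpoly_map,
    Matrix.charpoly_fromBlocks_zero₁₂, Polynomial.map_mul, Polynomial.IsRoot, Polynomial.eval_mul,
    mul_eq_zero] at hμ
  rcases hμ with h | h
  · exact hA μ (by
      rwa [cspec, Matrix.mem_spectrum_iff_isRoot_charpoly, Matrix.charpoly_map])
  · exact hD μ (by
      rwa [cspec, Matrix.mem_spectrum_iff_isRoot_charpoly, Matrix.charpoly_map])

lemma Schur.one_kronecker {ι κ : Type*} [Fintype ι] [DecidableEq ι] [Fintype κ]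
    [DecidableEq κ] {A : Matrix ι ι ℝ} (hA : Schur A) :
    Schur ((1 : Matrix κ κ ℝ) ⊗ₖ A) := by
  refine schur_of_isEigenPair fun α β a b hab h1 => ?_
  have hmul : ∀ (v : κ × ι → ℝ) (j : κ) (i : ι),
      (((1 : Matrix κ κ ℝ) ⊗ₖ A) *ᵥ v) (j, i) = (A *ᵥ fun i => v (j, i)) i := by
    intro v j i
    simp [Matrix.mulVec, dotProduct, Fintype.sum_prod_type, Matrix.one_apply, ite_mul]
  have hj : ∀ j, IsEigenPair A α β (fun i => a (j, i)) (fun i => b (j, i)) := fun j =>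
    ⟨funext fun i => by rw [← hmul, hab.1]; rfl, funext fun i => by rw [← hmul, hab.2]; rfl⟩
  have h0 := fun j => hA.eq_zero_of_isEigenPair (hj j) h1
  exact ⟨funext fun x => congrFun (h0 x.1).1 x.2, funext fun x => congrFun (h0 x.1).2 x.2⟩

lemma schur_filterMat {c : Fin N → ℝ} (hc : Schur (companion c)) : Schur (filterMat m p c) :=
  hc.one_kronecker.fromBlocks_diagonal (hc.one_kronecker.fromBlocks_diagonal hc.one_kronecker)

end FilterBank

namespace Sys

variable {n m p q d : ℕ} {s : Sys n m p q d} {c : Fin (n + d * p) → ℝ}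

lemma card_rIdx : Fintype.card (RIdx n p d) = n + d * p := by
  simp [RIdx]

/-- The parameterization matrix reconstructs the augmented state from the filters. -/
lemma isReconstructor (s : Sys n m p q d) (hc : Schur (companion c))
    {L : Matrix (RIdx n p d) (Fin p) ℝ}
    (hL : (s.Aaug - L * s.Caug).charpoly = (companion c).charpoly) :
    IsReconstructor s.Aaug s.Baug s.Gaug s.Caug L (filterMat m p c) (inputU m p (n + d * p))
      (inputY m p (n + d * p)) (inputTh m p (n + d * p)) (s.paramMatrix L) where
  schur := schur_filterMat hc
  schur_observer := hc.of_charpoly_eq hL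
  mul_filter := by
    rw [paramMatrix, filterMat, Matrix.fromCols_mul_fromBlocks, Matrix.fromCols_mul_fromBlocks,
      Matrix.mul_fromCols, Matrix.mul_fromCols, paramBlock_mul_kronecker card_rIdx _ _ hL,
      paramBlock_mul_kronecker card_rIdx _ _ hL, paramBlock_mul_kronecker card_rIdx _ _ hL]
    simp
  mul_bu := by
    rw [paramMatrix, inputU, Matrix.fromCols_mul_fromRows, paramBlock_mul_filterInput card_rIdx]
    simp
  mul_bY := by
    rw [paramMatrix, inputY, Matrix.fromCols_mul_fromRows, Matrix.fromCols_mul_fromRows,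
      paramBlock_mul_filterInput card_rIdx]
    simp
  mul_bt := by
    rw [paramMatrix, inputTh, Matrix.fromCols_mul_fromRows, Matrix.fromCols_mul_fromRows,
      paramBlock_mul_filterInput card_rIdx]
    simp

variable {w : Signals n m p d}

lemma Caug_mulVec_r (s : Sys n m p q d) (w : Signals n m p d) (k : ℕ) :
    s.Caug *ᵥ w.r k = s.C *ᵥ w.x k := by
  rw [Caug, Signals.r, Matrix.fromCols_mulVec]
  simp

lemma Obeys.r_succ (h : s.Obeys c w) (k : ℕ) :
    w.r (k + 1) = s.Aaug *ᵥ w.r k + s.Baug *ᵥ w.u k + s.Gaug *ᵥ w.th k := by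
  obtain ⟨h1, h2, -⟩ := h k
  rw [Signals.r, h1, h2, Aaug, Baug, Gaug, Signals.r, Matrix.fromBlocks_mulVec,
    Matrix.fromRows_mulVec, Matrix.fromRows_mulVec, Sum.elim_comp_inl, Sum.elim_comp_inr]
  funext i
  rcases i with i | i
  · simp [Matrix.mulVec_sub, Matrix.neg_mulVec, Matrix.mulVec_mulVec]; ring
  · simp [Matrix.neg_mulVec, Matrix.mulVec_mulVec]; ring

lemma Obeys.zeta_succ (h : s.Obeys c w) (k : ℕ) :
    w.zeta (k + 1) = filterMat m p c *ᵥ w.zeta k + inputU m p (n + d * p) *ᵥ w.u k +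
      inputY m p (n + d * p) *ᵥ (s.Caug *ᵥ w.r k) + inputTh m p (n + d * p) *ᵥ w.th k := by
  obtain ⟨-, -, h1, h2, h3⟩ := h k
  rw [Signals.zeta, h1, h2, h3, filterStep_eq, filterStep_eq, filterStep_eq, Caug_mulVec_r,
    Signals.zeta, filterMat, inputU, inputY, inputTh, Matrix.fromBlocks_mulVec,
    Matrix.fromRows_mulVec, Matrix.fromRows_mulVec, Matrix.fromRows_mulVec,
    Matrix.fromRows_mulVec, Matrix.fromRows_mulVec, Sum.elim_comp_inl, Sum.elim_comp_inr,
    Matrix.fromBlocks_mulVec, Sum.elim_comp_inl, Sum.elim_comp_inr]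
  funext i
  rcases i with i | i | i <;> simp

end Sys

/-! ### Observability and reachability of the augmented plant -/

lemma mem_cspec_transpose {ι : Type*} [Fintype ι] [DecidableEq ι] {A : Matrix ι ι ℝ} {μ : ℂ} :
    μ ∈ cspec Aᵀ ↔ μ ∈ cspec A := by
  rw [cspec, cspec, Matrix.mem_spectrum_iff_isRoot_charpoly,
    Matrix.mem_spectrum_iff_isRoot_charpoly, Matrix.transpose_map, Matrix.charpoly_transpose]

namespace Sys

variable {n m p q d : ℕ} {s : Sys n m p q d}

lemma pairObservable (hobsv : Observable s.A s.C)
    (hrank : ∀ μ ∈ cspec s.S,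
      (Matrix.fromBlocks
        (s.A.map (algebraMap ℝ ℂ) - μ • (1 : Matrix (Fin n) (Fin n) ℂ))
        (s.B.map (algebraMap ℝ ℂ)) (s.C.map (algebraMap ℝ ℂ))
        (0 : Matrix (Fin p) (Fin m) ℂ)).rank = n + p)
    (hFG : IsInternalModel s.S s.F s.G) (hmp : m ≤ p) (hFT : Observable s.F s.T) :
    PairObservable s.Aaug s.Caug := by
  refine pairObservable_fromBlocks s.G hobsv.pairObservable hFT.pairObservable
    fun α β hαβ x x' u u' => eq_zero_of_rosenbrock ?_
  have h1 := hrank _ (hFG.mem_cspec hαβ)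
  refine le_antisymm (Matrix.rank_le_card_width _) ?_
  rw [h1, Fintype.card_sum, Fintype.card_fin, Fintype.card_fin]
  omega

lemma pairObservable_transpose (hctrb : Controllable s.A s.B)
    (hrank : ∀ μ ∈ cspec s.S,
      (Matrix.fromBlocks
        (s.A.map (algebraMap ℝ ℂ) - μ • (1 : Matrix (Fin n) (Fin n) ℂ))
        (s.B.map (algebraMap ℝ ℂ)) (s.C.map (algebraMap ℝ ℂ))
        (0 : Matrix (Fin p) (Fin m) ℂ)).rank = n + p)
    (hFG : IsInternalModel s.S s.F s.G) : PairObservable s.Aaugᵀ s.Baugᵀ := by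
  have e1 : s.Aaugᵀ = Matrix.fromBlocks s.Aᵀ (-(s.Cᵀ * s.Gᵀ)) (-(s.Tᵀ * s.Bᵀ)) s.Fᵀ := by
    rw [Aaug, Matrix.fromBlocks_transpose, Matrix.transpose_neg, Matrix.transpose_neg,
      Matrix.transpose_mul, Matrix.transpose_mul]
  have e2 : s.Baugᵀ = Matrix.fromCols s.Bᵀ 0 := by
    rw [Baug, Matrix.transpose_fromRows, Matrix.transpose_zero]
  rw [e1, e2]
  refine pairObservable_fromBlocks _ hctrb.pairObservable_transpose hFG.pairObservable_transpose
    fun α β hαβ x x' u u' => eq_zero_of_rosenbrock ?_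
  have h1 := hrank _ (hFG.mem_cspec (mem_cspec_transpose.1 hαβ))
  rw [← Matrix.rank_transpose, Matrix.fromBlocks_transpose, Matrix.transpose_sub,
    Matrix.transpose_smul, Matrix.transpose_one, Matrix.transpose_map, Matrix.transpose_map,
    Matrix.transpose_map, Matrix.transpose_zero, Matrix.transpose_transpose,
    Matrix.transpose_transpose, Matrix.transpose_transpose] 
  rw [h1]
  simp

lemma exists_observer_gain (h : PairObservable s.Aaug s.Caug) (c : Fin (n + d * p) → ℝ) :
    ∃ L : Matrix (RIdx n p d) (Fin p) ℝ,
      (s.Aaug - L * s.Caug).charpoly = (companion c).charpoly := by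
  have h' : Reachable s.Aaugᵀ s.Caugᵀ := PairObservable.reachable (by
    rwa [Matrix.transpose_transpose, Matrix.transpose_transpose])
  obtain ⟨K, hK⟩ := h'.exists_charpoly_eq card_rIdx c
  refine ⟨Kᵀ, ?_⟩
  rw [← hK, ← Matrix.charpoly_transpose (s.Aaugᵀ - s.Caugᵀ * K), Matrix.transpose_sub,
    Matrix.transpose_mul, Matrix.transpose_transpose, Matrix.transpose_transpose]

lemma exists_stabilizing_gain (h : PairObservable s.Aaugᵀ s.Baugᵀ) {c : Fin (n + d * p) → ℝ}
    (hc : Schur (companion c)) :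
    ∃ K : Matrix (Fin m) (RIdx n p d) ℝ, Schur (s.Aaug - s.Baug * K) := by
  obtain ⟨K, hK⟩ := h.reachable.exists_charpoly_eq card_rIdx c
  exact ⟨K, hc.of_charpoly_eq hK⟩

end Sys

/-! ### Optimal tracking with known system matrices -/

namespace Sys

variable {n m p q d : ℕ} {s : Sys n m p q d} {Q : Matrix (Fin p) (Fin p) ℝ}
  {Rb : Matrix (Fin m) (Fin m) ℝ} {c : Fin (n + d * p) → ℝ}
  {P : Matrix (RIdx n p d) (RIdx n p d) ℝ} {rq ru : ℝ}

/-- `P` is a positive semidefinite fixed point of the Bellman operator of the augmented plant, and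
its gain is stabilizing. -/
structure IsOptimalValue (s : Sys n m p q d) (Q : Matrix (Fin p) (Fin p) ℝ)
    (Rb : Matrix (Fin m) (Fin m) ℝ) (P : Matrix (RIdx n p d) (RIdx n p d) ℝ) : Prop where
  posSemidef : P.PosSemidef
  fixed : P = evalStep s.Aaug s.Baug (s.Caugᵀ * Q * s.Caug) Rb (greedy s.Aaug s.Baug Rb P) P
  schur : Schur (s.Aaug - s.Baug * greedy s.Aaug s.Baug Rb P)

lemma exists_isOptimalValue (hw : Weights (s.Caugᵀ * Q * s.Caug) Rb ru) (hQ : Coercive rq Q)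
    (hobs : PairObservable s.Aaug s.Caug) {K0 : Matrix (Fin m) (RIdx n p d) ℝ}
    (hK0 : Schur (s.Aaug - s.Baug * K0)) :
    ∃ P, s.IsOptimalValue Q Rb P := by
  obtain ⟨Ks, Ps, -, hI⟩ := exists_isPolicyIteration hw hK0
  obtain ⟨P, hPs, hP, -⟩ := hI.exists_tendsto hw
  exact ⟨P, hPs, hP, hw.schur_of_fixedPoint hQ hobs hPs hP⟩

lemma IsOptimalValue.eq_of_are (hw : Weights (s.Caugᵀ * Q * s.Caug) Rb ru) (hQ : Coercive rq Q)
    (hobs : PairObservable s.Aaug s.Caug) (h : s.IsOptimalValue Q Rb P)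
    {P' : Matrix (RIdx n p d) (RIdx n p d) ℝ} (hP' : P'.PosSemidef) (hA : s.ARE Q Rb P') :
    P' = P := by
  have hf := (hw.riccati_iff hP').1 hA
  exact hw.fixedPoint_unique hP' hf (hw.schur_of_fixedPoint hQ hobs hP' hf) h.posSemidef h.fixed
    h.schur

lemma cost_eq (s : Sys n m p q d) (Q : Matrix (Fin p) (Fin p) ℝ) (Rb : Matrix (Fin m) (Fin m) ℝ)
    (e : ℕ → RIdx n p d → ℝ) (ue : ℕ → Fin m → ℝ) (k : ℕ) :
    s.cost Q Rb e ue k = ∑' i, ENNReal.ofReal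
      (e (k + i) ⬝ᵥ ((s.Caugᵀ * Q * s.Caug) *ᵥ e (k + i)) + ue (k + i) ⬝ᵥ (Rb *ᵥ ue (k + i))) := by
  simp only [cost, dotProduct_transpose_mul_mulVec]

lemma tendsto_of_feedback {K : Matrix (Fin m) (RIdx n p d) ℝ}
    (hK : Schur (s.Aaug - s.Baug * K)) {e : ℕ → RIdx n p d → ℝ} {ue : ℕ → Fin m → ℝ}
    (he : s.IsErrorTraj e ue) (hu : ∀ k, ue k = -(K *ᵥ e k)) : Tendsto e atTop (𝓝 0) := by
  have : ∀ k, e k = (s.Aaug - s.Baug * K) ^ k *ᵥ e 0 := by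
    intro k
    induction k with
    | zero => simp
    | succ k ih =>
      rw [pow_succ_mulVec, ← ih, he, hu, Matrix.sub_mulVec, Matrix.mulVec_neg,
        Matrix.mulVec_mulVec, sub_eq_add_neg]
  exact (hK.tendsto_pow_mulVec (e 0)).congr fun k => (this k).symm

lemma IsOptimalValue.solvesProblem (hw : Weights (s.Caugᵀ * Q * s.Caug) Rb ru)
    (hQ : Coercive rq Q) {L : Matrix (RIdx n p d) (Fin p) ℝ} (hL : Schur (s.Aaug - L * s.Caug))
    (h : s.IsOptimalValue Q Rb P) : s.SolvesProblem Q Rb (s.lqrGain Rb P) := by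
  intro e ue he hu
  refine ⟨tendsto_of_feedback h.schur he hu, fun k e' ue' he' h0 => ?_⟩
  rw [cost_eq, cost_eq]
  refine (hw.tsum_le h.posSemidef h.fixed (e := fun i => e (k + i)) (u := fun i => ue (k + i))
    (fun i => he (k + i)) fun i => hu (k + i)).trans ?_
  refine le_trans (le_of_eq ?_) (hw.le_tsum hQ h.posSemidef h.fixed hL
    (e := fun i => e' (k + i)) (u := fun i => ue' (k + i)) fun i => he' (k + i))
  simp only [add_zero, h0]

lemma IsOptimalValue.eq_of_solvesProblem (hw : Weights (s.Caugᵀ * Q * s.Caug) Rb ru)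
    (h : s.IsOptimalValue Q Rb P) {K : Matrix (Fin m) (RIdx n p d) ℝ}
    (hK : s.SolvesProblem Q Rb K) : K = s.lqrGain Rb P := by
  have key : ∀ x, K *ᵥ x = s.lqrGain Rb P *ᵥ x := by
    intro x
    set e : ℕ → RIdx n p d → ℝ := fun k => (s.Aaug - s.Baug * K) ^ k *ᵥ x with he
    set e' : ℕ → RIdx n p d → ℝ := fun k => (s.Aaug - s.Baug * s.lqrGain Rb P) ^ k *ᵥ x with he'
    have htraj : ∀ K' : Matrix (Fin m) (RIdx n p d) ℝ,
        s.IsErrorTraj (fun k => (s.Aaug - s.Baug * K') ^ k *ᵥ x)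
          (fun k => -(K' *ᵥ ((s.Aaug - s.Baug * K') ^ k *ᵥ x))) := by
      intro K' k
      simp only [pow_succ_mulVec]
      rw [Matrix.sub_mulVec, Matrix.mulVec_neg, Matrix.mulVec_mulVec _ s.Baug K', sub_eq_add_neg]
    obtain ⟨h0, hmin⟩ := hK e (fun k => -(K *ᵥ e k)) (htraj K) fun k => rfl
    have hle := hmin 0 e' (fun k => -(s.lqrGain Rb P *ᵥ e' k)) (htraj _) (by simp [he, he'])
    have hub := hw.tsum_le h.posSemidef h.fixed (e := e')
      (u := fun k => -(s.lqrGain Rb P *ᵥ e' k)) (htraj _) fun k => rfl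
    rw [cost_eq, cost_eq] at hle
    simp only [zero_add] at hle
    have h00 : e' 0 = e 0 := by simp [he, he']
    have hfin := hw.eq_greedy h.posSemidef h.fixed (e := e) (K := K) (htraj K) h0
      (hle.trans (hub.trans (le_of_eq (by rw [h00]))))
    have he0 : e 0 = x := by simp [he]
    rwa [he0] at hfin
  ext i j
  have := congrFun (key (Pi.single j 1)) i
  simpa using this

/-- The steady state reproduces the reference output: the internal model admits a steady state only
if its input `G (C X₁ - R)` vanishes. -/
lemma Caug_mul_eq (hFG : IsInternalModel s.S s.F s.G) {X : Matrix (RIdx n p d) (Fin q) ℝ}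
    {U : Matrix (Fin m) (Fin q) ℝ} (hX : s.Aaug * X + s.Baug * U + s.Gaug * s.R = X * s.S) :
    s.Caug * X = s.R := by
  obtain ⟨X1, X2, rfl⟩ : ∃ X1 X2, X = Matrix.fromRows X1 X2 :=
    ⟨X.toRows₁, X.toRows₂, by simp⟩
  have h2 := congrArg Matrix.toRows₂ hX
  rw [Aaug, Baug, Gaug, Matrix.fromBlocks_mul_fromRows, Matrix.fromRows_mul, Matrix.fromRows_mul,
    Matrix.fromRows_mul, Matrix.toRows₂_fromRows] at h2
  have h3 : -(s.G * s.C) * X1 + s.F * X2 + s.G * s.R = X2 * s.S := by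
    rw [← h2]; ext i j; simp [Matrix.toRows₂]
  rw [Caug, Matrix.fromCols_mul_fromRows, Matrix.zero_mul, add_zero]
  refine sub_eq_zero.1 (hFG.eq_zero (X := X2) ?_)
  rw [← h3, Matrix.mul_sub, Matrix.neg_mul, Matrix.mul_assoc]
  abel

/-- The output-feedback controller tracks and is nearly optimal, with one constant `γ` for the limit
gain and for all gains near it. -/
lemma IsOptimalValue.exists_tracks (hw : Weights (s.Caugᵀ * Q * s.Caug) Rb ru)
    (hS : ∀ μ ∈ cspec s.S, 1 ≤ ‖μ‖) (hFG : IsInternalModel s.S s.F s.G)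
    (hc : Schur (companion c)) {L : Matrix (RIdx n p d) (Fin p) ℝ}
    (hL : (s.Aaug - L * s.Caug).charpoly = (companion c).charpoly)
    (h : s.IsOptimalValue Q Rb P) :
    ∃ γ : ℝ, 0 ≤ γ ∧
      (∃ X : Matrix (RIdx n p d) (Fin q) ℝ,
        s.Tracks Q Rb c P (s.paramMatrix L) (s.lqrGain Rb P * s.paramMatrix L)
          X (-(s.lqrGain Rb P * X)) γ 0) ∧
      ∀ η > 0, ∃ δ > 0, ∀ Kh : Matrix (Fin m) (ZIdx m p (n + d * p)) ℝ,
        ‖Kh - s.lqrGain Rb P * s.paramMatrix L‖ < δ →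
        ∃ (X : Matrix (RIdx n p d) (Fin q) ℝ) (U : Matrix (Fin m) (Fin q) ℝ),
          s.Tracks Q Rb c P (s.paramMatrix L) Kh X U γ η := by
  have hrec := s.isReconstructor hc hL
  obtain ⟨γ, hγ, δ, hδ, C, hC, hcost⟩ :=
    hrec.exists_cost_le hw h.posSemidef h.fixed h.schur hS s.R
  have key : ∀ (η : ℝ) (Kh : Matrix (Fin m) (ZIdx m p (n + d * p)) ℝ),
      ‖Kh - s.lqrGain Rb P * s.paramMatrix L‖ < δ →
      C * ‖Kh - s.lqrGain Rb P * s.paramMatrix L‖ ^ 2 ≤ η →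
      ∃ (X : Matrix (RIdx n p d) (Fin q) ℝ) (Z : Matrix (ZIdx m p (n + d * p)) (Fin q) ℝ),
        X = s.paramMatrix L * Z ∧
          s.Tracks Q Rb c P (s.paramMatrix L) Kh X (-(Kh * Z)) γ η := by
    intro η Kh hKh hη
    obtain ⟨X, Z, hX, hXZ, htr⟩ := hcost Kh hKh
    have hCX : s.Caug * X = s.R := Caug_mul_eq hFG (U := -(Kh * Z)) hX
    refine ⟨X, Z, hXZ, hX, hCX, fun xd w hcl => ?_⟩
    obtain ⟨hxd, hob, hu, hth⟩ := hcl
    obtain ⟨he, h0, hle⟩ := htr xd w.r w.zeta hxd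
      (fun k => by rw [hob.r_succ, hu, hth]) (fun k => by rw [hob.zeta_succ, hu, hth])
    have hue : ∀ k, w.u k - -(Kh * Z) *ᵥ xd k = -(Kh *ᵥ (w.zeta k - Z *ᵥ xd k)) := by
      intro k
      rw [hu, Matrix.neg_mulVec, Matrix.mulVec_sub, Matrix.mulVec_mulVec]
      abel
    refine ⟨fun k => ?_, h0, ?_, ?_⟩
    · simp only [hue]
      exact he k
    · have hcont : Continuous fun v : RIdx n p d → ℝ => s.Caug *ᵥ v := by fun_prop
      have h1 := (hcont.tendsto 0).comp h0
      rw [Matrix.mulVec_zero] at h1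
      refine h1.congr fun k => ?_
      simp only [Function.comp, Matrix.mulVec_sub, Matrix.mulVec_mulVec, hCX]
      rw [Caug_mulVec_r]
    · rw [cost_eq]
      simp only [hue, zero_add]
      refine hle.trans (ENNReal.ofReal_le_ofReal ?_)
      have hJ : 0 ≤ xd 0 ⬝ᵥ xd 0 + w.r 0 ⬝ᵥ w.r 0 + w.zeta 0 ⬝ᵥ w.zeta 0 :=
        add_nonneg (add_nonneg (dotProduct_self_nonneg' _) (dotProduct_self_nonneg' _))
          (dotProduct_self_nonneg' _)
      have := mul_le_mul_of_nonneg_right hη hJ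
      exact add_le_add le_rfl this
  refine ⟨γ, hγ, ?_, fun η hη => ?_⟩
  · obtain ⟨X, Z, hXZ, htr⟩ := key 0 (s.lqrGain Rb P * s.paramMatrix L)
      (by rw [sub_self, norm_zero]; exact hδ) (by rw [sub_self, norm_zero]; simp)
    refine ⟨X, ?_⟩
    rwa [Matrix.mul_assoc, ← hXZ] at htr
  · refine ⟨min δ (min 1 (η / C)), by positivity, fun Kh hKh => ?_⟩
    obtain ⟨h1, h2⟩ := lt_min_iff.1 hKh
    obtain ⟨h2, h3⟩ := lt_min_iff.1 h2
    obtain ⟨X, Z, -, htr⟩ := key η Kh h1 (by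
      have h4 := (lt_div_iff₀ hC).1 h3
      have h5 := norm_nonneg (Kh - s.lqrGain Rb P * s.paramMatrix L)
      have h6 : ‖Kh - s.lqrGain Rb P * s.paramMatrix L‖ ^ 2 ≤
          ‖Kh - s.lqrGain Rb P * s.paramMatrix L‖ := by nlinarith
      nlinarith)
    exact ⟨X, _, htr⟩

end Sys

/-! ### Information in the collected data -/

section Data

/-- If the rows of `D` span a space containing `v`, the smallest nonzero singular value of `D` bounds
`|D v|` from below: with `v = Dᵀ D w` one has `|v|² = ⟨D v, D w⟩` and `σ |D w| ≤ |v|`. -/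
lemma Conditioned.le_of_mem {τ κ : Type*} [Fintype τ] [Fintype κ] {σ b : ℝ}
    {D : Matrix τ κ ℝ} (h : Conditioned σ b D) {W : Submodule ℝ (κ → ℝ)} (hD : ∀ t, D t ∈ W)
    (hW : Module.finrank ℝ W ≤ D.rank) {v : κ → ℝ} (hv : v ∈ W) :
    σ ^ 2 * (v ⬝ᵥ v) ≤ (D *ᵥ v) ⬝ᵥ (D *ᵥ v) := by
  have hle : LinearMap.range (Dᵀ * D).mulVecLin ≤ W := by
    rintro _ ⟨w, rfl⟩
    rw [Matrix.mulVecLin_apply, ← Matrix.mulVec_mulVec, Matrix.mulVec_transpose]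
    have : (D *ᵥ w) ᵥ* D = ∑ t, (D *ᵥ w) t • D t := by
      funext j
      simp [Matrix.vecMul, dotProduct, Finset.sum_apply]
    rw [this]
    exact W.sum_mem fun t _ => W.smul_mem _ (hD t)
  have hr : Module.finrank ℝ (LinearMap.range (Dᵀ * D).mulVecLin) = D.rank :=
    D.rank_transpose_mul_self
  have heq := Submodule.eq_of_le_of_finrank_le hle (hr ▸ hW)
  rw [← heq] at hv
  obtain ⟨w, hw⟩ := hv
  rw [Matrix.mulVecLin_apply, ← Matrix.mulVec_mulVec] at hw
  have h1 : v ⬝ᵥ v = (D *ᵥ v) ⬝ᵥ (D *ᵥ w) := by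
    have e : v ⬝ᵥ v = v ⬝ᵥ (Dᵀ *ᵥ (D *ᵥ w)) := by rw [hw]
    rw [e, Matrix.dotProduct_mulVec, Matrix.vecMul_transpose]
  have h2 := h.1 w
  rw [hw] at h2
  have h3 := dotProduct_sq_le (D *ᵥ v) (D *ᵥ w)
  rw [← h1] at h3
  rcases (dotProduct_self_nonneg' v).eq_or_lt with h0 | h0
  · rw [← h0, mul_zero]; exact dotProduct_self_nonneg' _
  · refine le_of_mul_le_mul_left ?_ h0
    calc (v ⬝ᵥ v) * (σ ^ 2 * (v ⬝ᵥ v)) = σ ^ 2 * (v ⬝ᵥ v) ^ 2 := by ring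
      _ ≤ σ ^ 2 * (((D *ᵥ v) ⬝ᵥ (D *ᵥ v)) * ((D *ᵥ w) ⬝ᵥ (D *ᵥ w))) :=
        mul_le_mul_of_nonneg_left h3 (sq_nonneg _)
      _ = ((D *ᵥ v) ⬝ᵥ (D *ᵥ v)) * (σ ^ 2 * ((D *ᵥ w) ⬝ᵥ (D *ᵥ w))) := by ring
      _ ≤ ((D *ᵥ v) ⬝ᵥ (D *ᵥ v)) * (v ⬝ᵥ v) :=
        mul_le_mul_of_nonneg_left h2 (dotProduct_self_nonneg' _)
      _ = (v ⬝ᵥ v) * ((D *ᵥ v) ⬝ᵥ (D *ᵥ v)) := mul_comm _ _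

variable {m p N : ℕ}

/-- The vectors on the columns of the data matrix that are symmetric in the `ζ̄ ⊗ ζ̄` part. -/
def symmSlot (m p N : ℕ) : Submodule ℝ (DataIdx m p N → ℝ) where
  carrier := {v | ∀ i j, v (Sum.inl (i, j)) = v (Sum.inl (j, i))}
  add_mem' := fun {v w} hv hw i j => by rw [Pi.add_apply, Pi.add_apply, hv, hw]
  zero_mem' := fun _ _ => rfl
  smul_mem' := fun a v hv i j => by rw [Pi.smul_apply, Pi.smul_apply, hv]

lemma card_upperPairs (a : ℕ) : Fintype.card (UpperPairs a) = a * (a + 1) / 2 := by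
  rw [← Fintype.card_congr (Sym2.sortEquiv (α := Fin a)), Sym2.card, Fintype.card_fin,
    Nat.choose_two_right, Nat.add_sub_cancel, mul_comm]

lemma finrank_symmSlot_le (m p N : ℕ) :
    Module.finrank ℝ (symmSlot m p N) ≤
      (Fintype.card (ZIdx m p N) * (Fintype.card (ZIdx m p N) + 1) + m * (m + 1) + p * (p + 1)) / 2
        + Fintype.card (ZIdx m p N) * m + p * Fintype.card (ZIdx m p N) + p * m := by
  let R := (Fin m × ZIdx m p N) ⊕ UpperPairs m ⊕
    (Fin p × ZIdx m p N) ⊕ (Fin m × Fin p) ⊕ UpperPairs p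
  let g : DataIdx m p N → Sym2 (ZIdx m p N) ⊕ R := Sum.map (fun ij => s(ij.1, ij.2)) id
  have hle : symmSlot m p N ≤ LinearMap.range (LinearMap.funLeft ℝ ℝ g) := by
    intro v hv
    refine ⟨Sum.elim (Sym2.lift ⟨fun i j => v (Sum.inl (i, j)), hv⟩) (fun i => v (Sum.inr i)), ?_⟩
    funext i
    rcases i with ⟨i, j⟩ | i <;> simp [LinearMap.funLeft, g]
  have h1 := (Submodule.finrank_mono hle).trans (LinearMap.finrank_range_le _)
  refine h1.trans ?_
  rw [Module.finrank_fintype_fun_eq_card]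
  have hcard : Fintype.card (Sym2 (ZIdx m p N) ⊕ R) =
      (Fintype.card (ZIdx m p N) + 1) * Fintype.card (ZIdx m p N) / 2 +
        (m * Fintype.card (ZIdx m p N) + (m * (m + 1) / 2 +
          (p * Fintype.card (ZIdx m p N) + (m * p + p * (p + 1) / 2)))) := by
    rw [Fintype.card_sum, Fintype.card_sum, Fintype.card_sum, Fintype.card_sum, Fintype.card_sum,
      Fintype.card_prod, Fintype.card_prod, Fintype.card_prod, Fintype.card_fin, Fintype.card_fin,
      card_upperPairs, card_upperPairs, Sym2.card, Nat.choose_two_right, Nat.add_sub_cancel]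
  rw [hcard]
  generalize Fintype.card (ZIdx m p N) = k
  have hk : k * (k + 1) = 2 * ((k + 1) * k / 2) := by
    rw [Nat.mul_div_cancel' (by rw [mul_comm]; exact (Nat.even_mul_succ_self k).two_dvd), mul_comm]
  have hm : m * (m + 1) = 2 * (m * (m + 1) / 2) :=
    (Nat.mul_div_cancel' (Nat.even_mul_succ_self m).two_dvd).symm
  have hp : p * (p + 1) = 2 * (p * (p + 1) / 2) :=
    (Nat.mul_div_cancel' (Nat.even_mul_succ_self p).two_dvd).symm
  have c1 : m * k = k * m := mul_comm _ _
  have c2 : m * p = p * m := mul_comm _ _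
  rw [c1, c2]
  omega

/-- The coordinates of the joint vector `[ζ̄; ū; ϑ]`. -/
abbrev JointIdx (m p N : ℕ) : Type := ZIdx m p N ⊕ (Fin m ⊕ Fin p)

/-- The joint vector `[ζ̄; ū; ϑ]`. -/
def joint (z : ZIdx m p N → ℝ) (u : Fin m → ℝ) (th : Fin p → ℝ) : JointIdx m p N → ℝ :=
  Sum.elim z (Sum.elim u th)

/-- The coefficients of the quadratic form of `H` in the monomials listed by the data matrix. -/
def formCoeff (H : Matrix (JointIdx m p N) (JointIdx m p N) ℝ) : DataIdx m p N → ℝ :=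
  Sum.elim (fun ij => H (Sum.inl ij.1) (Sum.inl ij.2)) <|
  Sum.elim (fun ij => 2 * H (Sum.inr (Sum.inl ij.1)) (Sum.inl ij.2)) <|
  Sum.elim (fun ij => (if ij.1.1 = ij.1.2 then 1 else 2) *
    H (Sum.inr (Sum.inl ij.1.1)) (Sum.inr (Sum.inl ij.1.2))) <|
  Sum.elim (fun ij => 2 * H (Sum.inr (Sum.inr ij.1)) (Sum.inl ij.2)) <|
  Sum.elim (fun ij => 2 * H (Sum.inr (Sum.inl ij.1)) (Sum.inr (Sum.inr ij.2))) <|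
  fun ij => (if ij.1.1 = ij.1.2 then 1 else 2) *
    H (Sum.inr (Sum.inr ij.1.1)) (Sum.inr (Sum.inr ij.1.2))

lemma sum_upperPairs {a : ℕ} (f : Fin a → Fin a → ℝ) (hf : ∀ i j, f i j = f j i) :
    ∑ ij : UpperPairs a, (if ij.1.1 = ij.1.2 then 1 else 2) * f ij.1.1 ij.1.2 =
      ∑ i, ∑ j, f i j := by
  have e1 : ∑ ij : UpperPairs a, (if ij.1.1 = ij.1.2 then 1 else 2) * f ij.1.1 ij.1.2 =
      ∑ ij : Fin a × Fin a, if ij.1 ≤ ij.2 then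
        (if ij.1 = ij.2 then 1 else 2) * f ij.1 ij.2 else 0 := by
    rw [← Finset.sum_filter]
    exact (Finset.sum_subtype _ (by simp) fun ij : Fin a × Fin a =>
      (if ij.1 = ij.2 then 1 else 2) * f ij.1 ij.2).symm
  have e2 : ∀ F : Fin a → Fin a → ℝ,
      2 * ∑ i, ∑ j, F i j = ∑ i, ∑ j, (F i j + F j i) := by
    intro F
    simp only [Finset.sum_add_distrib]
    rw [Finset.sum_comm (f := fun i j => F j i)]
    ring
  rw [e1, Fintype.sum_prod_type]
  have h2 : (2 : ℝ) ≠ 0 := two_ne_zero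
  refine mul_left_cancel₀ h2 ?_
  rw [e2, e2]
  refine Finset.sum_congr rfl fun i _ => Finset.sum_congr rfl fun j _ => ?_
  simp only
  rcases lt_trichotomy i j with h | rfl | h
  · rw [if_pos h.le, if_neg h.ne, if_neg (not_le.2 h), hf j i]; ring
  · simp
  · rw [if_neg (not_le.2 h), if_pos h.le, if_neg h.ne, hf j i]; ring

lemma sum_mul_comm_of_isSymm {α β γ : Type*} [Fintype α] [Fintype β] {H : Matrix γ γ ℝ}
    (hH : H.IsSymm) (x : α → ℝ) (y : β → ℝ) (f : α → γ) (g : β → γ) :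
    ∑ i, ∑ j, x i * (H (f i) (g j) * y j) = ∑ j, ∑ i, y j * (H (g j) (f i) * x i) := by
  rw [Finset.sum_comm]
  refine Finset.sum_congr rfl fun j _ => Finset.sum_congr rfl fun i _ => ?_
  rw [hH.apply (f i) (g j)]; ring

lemma sum_sum_eq_dotProduct {α β : Type*} [Fintype α] [Fintype β] (f : α → ℝ) (g : β → ℝ)
    (F : α → β → ℝ) : ∑ i, ∑ j, f i * g j * F i j =
      (fun ij : α × β => f ij.1 * g ij.2) ⬝ᵥ (fun ij => F ij.1 ij.2) := by
  rw [dotProduct, Fintype.sum_prod_type]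

lemma sum_sum_eq_dotProduct_upperPairs {a : ℕ} (f : Fin a → ℝ) {F : Fin a → Fin a → ℝ}
    (hF : ∀ i j, F i j = F j i) : ∑ i, ∑ j, f i * f j * F i j =
      (fun ij : UpperPairs a => f ij.1.1 * f ij.1.2) ⬝ᵥ
        (fun ij => (if ij.1.1 = ij.1.2 then 1 else 2) * F ij.1.1 ij.1.2) := by
  rw [dotProduct, ← sum_upperPairs (fun i j => f i * f j * F i j)
    fun i j => by rw [hF]; ring]
  exact Finset.sum_congr rfl fun x _ => by ring

lemma sumElim_quadratic {Z κ o : Type*} [Fintype Z] [Fintype κ] [Fintype o]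
    {H : Matrix (Z ⊕ (κ ⊕ o)) (Z ⊕ (κ ⊕ o)) ℝ} (hH : H.IsSymm) (z : Z → ℝ) (u : κ → ℝ)
    (th : o → ℝ) :
    Sum.elim z (Sum.elim u th) ⬝ᵥ (H *ᵥ Sum.elim z (Sum.elim u th)) =
      ∑ i, ∑ j, z i * z j * H (Sum.inl i) (Sum.inl j) +
      (∑ i, ∑ j, u i * z j * (2 * H (Sum.inr (Sum.inl i)) (Sum.inl j)) +
      (∑ i, ∑ j, u i * u j * H (Sum.inr (Sum.inl i)) (Sum.inr (Sum.inl j)) +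
      (∑ i, ∑ j, th i * z j * (2 * H (Sum.inr (Sum.inr i)) (Sum.inl j)) +
      (∑ i, ∑ j, u i * th j * (2 * H (Sum.inr (Sum.inl i)) (Sum.inr (Sum.inr j))) +
      ∑ i, ∑ j, th i * th j * H (Sum.inr (Sum.inr i)) (Sum.inr (Sum.inr j)))))) := by
  simp only [dotProduct, Fintype.sum_sum_type, Sum.elim_inl, Sum.elim_inr,
    Matrix.mulVec, Finset.mul_sum, mul_add, Finset.sum_add_distrib]
  have e1 := sum_mul_comm_of_isSymm hH z u Sum.inl (fun j => Sum.inr (Sum.inl j))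
  have e2 := sum_mul_comm_of_isSymm hH z th Sum.inl (fun j => Sum.inr (Sum.inr j))
  have e3 := sum_mul_comm_of_isSymm hH th u (fun j => Sum.inr (Sum.inr j)) (fun j => Sum.inr (Sum.inl j))
  rw [e1, e2, e3]
  have r1 : ∀ (a b x : ℝ), a * b * (2 * x) = 2 * (a * (x * b)) := fun a b x => by ring
  have r2 : ∀ (a b x : ℝ), a * b * x = a * (x * b) := fun a b x => by ring
  simp only [r1, r2, ← Finset.mul_sum]
  ring

/-- The quadratic form of `H` is linear in the monomials listed by the data matrix. -/
lemma joint_quadratic {H : Matrix (JointIdx m p N) (JointIdx m p N) ℝ} (hH : H.IsSymm)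
    (z : ZIdx m p N → ℝ) (u : Fin m → ℝ) (th : Fin p → ℝ) :
    joint z u th ⬝ᵥ (H *ᵥ joint z u th) =
      Sum.elim (fun ij => z ij.1 * z ij.2)
        (Sum.elim (fun ij => u ij.1 * z ij.2)
          (Sum.elim (fun ij => u ij.1.1 * u ij.1.2)
            (Sum.elim (fun ij => th ij.1 * z ij.2)
              (Sum.elim (fun ij => u ij.1 * th ij.2)
                fun ij => th ij.1.1 * th ij.1.2)))) ⬝ᵥ formCoeff H := by
  rw [joint, sumElim_quadratic hH,
    sum_sum_eq_dotProduct z z fun i j => H (Sum.inl i) (Sum.inl j),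
    sum_sum_eq_dotProduct u z fun i j => 2 * H (Sum.inr (Sum.inl i)) (Sum.inl j),
    sum_sum_eq_dotProduct th z fun i j => 2 * H (Sum.inr (Sum.inr i)) (Sum.inl j),
    sum_sum_eq_dotProduct u th fun i j => 2 * H (Sum.inr (Sum.inl i)) (Sum.inr (Sum.inr j)),
    sum_sum_eq_dotProduct_upperPairs u (F := fun i j => H (Sum.inr (Sum.inl i)) (Sum.inr (Sum.inl j)))
      fun i j => (hH.apply _ _).symm,
    sum_sum_eq_dotProduct_upperPairs th
      (F := fun i j => H (Sum.inr (Sum.inr i)) (Sum.inr (Sum.inr j)))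
      fun i j => (hH.apply _ _).symm,
    formCoeff]
  simp only [sumElim_dotProduct_sumElim]

lemma norm_sq_le_formCoeff {H : Matrix (JointIdx m p N) (JointIdx m p N) ℝ} (hH : H.IsSymm) :
    ‖H‖ ^ 2 ≤ Fintype.card (JointIdx m p N) ^ 2 * (formCoeff H ⬝ᵥ formCoeff H) := by
  have hs := hH.apply
  have key := sq_apply_le_dotProduct_self (formCoeff H)
  have h2 : ∀ {x y : ℝ}, (2 * x) ^ 2 ≤ y → x ^ 2 ≤ y := fun {x y} h => by nlinarith [sq_nonneg x]
  have hif : ∀ {P : Prop} [Decidable P] {x y : ℝ}, ((if P then 1 else 2) * x) ^ 2 ≤ y → x ^ 2 ≤ y := by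
    intro P _ x y h
    split_ifs at h
    · rwa [one_mul] at h
    · exact h2 h
  have hent : ∀ a b, H a b ^ 2 ≤ formCoeff H ⬝ᵥ formCoeff H := by
    rintro (i | i | i) (j | j | j)
    · exact key (Sum.inl (i, j))
    · rw [← hs]; exact h2 (key (Sum.inr (Sum.inl (j, i))))
    · rw [← hs]; exact h2 (key (Sum.inr (Sum.inr (Sum.inr (Sum.inl (j, i))))))
    · exact h2 (key (Sum.inr (Sum.inl (i, j))))
    · rcases le_total i j with h | h
      · exact hif (key (Sum.inr (Sum.inr (Sum.inl ⟨(i, j), h⟩))))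
      · rw [← hs]; exact hif (key (Sum.inr (Sum.inr (Sum.inl ⟨(j, i), h⟩))))
    · exact h2 (key (Sum.inr (Sum.inr (Sum.inr (Sum.inr (Sum.inl (i, j)))))))
    · exact h2 (key (Sum.inr (Sum.inr (Sum.inr (Sum.inl (i, j))))))
    · rw [← hs]; exact h2 (key (Sum.inr (Sum.inr (Sum.inr (Sum.inr (Sum.inl (j, i)))))))
    · rcases le_total i j with h | h
      · exact hif (key (Sum.inr (Sum.inr (Sum.inr (Sum.inr (Sum.inr ⟨(i, j), h⟩))))))
      · rw [← hs]; exact hif (key (Sum.inr (Sum.inr (Sum.inr (Sum.inr (Sum.inr ⟨(j, i), h⟩))))))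
  rw [norm_sq_eq_sum]
  refine (Finset.sum_le_sum fun a _ => Finset.sum_le_sum fun b _ => hent a b).trans ?_
  rw [Finset.sum_const, Finset.sum_const, Finset.card_univ, nsmul_eq_mul, nsmul_eq_mul]
  exact le_of_eq (by ring)

end Data

namespace Signals

variable {n m p d : ℕ} {w : Signals n m p d} {k₀ N : ℕ} {σ b : ℝ}

/-- The joint vector `[ζ̄; ū; ϑ]` at time `k`. -/
def jointAt (w : Signals n m p d) (k : ℕ) : JointIdx m p (n + d * p) → ℝ :=
  joint (w.zeta k) (w.u k) (w.th k)

lemma dataMatrix_mulVec_formCoeff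
    {H : Matrix (JointIdx m p (n + d * p)) (JointIdx m p (n + d * p)) ℝ} (hH : H.IsSymm)
    (t : Fin N) :
    (w.dataMatrix k₀ N *ᵥ formCoeff H) t =
      w.jointAt (k₀ + t) ⬝ᵥ (H *ᵥ w.jointAt (k₀ + t)) :=
  (joint_quadratic hH _ _ _).symm

/-- Under the rank condition the data determine a quadratic form, with a bound that depends on the
singular values only. -/
lemma norm_sq_le_sum (hrank : w.RankCondition k₀ N) (hc : Conditioned σ b (w.dataMatrix k₀ N))
    {H : Matrix (JointIdx m p (n + d * p)) (JointIdx m p (n + d * p)) ℝ} (hH : H.IsSymm) :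
    σ ^ 2 * ‖H‖ ^ 2 ≤ Fintype.card (JointIdx m p (n + d * p)) ^ 2 *
      ∑ t ∈ Finset.range N,
        (w.jointAt (k₀ + t) ⬝ᵥ (H *ᵥ w.jointAt (k₀ + t))) ^ 2 := by
  have h1 := hc.le_of_mem (W := symmSlot m p (n + d * p)) (v := formCoeff H)
    (fun t i j => mul_comm _ _) ((finrank_symmSlot_le m p (n + d * p)).trans (le_of_eq hrank.symm))
    (fun i j => (hH.apply _ _).symm)
  have h2 : (w.dataMatrix k₀ N *ᵥ formCoeff H) ⬝ᵥ (w.dataMatrix k₀ N *ᵥ formCoeff H) =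
      ∑ t ∈ Finset.range N, (w.jointAt (k₀ + t) ⬝ᵥ (H *ᵥ w.jointAt (k₀ + t))) ^ 2 := by
    rw [Finset.sum_range, dotProduct]
    refine Finset.sum_congr rfl fun t _ => ?_
    rw [dataMatrix_mulVec_formCoeff hH, pow_two]
  rw [h2] at h1
  have h3 := mul_le_mul_of_nonneg_left (norm_sq_le_formCoeff hH) (sq_nonneg σ)
  have h4 := mul_le_mul_of_nonneg_left h1
    (sq_nonneg (Fintype.card (JointIdx m p (n + d * p)) : ℝ))
  linarith

lemma jointAt_dotProduct_self_le (hc : Conditioned σ b (w.dataMatrix k₀ N)) {t : ℕ} (ht : t < N) :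
    w.jointAt (k₀ + t) ⬝ᵥ w.jointAt (k₀ + t) ≤
      Fintype.card (JointIdx m p (n + d * p)) * b := by
  have hent := fun j => (le_abs_self _).trans (hc.2 ⟨t, ht⟩ j)
  have h1 : ∀ i, w.jointAt (k₀ + t) i * w.jointAt (k₀ + t) i ≤ b := by
    rintro (i | i | i)
    · exact hent (Sum.inl (i, i))
    · exact hent (Sum.inr (Sum.inr (Sum.inl ⟨(i, i), le_rfl⟩)))
    · exact hent (Sum.inr (Sum.inr (Sum.inr (Sum.inr (Sum.inr ⟨(i, i), le_rfl⟩)))))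
  refine (Finset.sum_le_sum fun i _ => h1 i).trans ?_
  rw [Finset.sum_const, Finset.card_univ, nsmul_eq_mul]

end Signals

/-! ### The data-based Bellman equation -/

section Bellman

variable {m p N : ℕ} (Zm : Matrix (ZIdx m p N) (ZIdx m p N) ℝ) (bu : Matrix (ZIdx m p N) (Fin m) ℝ)
  (bt : Matrix (ZIdx m p N) (Fin p) ℝ) (Q : Matrix (Fin p) (Fin p) ℝ) (Rb : Matrix (Fin m) (Fin m) ℝ)
  (K : Matrix (Fin m) (ZIdx m p N) ℝ) (L L' : BellmanUnknown m p N)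

/-- The difference of the two sides of the data-based Bellman equation for the gain `K`, as a function
of the filter state `z`, its successor `z'`, the inputs `u`, `th` and the output `y`. -/
def bellmanResidual (z z' : ZIdx m p N → ℝ) (u : Fin m → ℝ) (th y : Fin p → ℝ) : ℝ :=
  (z' ⬝ᵥ (L.LP *ᵥ z') - z ⬝ᵥ (L.LP *ᵥ z) - 2 * (z ⬝ᵥ (L.L1 *ᵥ (K *ᵥ z + u)))
      - u ⬝ᵥ (L.L2 *ᵥ u) + (K *ᵥ z) ⬝ᵥ (L.L2 *ᵥ (K *ᵥ z))
      - 2 * (z ⬝ᵥ (L.L3 *ᵥ th)) - 2 * (th ⬝ᵥ (L.L4 *ᵥ u)) - th ⬝ᵥ (L.L5 *ᵥ th))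
    - (-(y ⬝ᵥ (Q *ᵥ y)) - (K *ᵥ z) ⬝ᵥ (Rb *ᵥ (K *ᵥ z)))

/-- The symmetric matrix of the left-hand side of the Bellman equation for the gain `K`, as a
quadratic form in `[z; u; th]`, when the successor of `z` is `Zm z + bu u + bt th`. -/
def bellmanMatrix : Matrix (JointIdx m p N) (JointIdx m p N) ℝ :=
  (Matrix.fromCols Zm (Matrix.fromCols bu bt))ᵀ * L.LP * Matrix.fromCols Zm (Matrix.fromCols bu bt) -
    Matrix.fromBlocks (L.LP + L.L1 * K + (L.L1 * K)ᵀ - Kᵀ * L.L2 * K)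
      (Matrix.fromCols L.L1 L.L3) (Matrix.fromRows L.L1ᵀ L.L3ᵀ)
      (Matrix.fromBlocks L.L2 L.L4ᵀ L.L4 L.L5)

/-- The exact solution of the Bellman equation that belongs to the value matrix `P`. -/
def exactUnknown (P : Matrix (ZIdx m p N) (ZIdx m p N) ℝ) : BellmanUnknown m p N where
  LP := P
  L1 := Zmᵀ * P * bu
  L2 := buᵀ * P * bu
  L3 := Zmᵀ * P * bt
  L4 := btᵀ * P * bu
  L5 := btᵀ * P * bt

/-- The blockwise difference of two solutions. -/
def BellmanUnknown.sub : BellmanUnknown m p N where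
  LP := L.LP - L'.LP
  L1 := L.L1 - L'.L1
  L2 := L.L2 - L'.L2
  L3 := L.L3 - L'.L3
  L4 := L.L4 - L'.L4
  L5 := L.L5 - L'.L5

variable {Zm bu bt Q Rb K L L'}

lemma dotProduct_transpose_mulVec' {ι κ : Type*} [Fintype ι] [Fintype κ] (A : Matrix ι κ ℝ)
    (x : κ → ℝ) (y : ι → ℝ) : x ⬝ᵥ (Aᵀ *ᵥ y) = y ⬝ᵥ (A *ᵥ x) := by
  rw [Matrix.dotProduct_mulVec, Matrix.vecMul_transpose, dotProduct_comm]

lemma fromCols_mulVec_joint (z : ZIdx m p N → ℝ) (u : Fin m → ℝ) (th : Fin p → ℝ) :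
    Matrix.fromCols Zm (Matrix.fromCols bu bt) *ᵥ joint z u th =
      Zm *ᵥ z + bu *ᵥ u + bt *ᵥ th := by
  rw [joint, Matrix.fromCols_mulVec, Sum.elim_comp_inl, Sum.elim_comp_inr, Matrix.fromCols_mulVec,
    Sum.elim_comp_inl, Sum.elim_comp_inr, add_assoc]

lemma bellmanMatrix_quadratic (z : ZIdx m p N → ℝ) (u : Fin m → ℝ) (th : Fin p → ℝ) :
    joint z u th ⬝ᵥ (bellmanMatrix Zm bu bt K L *ᵥ joint z u th) =
      (Zm *ᵥ z + bu *ᵥ u + bt *ᵥ th) ⬝ᵥ (L.LP *ᵥ (Zm *ᵥ z + bu *ᵥ u + bt *ᵥ th)) -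
        z ⬝ᵥ (L.LP *ᵥ z) - 2 * (z ⬝ᵥ (L.L1 *ᵥ (K *ᵥ z + u))) - u ⬝ᵥ (L.L2 *ᵥ u) +
        (K *ᵥ z) ⬝ᵥ (L.L2 *ᵥ (K *ᵥ z)) - 2 * (z ⬝ᵥ (L.L3 *ᵥ th)) - 2 * (th ⬝ᵥ (L.L4 *ᵥ u)) -
        th ⬝ᵥ (L.L5 *ᵥ th) := by
  rw [bellmanMatrix, Matrix.sub_mulVec, dotProduct_sub, dotProduct_transpose_mul_mulVec,
    fromCols_mulVec_joint, joint, Matrix.fromBlocks_mulVec, Sum.elim_comp_inl, Sum.elim_comp_inr,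
    Matrix.fromCols_mulVec, Matrix.fromRows_mulVec, Matrix.fromBlocks_mulVec, Sum.elim_comp_inl,
    Sum.elim_comp_inr, sumElim_dotProduct_sumElim, dotProduct_add (Sum.elim u th),
    sumElim_dotProduct_sumElim, sumElim_dotProduct_sumElim]
  simp only [Matrix.add_mulVec, Matrix.sub_mulVec, dotProduct_add, dotProduct_sub,
    Matrix.mulVec_add, dotProduct_transpose_mulVec', ← Matrix.mulVec_mulVec]
  rw [dotProduct_comm (L.L2 *ᵥ (K *ᵥ z))]
  ring

lemma bellmanMatrix_isSymm (hL : L.Symm) : (bellmanMatrix Zm bu bt K L).IsSymm := by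
  obtain ⟨h1, h2, h3⟩ := hL
  rw [bellmanMatrix, Matrix.IsSymm, Matrix.transpose_sub, Matrix.fromBlocks_transpose,
    Matrix.fromBlocks_transpose, Matrix.transpose_fromCols L.L1, Matrix.transpose_fromRows L.L1ᵀ,
    h2.eq, h3.eq]
  simp only [Matrix.transpose_mul, Matrix.transpose_transpose, Matrix.transpose_add,
    Matrix.transpose_sub, h1.eq, h2.eq, Matrix.mul_assoc]
  congr 2
  abel

lemma bellmanResidual_sub (z z' : ZIdx m p N → ℝ) (u : Fin m → ℝ) (th y : Fin p → ℝ) :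
    bellmanResidual Q Rb K L z z' u th y - bellmanResidual Q Rb K L' z z' u th y =
      joint z u th ⬝ᵥ (bellmanMatrix Zm bu bt K (L.sub L') *ᵥ joint z u th) +
        (z' ⬝ᵥ ((L.sub L').LP *ᵥ z') - (Zm *ᵥ z + bu *ᵥ u + bt *ᵥ th) ⬝ᵥ
          ((L.sub L').LP *ᵥ (Zm *ᵥ z + bu *ᵥ u + bt *ᵥ th))) := by
  rw [bellmanMatrix_quadratic, bellmanResidual, bellmanResidual]
  simp only [BellmanUnknown.sub, Matrix.sub_mulVec, dotProduct_sub]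
  ring

lemma exactUnknown_symm {P : Matrix (ZIdx m p N) (ZIdx m p N) ℝ} (hP : P.IsSymm) :
    (exactUnknown Zm bu bt P).Symm := by
  refine ⟨hP, ?_, ?_⟩ <;>
  · simp only [exactUnknown, Matrix.IsSymm, Matrix.transpose_mul, Matrix.transpose_transpose, hP.eq,
      Matrix.mul_assoc]

/-- Without reconstruction error the Bellman equation of the gain `K` holds exactly; the residual
consists of the terms caused by the deviations of the successor state and of the output. -/
lemma bellmanResidual_exactUnknown {Y : Matrix (Fin p) (ZIdx m p N) ℝ}
    {P : Matrix (ZIdx m p N) (ZIdx m p N) ℝ} (hPs : P.IsSymm)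
    (hP : P = evalStep Zm bu (Yᵀ * Q * Y) Rb K P)
    (z z' : ZIdx m p N → ℝ) (u : Fin m → ℝ) (th y : Fin p → ℝ) :
    bellmanResidual Q Rb K (exactUnknown Zm bu bt P) z z' u th y =
      (z' ⬝ᵥ (P *ᵥ z') -
        (Zm *ᵥ z + bu *ᵥ u + bt *ᵥ th) ⬝ᵥ (P *ᵥ (Zm *ᵥ z + bu *ᵥ u + bt *ᵥ th))) +
      (y ⬝ᵥ (Q *ᵥ y) - (Y *ᵥ z) ⬝ᵥ (Q *ᵥ (Y *ᵥ z))) := by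
  have hcomm : ∀ v w, v ⬝ᵥ (P *ᵥ w) = w ⬝ᵥ (P *ᵥ v) := by
    intro v w
    conv_rhs => rw [← hPs.eq, dotProduct_transpose_mulVec']
  have hz : z ⬝ᵥ (P *ᵥ z) = ((Zm - bu * K) *ᵥ z) ⬝ᵥ (P *ᵥ ((Zm - bu * K) *ᵥ z)) +
      ((Y *ᵥ z) ⬝ᵥ (Q *ᵥ (Y *ᵥ z)) + (K *ᵥ z) ⬝ᵥ (Rb *ᵥ (K *ᵥ z))) := by
    conv_lhs => rw [hP, evalStep]
    simp only [Matrix.add_mulVec, dotProduct_add, dotProduct_transpose_mul_mulVec]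
  rw [Matrix.sub_mulVec, ← Matrix.mulVec_mulVec] at hz
  rw [bellmanResidual]
  simp only [exactUnknown, dotProduct_transpose_mul_mulVec]
  rw [hz]
  simp only [Matrix.mulVec_add, Matrix.mulVec_sub, add_dotProduct, dotProduct_add, sub_dotProduct,
    dotProduct_sub]
  rw [hcomm (bu *ᵥ u) (Zm *ᵥ z), hcomm (bt *ᵥ th) (Zm *ᵥ z), hcomm (bu *ᵥ (K *ᵥ z)) (Zm *ᵥ z),
    hcomm (bu *ᵥ u) (bt *ᵥ th)]
  ring

lemma quadratic_add_sub_sq_le {ι : Type*} [Fintype ι] (X : Matrix ι ι ℝ) (a e : ι → ℝ) :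
    ((a + e) ⬝ᵥ (X *ᵥ (a + e)) - a ⬝ᵥ (X *ᵥ a)) ^ 2 ≤
      ‖X‖ ^ 2 * (6 * (a ⬝ᵥ a) + 3 * (e ⬝ᵥ e)) * (e ⬝ᵥ e) := by
  have h1 := dotProduct_mulVec_sq_le X a e
  have h2 := dotProduct_mulVec_sq_le X e a
  have h3 := dotProduct_mulVec_sq_le X e e
  have e1 : (a + e) ⬝ᵥ (X *ᵥ (a + e)) - a ⬝ᵥ (X *ᵥ a) =
      a ⬝ᵥ (X *ᵥ e) + e ⬝ᵥ (X *ᵥ a) + e ⬝ᵥ (X *ᵥ e) := by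
    simp only [Matrix.mulVec_add, add_dotProduct, dotProduct_add]; ring
  rw [e1]
  have h4 : ∀ x y z : ℝ, (x + y + z) ^ 2 ≤ 3 * x ^ 2 + 3 * y ^ 2 + 3 * z ^ 2 := fun x y z => by
    nlinarith [sq_nonneg (x - y), sq_nonneg (y - z), sq_nonneg (x - z)]
  refine (h4 _ _ _).trans ?_
  linarith

lemma norm_fromRows_sq {ι κ l : Type*} [Fintype ι] [Fintype κ] [Fintype l] (A : Matrix ι l ℝ)
    (B : Matrix κ l ℝ) : ‖Matrix.fromRows A B‖ ^ 2 = ‖A‖ ^ 2 + ‖B‖ ^ 2 := by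
  rw [norm_sq_eq_sum, norm_sq_eq_sum, norm_sq_eq_sum, Fintype.sum_sum_type]
  simp

lemma sum_comp_le_of_injective {α β : Type*} [Fintype α] [Fintype β] {h : α → β}
    (hh : Function.Injective h) {F : β → ℝ} (hF : ∀ b, 0 ≤ F b) : ∑ a, F (h a) ≤ ∑ b, F b := by
  have := Finset.sum_map Finset.univ ⟨h, hh⟩ F
  rw [Function.Embedding.coeFn_mk] at this
  rw [← this]
  exact Finset.sum_le_sum_of_subset_of_nonneg (Finset.subset_univ _) fun b _ _ => hF b

lemma norm_submatrix_le {ι κ ι' κ' : Type*} [Fintype ι] [Fintype κ] [Fintype ι'] [Fintype κ']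
    (A : Matrix ι κ ℝ) {f : ι' → ι} {g : κ' → κ} (hf : Function.Injective f)
    (hg : Function.Injective g) : ‖A.submatrix f g‖ ≤ ‖A‖ := by
  refine le_of_sq_le_sq ?_ (norm_nonneg _)
  rw [norm_sq_eq_sum, norm_sq_eq_sum]
  simp only [Matrix.submatrix_apply]
  refine (Finset.sum_le_sum fun i _ => sum_comp_le_of_injective hg
    (F := fun j => A (f i) j ^ 2) fun _ => sq_nonneg _).trans ?_
  exact sum_comp_le_of_injective hf (F := fun i => ∑ j, A i j ^ 2)
    fun _ => Finset.sum_nonneg fun _ _ => sq_nonneg _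

/-- Evaluated along `u = -K z`, `th = 0`, the Bellman matrix reduces to the Lyapunov operator of the
closed loop, which bounds `LP`. -/
lemma norm_LP_le (hL : L.Symm) {c : ℝ} (hc : 0 ≤ c)
    (h : ∀ X : Matrix (ZIdx m p N) (ZIdx m p N) ℝ,
      ‖X‖ ≤ c * ‖X - (Zm - bu * K)ᵀ * X * (Zm - bu * K)‖) :
    ‖L.LP‖ ≤ c * ((‖(1 : Matrix (ZIdx m p N) (ZIdx m p N) ℝ)‖ ^ 2 + ‖K‖ ^ 2) *
      ‖bellmanMatrix Zm bu bt K L‖) := by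
  set T : Matrix (JointIdx m p N) (ZIdx m p N) ℝ :=
    Matrix.fromRows 1 (Matrix.fromRows (-K) 0) with hT
  set H := bellmanMatrix Zm bu bt K L with hH
  have hTn : ‖T‖ ^ 2 = ‖(1 : Matrix (ZIdx m p N) (ZIdx m p N) ℝ)‖ ^ 2 + ‖K‖ ^ 2 := by
    rw [hT, norm_fromRows_sq, norm_fromRows_sq, norm_neg, norm_zero]; ring
  have key : L.LP - (Zm - bu * K)ᵀ * L.LP * (Zm - bu * K) = -(Tᵀ * H * T) := by
    have hs1 : (L.LP - (Zm - bu * K)ᵀ * L.LP * (Zm - bu * K)).IsSymm := by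
      rw [Matrix.IsSymm, Matrix.transpose_sub, Matrix.transpose_mul, Matrix.transpose_mul,
        Matrix.transpose_transpose, hL.1.eq, Matrix.mul_assoc]
    have hs2 : (-(Tᵀ * H * T)).IsSymm := by
      rw [Matrix.IsSymm, Matrix.transpose_neg, Matrix.transpose_mul, Matrix.transpose_mul,
        Matrix.transpose_transpose, (bellmanMatrix_isSymm hL).eq, Matrix.mul_assoc]
    refine eq_of_quadratic_eq hs1 hs2 fun x => ?_
    have hTx : T *ᵥ x = joint x (-(K *ᵥ x)) 0 := by
      rw [hT, Matrix.fromRows_mulVec, Matrix.fromRows_mulVec, Matrix.one_mulVec, Matrix.neg_mulVec,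
        Matrix.zero_mulVec, joint]
    rw [Matrix.neg_mulVec, dotProduct_neg, dotProduct_transpose_mul_mulVec, hTx, hH,
      bellmanMatrix_quadratic, Matrix.sub_mulVec, dotProduct_sub, dotProduct_transpose_mul_mulVec,
      Matrix.sub_mulVec, ← Matrix.mulVec_mulVec]
    simp only [Matrix.mulVec_zero, Matrix.mulVec_neg, add_zero, add_neg_cancel, dotProduct_zero,
      zero_dotProduct, neg_dotProduct, dotProduct_neg, sub_eq_add_neg]
    ring
  refine (h L.LP).trans (mul_le_mul_of_nonneg_left ?_ hc)
  rw [key, norm_neg, ← hTn]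
  refine (norm_transpose_mul_mul_le T T H).trans (le_of_eq (by ring))

lemma norm_L1_le : ‖L.L1‖ ≤ ‖Zm‖ * ‖L.LP‖ * ‖bu‖ + ‖bellmanMatrix Zm bu bt K L‖ := by
  have e : L.L1 = Zmᵀ * L.LP * bu - (bellmanMatrix Zm bu bt K L).submatrix Sum.inl
      (fun j => Sum.inr (Sum.inl j)) := by
    ext i j
    simp [bellmanMatrix, Matrix.mul_apply, Matrix.transpose_apply]
  rw [e]
  refine (norm_sub_le _ _).trans (add_le_add ?_ (norm_submatrix_le _ Sum.inl_injective
    (Sum.inr_injective.comp Sum.inl_injective)))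
  refine (norm_mul_le' _ _).trans (mul_le_mul_of_nonneg_right ?_ (norm_nonneg _))
  refine (norm_mul_le' _ _).trans (le_of_eq ?_)
  rw [Matrix.frobenius_norm_transpose]

lemma norm_L2_le : ‖L.L2‖ ≤ ‖bu‖ * ‖L.LP‖ * ‖bu‖ + ‖bellmanMatrix Zm bu bt K L‖ := by
  have e : L.L2 = buᵀ * L.LP * bu - (bellmanMatrix Zm bu bt K L).submatrix
      (fun j => Sum.inr (Sum.inl j)) (fun j => Sum.inr (Sum.inl j)) := by
    ext i j
    simp [bellmanMatrix, Matrix.mul_apply, Matrix.transpose_apply]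
  rw [e]
  refine (norm_sub_le _ _).trans (add_le_add ?_ (norm_submatrix_le _
    (Sum.inr_injective.comp Sum.inl_injective) (Sum.inr_injective.comp Sum.inl_injective)))
  exact norm_transpose_mul_mul_le _ _ _

end Bellman

/-! ### Sensitivity of the least-squares policy iteration -/

section Sensitivity

variable {m p N : ℕ} {Zm : Matrix (ZIdx m p N) (ZIdx m p N) ℝ} {bu : Matrix (ZIdx m p N) (Fin m) ℝ}
  {bt : Matrix (ZIdx m p N) (Fin p) ℝ} {Y : Matrix (Fin p) (ZIdx m p N) ℝ}
  {Q : Matrix (Fin p) (Fin p) ℝ} {Rb : Matrix (Fin m) (Fin m) ℝ}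
  {K : Matrix (Fin m) (ZIdx m p N) ℝ} {L : BellmanUnknown m p N}

lemma BellmanUnknown.Symm.sub {L' : BellmanUnknown m p N} (hL : L.Symm) (hL' : L'.Symm) :
    (L.sub L').Symm :=
  ⟨Matrix.IsSymm.sub hL.1 hL'.1, Matrix.IsSymm.sub hL.2.1 hL'.2.1, Matrix.IsSymm.sub hL.2.2 hL'.2.2⟩

/-- A least-squares solution of the Bellman equation is close to the exact one when the deviations of
the data from the model `z' = Zm z + bu u + bt th`, `y = Y z` have a small square sum `s`. -/
lemma norm_bellmanMatrix_sub_sq_le {P : Matrix (ZIdx m p N) (ZIdx m p N) ℝ} (hPs : P.IsSymm)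
    (hP : P = evalStep Zm bu (Yᵀ * Q * Y) Rb K P) {ρ B s : ℝ} (hB : 0 ≤ B) (hs : s ≤ 1) {T : ℕ}
    {z z' : ℕ → ZIdx m p N → ℝ} {u : ℕ → Fin m → ℝ} {th y : ℕ → Fin p → ℝ}
    (hρ : ∀ H : Matrix (JointIdx m p N) (JointIdx m p N) ℝ, H.IsSymm → ρ * ‖H‖ ^ 2 ≤
      ∑ t ∈ Finset.range T, (joint (z t) (u t) (th t) ⬝ᵥ (H *ᵥ joint (z t) (u t) (th t))) ^ 2)
    (hb : ∀ t < T, joint (z t) (u t) (th t) ⬝ᵥ joint (z t) (u t) (th t) ≤ B)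
    {e : ℕ → ZIdx m p N → ℝ} {f : ℕ → Fin p → ℝ}
    (hz : ∀ t, z' t = Zm *ᵥ z t + bu *ᵥ u t + bt *ᵥ th t + e t)
    (hy : ∀ t, y t = Y *ᵥ z t + f t)
    (hef : ∑ t ∈ Finset.range T, (e t ⬝ᵥ e t + f t ⬝ᵥ f t) ≤ s)
    (hL : L.Symm) (hmin : ∀ L' : BellmanUnknown m p N, L'.Symm →
      ∑ t ∈ Finset.range T, bellmanResidual Q Rb K L (z t) (z' t) (u t) (th t) (y t) ^ 2 ≤
        ∑ t ∈ Finset.range T, bellmanResidual Q Rb K L' (z t) (z' t) (u t) (th t) (y t) ^ 2) :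
    ρ * ‖bellmanMatrix Zm bu bt K (L.sub (exactUnknown Zm bu bt P))‖ ^ 2 ≤
      (12 * (‖P‖ ^ 2 + ‖Q‖ ^ 2) + 3 * ‖(L.sub (exactUnknown Zm bu bt P)).LP‖ ^ 2) *
        ((6 * (‖Matrix.fromCols Zm (Matrix.fromCols bu bt)‖ ^ 2 + ‖Y‖ ^ 2) * B + 3) * s) := by
  set E := exactUnknown Zm bu bt P with hE
  set D := L.sub E with hD
  set Ψ := Matrix.fromCols Zm (Matrix.fromCols bu bt) with hΨ
  set G := 6 * (‖Ψ‖ ^ 2 + ‖Y‖ ^ 2) * B + 3 with hG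
  have hEs : E.Symm := exactUnknown_symm hPs
  have hDs : D.Symm := hL.sub hEs
  have hG0 : 0 ≤ G := by positivity
  have hd1 : ∀ t < T, e t ⬝ᵥ e t + f t ⬝ᵥ f t ≤ 1 := fun t ht =>
    ((Finset.single_le_sum (f := fun t => e t ⬝ᵥ e t + f t ⬝ᵥ f t)
      (fun t _ => add_nonneg (dotProduct_self_nonneg' _) (dotProduct_self_nonneg' _))
      (Finset.mem_range.2 ht)).trans hef).trans hs
  -- the two kinds of perturbation terms
  have hquad : ∀ t < T, ∀ X : Matrix (ZIdx m p N) (ZIdx m p N) ℝ,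
      (z' t ⬝ᵥ (X *ᵥ z' t) - (Zm *ᵥ z t + bu *ᵥ u t + bt *ᵥ th t) ⬝ᵥ
        (X *ᵥ (Zm *ᵥ z t + bu *ᵥ u t + bt *ᵥ th t))) ^ 2 ≤
          ‖X‖ ^ 2 * (G * (e t ⬝ᵥ e t + f t ⬝ᵥ f t)) := by
    intro t ht X
    rw [hz]
    refine (quadratic_add_sub_sq_le X _ _).trans ?_
    rw [mul_assoc]
    refine mul_le_mul_of_nonneg_left ?_ (sq_nonneg _)
    have p1 := mulVec_dotProduct_self_le Ψ (joint (z t) (u t) (th t))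
    rw [hΨ, fromCols_mulVec_joint] at p1
    have p2 := mul_le_mul_of_nonneg_left (hb t ht) (sq_nonneg ‖Ψ‖)
    have p3 := hd1 t ht
    have p4 := dotProduct_self_nonneg' (f t)
    have p5 := dotProduct_self_nonneg' (e t)
    have p6 : 0 ≤ ‖Y‖ ^ 2 * B := by positivity
    refine mul_le_mul ?_ (by linarith) p5 hG0
    rw [hG]
    linarith
  have hout : ∀ t < T, (y t ⬝ᵥ (Q *ᵥ y t) - (Y *ᵥ z t) ⬝ᵥ (Q *ᵥ (Y *ᵥ z t))) ^ 2 ≤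
      ‖Q‖ ^ 2 * (G * (e t ⬝ᵥ e t + f t ⬝ᵥ f t)) := by
    intro t ht
    rw [hy]
    refine (quadratic_add_sub_sq_le Q _ _).trans ?_
    rw [mul_assoc]
    refine mul_le_mul_of_nonneg_left ?_ (sq_nonneg _)
    have p1 := mulVec_dotProduct_self_le Y (z t)
    have p0 : z t ⬝ᵥ z t ≤ B := by
      refine le_trans ?_ (hb t ht)
      rw [joint, sumElim_dotProduct_sumElim]
      exact le_add_of_nonneg_right (dotProduct_self_nonneg' _)
    have p2 := mul_le_mul_of_nonneg_left p0 (sq_nonneg ‖Y‖)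
    have p3 := hd1 t ht
    have p4 := dotProduct_self_nonneg' (f t)
    have p5 := dotProduct_self_nonneg' (e t)
    have p6 : 0 ≤ ‖Ψ‖ ^ 2 * B := by positivity
    refine mul_le_mul ?_ (by linarith) p4 hG0
    rw [hG]
    linarith
  set res : BellmanUnknown m p N → ℕ → ℝ := fun L' t =>
    bellmanResidual Q Rb K L' (z t) (z' t) (u t) (th t) (y t) with hres
  -- the exact unknown violates the Bellman equation only through the perturbations
  have hEres : ∀ t < T, res E t ^ 2 ≤
      2 * (‖P‖ ^ 2 + ‖Q‖ ^ 2) * (G * (e t ⬝ᵥ e t + f t ⬝ᵥ f t)) := by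
    intro t ht
    rw [hres]
    simp only
    rw [hE, bellmanResidual_exactUnknown hPs hP]
    have h1 := hquad t ht P
    have h2 := hout t ht
    refine (add_sq_le).trans ?_
    linarith
  have hX : ∀ t < T, (joint (z t) (u t) (th t) ⬝ᵥ
      (bellmanMatrix Zm bu bt K D *ᵥ joint (z t) (u t) (th t))) ^ 2 ≤
        3 * res L t ^ 2 + 3 * res E t ^ 2 +
          3 * ‖D.LP‖ ^ 2 * (G * (e t ⬝ᵥ e t + f t ⬝ᵥ f t)) := by
    intro t ht
    have h1 := bellmanResidual_sub (Zm := Zm) (bu := bu) (bt := bt) (Q := Q) (Rb := Rb) (K := K)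
      (L := L) (L' := E) (z t) (z' t) (u t) (th t) (y t)
    have h2 := hquad t ht D.LP
    rw [← hD] at h1
    set a := joint (z t) (u t) (th t) ⬝ᵥ
      (bellmanMatrix Zm bu bt K D *ᵥ joint (z t) (u t) (th t))
    set b := z' t ⬝ᵥ (D.LP *ᵥ z' t) - (Zm *ᵥ z t + bu *ᵥ u t + bt *ᵥ th t) ⬝ᵥ
        (D.LP *ᵥ (Zm *ᵥ z t + bu *ᵥ u t + bt *ᵥ th t))
    have h3 : a = res L t - res E t - b := by
      rw [hres]; simp only; rw [h1]; ring
    rw [h3]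
    nlinarith [sq_nonneg (res L t + res E t), sq_nonneg (res L t + b), sq_nonneg (res E t - b)]
  have hsumE : ∑ t ∈ Finset.range T, res E t ^ 2 ≤ 2 * (‖P‖ ^ 2 + ‖Q‖ ^ 2) * (G * s) := by
    refine (Finset.sum_le_sum fun t ht => hEres t (Finset.mem_range.1 ht)).trans ?_
    rw [← Finset.mul_sum, ← Finset.mul_sum]
    exact mul_le_mul_of_nonneg_left (mul_le_mul_of_nonneg_left hef hG0) (by positivity)
  refine (hρ _ (bellmanMatrix_isSymm hDs)).trans ?_
  refine (Finset.sum_le_sum fun t ht => hX t (Finset.mem_range.1 ht)).trans ?_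
  rw [Finset.sum_add_distrib, Finset.sum_add_distrib, ← Finset.mul_sum, ← Finset.mul_sum,
    ← Finset.mul_sum, ← Finset.mul_sum]
  -- the exact unknown competes in the least-squares problem
  have h1 : ∑ t ∈ Finset.range T, res L t ^ 2 ≤ ∑ t ∈ Finset.range T, res E t ^ 2 := hmin E hEs
  have h2 := mul_le_mul_of_nonneg_left (mul_le_mul_of_nonneg_left hef hG0)
    (by positivity : 0 ≤ 3 * ‖D.LP‖ ^ 2)
  linarith

lemma norm_gain_sub_le {ι κ : Type*} [Fintype ι] [Fintype κ] [DecidableEq κ] {r : ℝ}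
    {S D : Matrix κ κ ℝ} (hS : Coercive r S) (hD : ‖D‖ ≤ r / 2) {E F G : Matrix κ ι ℝ}
    (hG : S * G = E) :
    r / 2 * ‖(S + D)⁻¹ * (E + F) - G‖ ≤ ‖F‖ + ‖D‖ * ‖G‖ := by
  have hr := hS.1
  have hSD : Coercive (r / 2) (S + D) := by
    refine ⟨by positivity, fun x => ?_⟩
    have h1 := hS.2 x
    have h2 := neg_le_of_abs_le (abs_quadratic_le D x)
    have h3 := mul_le_mul_of_nonneg_right hD (dotProduct_self_nonneg' x)
    rw [Matrix.add_mulVec, dotProduct_add]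
    linarith
  refine (hSD.norm_le _).trans ?_
  rw [Matrix.mul_sub, Matrix.mul_nonsing_inv_cancel_left _ _ hSD.isUnit_det, Matrix.add_mul, hG]
  have e : E + F - (E + D * G) = F - D * G := by abel
  rw [e]
  exact (norm_sub_le _ _).trans (add_le_add le_rfl (norm_mul_le' _ _))

/-- Uniform bounds for policy evaluation and policy improvement near a stabilizing gain. -/
lemma Weights.exists_bounds_nhds {ι κ : Type*} [Fintype ι] [DecidableEq ι] [Fintype κ]
    [DecidableEq κ] {A : Matrix ι ι ℝ} {B : Matrix ι κ ℝ} {W : Matrix ι ι ℝ} {R : Matrix κ κ ℝ}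
    {r : ℝ} (hw : Weights W R r) {Kb : Matrix κ ι ℝ} (hKb : Schur (A - B * Kb)) :
    ∃ δ > 0, ∃ c > 0, ∀ K : Matrix κ ι ℝ, ‖K - Kb‖ < δ →
      (∀ X : Matrix ι ι ℝ, ‖X‖ ≤ c * ‖X - (A - B * K)ᵀ * X * (A - B * K)‖) ∧ ‖K‖ ≤ c ∧
      ∃ P : Matrix ι ι ℝ, P = evalStep A B W R K P ∧ P.PosSemidef ∧ ‖P‖ ≤ c ∧
        ‖greedy A B R P‖ ≤ c := by
  obtain ⟨Pb, hPb⟩ := exists_eval W R hKb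
  have hPbs := hw.posSemidef_of_eval hKb hPb
  obtain ⟨δ1, hδ1, c0, hc0, hnhds⟩ := hw.exists_eval_nhds hKb hPb
  have hr := hw.coercive.1
  have hg0 : 0 ≤ ‖Kb - greedy A B R Pb‖ := norm_nonneg _
  set dp := c0 * (1 + ‖Kb - greedy A B R Pb‖) with hdp
  have hdp0 : 0 ≤ dp := by positivity
  set gd := ‖B‖ * dp * ‖A - B * greedy A B R Pb‖ / r with hgd
  have hgd0 : 0 ≤ gd := by positivity
  have n1 := norm_nonneg Kb
  have n2 := norm_nonneg Pb
  have n3 := norm_nonneg (greedy A B R Pb)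
  set c := c0 + (‖Kb‖ + 1) + (‖Pb‖ + dp) + (‖greedy A B R Pb‖ + gd) with hc
  refine ⟨min δ1 1, by positivity, c, by positivity, fun K hK => ?_⟩
  obtain ⟨hK1, hK2⟩ := lt_min_iff.1 hK
  obtain ⟨hKS, hlyap, heval⟩ := hnhds K hK1
  obtain ⟨P, hP⟩ := exists_eval W R hKS
  have hPs := hw.posSemidef_of_eval hKS hP
  have hK0 := norm_nonneg (K - Kb)
  refine ⟨fun X => (hlyap X).trans (mul_le_mul_of_nonneg_right (by linarith) (norm_nonneg _)), ?_,
    P, hP, hPs, ?_⟩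
  · have := norm_add_le Kb (K - Kb)
    rw [add_sub_cancel] at this
    linarith
  have hPP : ‖P - Pb‖ ≤ dp := by
    refine (heval P hP).trans (mul_le_mul_of_nonneg_left ?_ hc0.le)
    have : ‖K - Kb‖ ^ 2 ≤ 1 := by nlinarith
    have : ‖Kb - greedy A B R Pb‖ * ‖K - Kb‖ ≤ ‖Kb - greedy A B R Pb‖ := by nlinarith
    linarith
  constructor
  · have := norm_add_le Pb (P - Pb)
    rw [add_sub_cancel] at this
    linarith
  · have h1 := hw.norm_greedy_sub_le (A := A) (B := B) hPs hPbs
    have h2 : ‖B‖ * ‖P - Pb‖ * ‖A - B * greedy A B R Pb‖ ≤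
        ‖B‖ * dp * ‖A - B * greedy A B R Pb‖ :=
      mul_le_mul_of_nonneg_right (mul_le_mul_of_nonneg_left hPP (norm_nonneg _)) (norm_nonneg _)
    have h3 : ‖greedy A B R P - greedy A B R Pb‖ ≤ gd := by
      rw [hgd, le_div_iff₀ hr]; linarith
    have := norm_add_le (greedy A B R Pb) (greedy A B R P - greedy A B R Pb)
    rw [add_sub_cancel] at this
    linarith

/-- Near a stabilizing gain, one step of the least-squares policy iteration is uniformly close to the
exact improvement, provided that the deviations of the data from the model have a small square sum.
The radius `δ` does not depend on the data. -/
lemma exists_gain_estimate {r : ℝ} (hw : Weights (Yᵀ * Q * Y) Rb r)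
    {Kb : Matrix (Fin m) (ZIdx m p N) ℝ} (hKb : Schur (Zm - bu * Kb))
    (bt : Matrix (ZIdx m p N) (Fin p) ℝ) :
    ∃ δ > 0, ∀ ρ > 0, ∀ B ≥ 0, ∀ η > 0, ∃ s > 0, ∀ K : Matrix (Fin m) (ZIdx m p N) ℝ,
      ‖K - Kb‖ < δ → ∀ (T : ℕ) (z z' : ℕ → ZIdx m p N → ℝ) (u : ℕ → Fin m → ℝ)
        (th y : ℕ → Fin p → ℝ) (e : ℕ → ZIdx m p N → ℝ) (f : ℕ → Fin p → ℝ),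
      (∀ H : Matrix (JointIdx m p N) (JointIdx m p N) ℝ, H.IsSymm → ρ * ‖H‖ ^ 2 ≤
        ∑ t ∈ Finset.range T, (joint (z t) (u t) (th t) ⬝ᵥ (H *ᵥ joint (z t) (u t) (th t))) ^ 2) →
      (∀ t < T, joint (z t) (u t) (th t) ⬝ᵥ joint (z t) (u t) (th t) ≤ B) →
      (∀ t, z' t = Zm *ᵥ z t + bu *ᵥ u t + bt *ᵥ th t + e t) →
      (∀ t, y t = Y *ᵥ z t + f t) →
      ∑ t ∈ Finset.range T, (e t ⬝ᵥ e t + f t ⬝ᵥ f t) ≤ s →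
      ∀ L : BellmanUnknown m p N, L.Symm →
      (∀ L' : BellmanUnknown m p N, L'.Symm →
        ∑ t ∈ Finset.range T, bellmanResidual Q Rb K L (z t) (z' t) (u t) (th t) (y t) ^ 2 ≤
          ∑ t ∈ Finset.range T, bellmanResidual Q Rb K L' (z t) (z' t) (u t) (th t) (y t) ^ 2) →
      ∃ P, P = evalStep Zm bu (Yᵀ * Q * Y) Rb K P ∧
        ‖(Rb + L.L2)⁻¹ * L.L1ᵀ - greedy Zm bu Rb P‖ < η := by
  obtain ⟨δ, hδ, c, hc, hnhds⟩ := hw.exists_bounds_nhds hKb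
  have hr := hw.coercive.1
  obtain ⟨cl, hcl⟩ : ∃ cl, cl = c * (‖(1 : Matrix (ZIdx m p N) (ZIdx m p N) ℝ)‖ ^ 2 + c ^ 2) :=
    ⟨_, rfl⟩
  obtain ⟨c5, hc5⟩ : ∃ c5, c5 = (‖Zm‖ * ‖bu‖ + ‖bu‖ * ‖bu‖) * cl + 1 := ⟨_, rfl⟩
  have hcl0 : 0 ≤ cl := by rw [hcl]; positivity
  have hc50 : 0 < c5 := by rw [hc5]; positivity
  refine ⟨δ, hδ, fun ρ hρ B hB η hη => ?_⟩
  obtain ⟨G, hG⟩ : ∃ G, G =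
    6 * (‖Matrix.fromCols Zm (Matrix.fromCols bu bt)‖ ^ 2 + ‖Y‖ ^ 2) * B + 3 := ⟨_, rfl⟩
  have hG0 : 0 < G := by rw [hG]; positivity
  obtain ⟨c3, hc3⟩ : ∃ c3, c3 = 12 * (c ^ 2 + ‖Q‖ ^ 2) * G := ⟨_, rfl⟩
  obtain ⟨c4, hc4⟩ : ∃ c4, c4 = 3 * cl ^ 2 * G := ⟨_, rfl⟩
  have hc30 : 0 ≤ c3 := by rw [hc3]; positivity
  have hc40 : 0 ≤ c4 := by rw [hc4]; positivity
  -- `τ` is the admissible error of the quadratic form, and `s` keeps the bound of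
  -- `norm_bellmanMatrix_sub_sq_le`, which has the form `ρ h² ≤ c3 s + c4 s h²`, below `ρ τ²`
  obtain ⟨τ, hτ⟩ : ∃ τ, τ = min (r / 2) (η * r / (4 * (1 + c))) / c5 := ⟨_, rfl⟩
  have hτ0 : 0 < τ := by rw [hτ]; positivity
  obtain ⟨s, hs⟩ : ∃ s, s = min 1 (min (ρ / (2 * (c4 + 1))) (ρ * τ ^ 2 / (2 * (c3 + 1)))) :=
    ⟨_, rfl⟩
  have hs0 : 0 < s := by rw [hs]; positivity
  have hs1 : s ≤ 1 := by rw [hs]; exact min_le_left _ _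
  have hs2 : c4 * s ≤ ρ / 2 := by
    have h1 : s ≤ ρ / (2 * (c4 + 1)) := by
      rw [hs]; exact (min_le_right _ _).trans (min_le_left _ _)
    rw [le_div_iff₀ (by positivity)] at h1
    linarith
  have hs3 : c3 * s ≤ ρ * τ ^ 2 / 2 := by
    have h1 : s ≤ ρ * τ ^ 2 / (2 * (c3 + 1)) := by
      rw [hs]; exact (min_le_right _ _).trans (min_le_right _ _)
    rw [le_div_iff₀ (by positivity)] at h1
    linarith
  refine ⟨s, hs0, fun K hK T z z' u th y e f hinf hb hz hy hef L hL hmin => ?_⟩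
  obtain ⟨hlyap, hKn, P, hP, hPs, hPn, hgn⟩ := hnhds K hK
  have hPsymm := (posSemidef_iff_real.1 hPs).1
  refine ⟨P, hP, ?_⟩
  set D := L.sub (exactUnknown Zm bu bt P) with hD
  set h := ‖bellmanMatrix Zm bu bt K D‖ with hh
  have hh0 : 0 ≤ h := norm_nonneg _
  have hEs : (exactUnknown Zm bu bt P).Symm := exactUnknown_symm hPsymm
  have hDs : D.Symm := hL.sub hEs
  have hLP : ‖D.LP‖ ≤ cl * h := by
    refine (norm_LP_le (bt := bt) hDs hc.le hlyap).trans ?_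
    rw [hcl, mul_assoc]
    refine mul_le_mul_of_nonneg_left (mul_le_mul_of_nonneg_right ?_ hh0) hc.le
    exact add_le_add le_rfl (pow_le_pow_left₀ (norm_nonneg _) hKn 2)
  have hmain := norm_bellmanMatrix_sub_sq_le hPsymm hP hB hs1 hinf hb hz hy hef hL hmin
  rw [← hD, ← hh, ← hG] at hmain
  have hhτ : h ≤ τ := by
    have h1 : ‖D.LP‖ ^ 2 ≤ cl ^ 2 * h ^ 2 := by
      rw [← mul_pow]; exact pow_le_pow_left₀ (norm_nonneg _) hLP 2
    have h2 : ‖P‖ ^ 2 ≤ c ^ 2 := pow_le_pow_left₀ (norm_nonneg _) hPn 2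
    have h3 : ρ * h ^ 2 ≤ (12 * (c ^ 2 + ‖Q‖ ^ 2) + 3 * (cl ^ 2 * h ^ 2)) * (G * s) := by
      refine hmain.trans (mul_le_mul_of_nonneg_right ?_ (by positivity))
      linarith
    have h4 : (12 * (c ^ 2 + ‖Q‖ ^ 2) + 3 * (cl ^ 2 * h ^ 2)) * (G * s) =
        c3 * s + c4 * s * h ^ 2 := by rw [hc3, hc4]; ring
    rw [h4] at h3
    have h5 := mul_le_mul_of_nonneg_right hs2 (sq_nonneg h)
    have h6 : ρ * h ^ 2 ≤ ρ * τ ^ 2 := by linarith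
    exact le_of_sq_le_sq (le_of_mul_le_mul_left h6 hρ) hτ0.le
  have hc5h : c5 * h ≤ min (r / 2) (η * r / (4 * (1 + c))) := by
    rw [mul_comm]; exact (le_div_iff₀ hc50).1 (hτ ▸ hhτ)
  have hL1 : ‖D.L1‖ ≤ c5 * h := by
    refine (norm_L1_le (Zm := Zm) (bu := bu) (bt := bt) (K := K)).trans ?_
    have h1 := mul_le_mul_of_nonneg_left hLP (mul_nonneg (norm_nonneg Zm) (norm_nonneg bu))
    have h2 : 0 ≤ ‖bu‖ * ‖bu‖ * cl * h := by positivity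
    rw [hc5, ← hh]
    linarith
  have hL2 : ‖D.L2‖ ≤ c5 * h := by
    refine (norm_L2_le (Zm := Zm) (bu := bu) (bt := bt) (K := K)).trans ?_
    have h1 := mul_le_mul_of_nonneg_left hLP (mul_nonneg (norm_nonneg bu) (norm_nonneg bu))
    have h2 : 0 ≤ ‖Zm‖ * ‖bu‖ * cl * h := by positivity
    rw [hc5, ← hh]
    linarith
  have hfin := norm_gain_sub_le (coercive_add (B := bu) hw.coercive hPs)
    (D := D.L2) (F := D.L1ᵀ) (hL2.trans (hc5h.trans (min_le_left _ _))) (hw.mul_greedy (A := Zm) hPs)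
  have e1 : Rb + buᵀ * P * bu + D.L2 = Rb + L.L2 := by
    have : D.L2 = L.L2 - buᵀ * P * bu := rfl
    rw [this]; abel
  have e2 : buᵀ * P * Zm + D.L1ᵀ = L.L1ᵀ := by
    have h1 : D.L1 = L.L1 - Zmᵀ * P * bu := rfl
    have h2 : (Zmᵀ * P * bu)ᵀ = buᵀ * P * Zm := by
      rw [Matrix.transpose_mul, Matrix.transpose_mul, Matrix.transpose_transpose, hPsymm.eq,
        Matrix.mul_assoc]
    rw [h1, Matrix.transpose_sub, h2]; abel
  rw [e1, e2, Matrix.frobenius_norm_transpose] at hfin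
  have hb2 : c5 * h * (4 * (1 + c)) ≤ η * r :=
    (le_div_iff₀ (by positivity)).1 (hc5h.trans (min_le_right _ _))
  have hfin2 : ‖D.L1‖ + ‖D.L2‖ * ‖greedy Zm bu Rb P‖ ≤ c5 * h * (1 + c) := by
    have h1 : ‖D.L2‖ * ‖greedy Zm bu Rb P‖ ≤ c5 * h * c :=
      mul_le_mul hL2 hgn (norm_nonneg _) (by positivity)
    linarith
  have hηr : 0 < η * r := by positivity
  by_contra hcon
  have := mul_le_mul_of_nonneg_left (not_lt.1 hcon) (by positivity : 0 ≤ r / 2)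
  linarith

end Sensitivity

/-! ### Inexact policy iteration -/

section Inexact

variable {ι κ : Type*} [Fintype ι] [DecidableEq ι] [Fintype κ] [DecidableEq κ]
  {A : Matrix ι ι ℝ} {B : Matrix ι κ ℝ} {W : Matrix ι ι ℝ} {R : Matrix κ κ ℝ} {r : ℝ}
  {P : Matrix ι ι ℝ}

/-- Local behaviour of one step of exact policy iteration: continuous in general, and quadratically
contracting at a gain that is its own improvement. -/
lemma Weights.exists_greedy_nhds (h : Weights W R r) {K : Matrix κ ι ℝ} (hK : Schur (A - B * K))
    (hP : P = evalStep A B W R K P) :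
    ∃ δ > 0, ∃ c > 0, ∀ K' : Matrix κ ι ℝ, ‖K' - K‖ < δ → ∀ P', P' = evalStep A B W R K' P' →
      ‖greedy A B R P' - greedy A B R P‖ ≤
        c * (‖K' - K‖ ^ 2 + ‖K - greedy A B R P‖ * ‖K' - K‖) := by
  obtain ⟨δ, hδ, c, hc, hn⟩ := h.exists_eval_nhds hK hP
  have hr := h.coercive.1
  refine ⟨δ, hδ, ‖B‖ * c * ‖A - B * greedy A B R P‖ / r + 1, by positivity,
    fun K' hK' P' hP' => ?_⟩
  obtain ⟨hS, -, hest⟩ := hn K' hK'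
  have h1 := h.norm_greedy_sub_le (A := A) (B := B) (h.posSemidef_of_eval hS hP')
    (h.posSemidef_of_eval hK hP)
  have h2 := mul_le_mul_of_nonneg_right (mul_le_mul_of_nonneg_left (hest P' hP') (norm_nonneg B))
    (norm_nonneg (A - B * greedy A B R P))
  have hx : 0 ≤ ‖K' - K‖ ^ 2 + ‖K - greedy A B R P‖ * ‖K' - K‖ := by positivity
  set x := ‖K' - K‖ ^ 2 + ‖K - greedy A B R P‖ * ‖K' - K‖
  have h3 : ‖greedy A B R P' - greedy A B R P‖ ≤
      ‖B‖ * c * ‖A - B * greedy A B R P‖ / r * x := by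
    rw [div_mul_eq_mul_div, le_div_iff₀ hr]
    linarith
  linarith

/-- A family of runs of an inexact policy iteration, indexed by a parameter `k`: all runs start at
`K0`, and near every stabilizing gain the steps become exact as `k` grows. -/
structure IsInexactIteration (A : Matrix ι ι ℝ) (B : Matrix ι κ ℝ) (W : Matrix ι ι ℝ)
    (R : Matrix κ κ ℝ) (K0 : Matrix κ ι ℝ) (runs : ℕ → Set (ℕ → Matrix κ ι ℝ)) : Prop where
  schur_zero : Schur (A - B * K0)
  zero : ∀ k, ∀ Ks ∈ runs k, Ks 0 = K0
  step : ∀ Kb : Matrix κ ι ℝ, Schur (A - B * Kb) → ∃ δ > 0, ∀ η > 0, ∃ k₁, ∀ k ≥ k₁,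
    ∀ Ks ∈ runs k, ∀ j, ‖Ks j - Kb‖ < δ →
      ∃ P, P = evalStep A B W R (Ks j) P ∧ ‖Ks (j + 1) - greedy A B R P‖ < η

namespace IsInexactIteration

variable {K0 : Matrix κ ι ℝ} {runs : ℕ → Set (ℕ → Matrix κ ι ℝ)} {Kx : ℕ → Matrix κ ι ℝ}
  {Px : ℕ → Matrix ι ι ℝ}

/-- On a finite horizon the inexact runs follow the exact one. -/
lemma near_exact (h : IsInexactIteration A B W R K0 runs) (hw : Weights W R r)
    (hx : IsPolicyIteration A B W R Kx Px) (h0 : Kx 0 = K0) (J : ℕ) :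
    ∀ η > 0, ∃ k₁, ∀ k ≥ k₁, ∀ Ks ∈ runs k, ∀ j ≤ J, ‖Ks j - Kx j‖ < η := by
  induction J with
  | zero =>
    intro η hη
    refine ⟨0, fun k _ Ks hKs j hj => ?_⟩
    rw [Nat.le_zero.1 hj, h.zero k Ks hKs, h0, sub_self, norm_zero]
    exact hη
  | succ J ih =>
    intro η hη
    obtain ⟨δ1, hδ1, hstep⟩ := h.step (Kx J) (hx.schur hw J)
    obtain ⟨k1, hk1⟩ := hstep (η / 2) (by positivity)
    obtain ⟨δ2, hδ2, c, hc, hn⟩ := hw.exists_greedy_nhds (hx.schur hw J) (hx.eval J)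
    set g := ‖Kx J - greedy A B R (Px J)‖
    have hg : 0 ≤ g := norm_nonneg _
    set x := min (min δ1 δ2) (min (min 1 η) (η / (2 * (c * (1 + g))))) with hxdef
    obtain ⟨k2, hk2⟩ := ih x (by positivity)
    refine ⟨max k1 k2, fun k hk Ks hKs j hj => ?_⟩
    have hJ := hk2 k ((le_max_right _ _).trans hk) Ks hKs
    rcases Nat.le_succ_iff.1 hj with hj | rfl
    · exact (hJ j hj).trans_le ((min_le_right _ _).trans ((min_le_left _ _).trans (min_le_right _ _)))
    have hxJ := hJ J le_rfl
    obtain ⟨p1, p2⟩ := lt_min_iff.1 hxJ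
    obtain ⟨p3, p4⟩ := lt_min_iff.1 p1
    obtain ⟨p5, p6⟩ := lt_min_iff.1 p2
    obtain ⟨p7, -⟩ := lt_min_iff.1 p5
    obtain ⟨P, hP, hPn⟩ := hk1 k ((le_max_left _ _).trans hk) Ks hKs J p3
    have h1 := hn (Ks J) p4 P hP
    rw [lt_div_iff₀ (by positivity)] at p6
    have p0 := norm_nonneg (Ks J - Kx J)
    have h2 : c * (‖Ks J - Kx J‖ ^ 2 + g * ‖Ks J - Kx J‖) ≤
        ‖Ks J - Kx J‖ * (c * (1 + g)) := by
      have : ‖Ks J - Kx J‖ ^ 2 ≤ ‖Ks J - Kx J‖ := by nlinarith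
      nlinarith
    rw [hx.improve]
    have h3 := norm_sub_le_norm_sub_add_norm_sub (Ks (J + 1)) (greedy A B R P)
      (greedy A B R (Px J))
    linarith

/-- Small balls around the optimal gain are invariant: the exact step contracts quadratically. -/
lemma invariant (h : IsInexactIteration A B W R K0 runs) (hw : Weights W R r)
    (hP : P = evalStep A B W R (greedy A B R P) P) (hK : Schur (A - B * greedy A B R P)) :
    ∃ η₀ > 0, ∀ η > 0, η ≤ η₀ → ∃ k₁, ∀ k ≥ k₁, ∀ Ks ∈ runs k, ∀ j,
      ‖Ks j - greedy A B R P‖ < η → ‖Ks (j + 1) - greedy A B R P‖ < η := by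
  obtain ⟨δ1, hδ1, hstep⟩ := h.step _ hK
  obtain ⟨δ2, hδ2, c, hc, hn⟩ := hw.exists_greedy_nhds hK hP
  refine ⟨min (min δ1 δ2) (1 / (2 * c)), by positivity, fun η hη hle => ?_⟩
  obtain ⟨k1, hk1⟩ := hstep (η / 2) (by positivity)
  refine ⟨k1, fun k hk Ks hKs j hj => ?_⟩
  have q1 : η ≤ δ1 := hle.trans ((min_le_left _ _).trans (min_le_left _ _))
  have q2 : η ≤ δ2 := hle.trans ((min_le_left _ _).trans (min_le_right _ _))
  have q3 : η ≤ 1 / (2 * c) := hle.trans (min_le_right _ _)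
  obtain ⟨P', hP', hPn⟩ := hk1 k hk Ks hKs j (hj.trans_le q1)
  have h1 := hn (Ks j) (hj.trans_le q2) P' hP'
  rw [sub_self, norm_zero, zero_mul, add_zero] at h1
  rw [le_div_iff₀ (by positivity)] at q3
  have p0 := norm_nonneg (Ks j - greedy A B R P)
  have h2 : c * ‖Ks j - greedy A B R P‖ ^ 2 ≤ c * η ^ 2 :=
    mul_le_mul_of_nonneg_left (pow_le_pow_left₀ p0 hj.le 2) hc.le
  have h3 := norm_sub_le_norm_sub_add_norm_sub (Ks (j + 1)) (greedy A B R P') (greedy A B R P)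
  nlinarith

lemma converges (h : IsInexactIteration A B W R K0 runs) (hw : Weights W R r)
    (hPs : P.PosSemidef) (hP : P = evalStep A B W R (greedy A B R P) P)
    (hK : Schur (A - B * greedy A B R P)) :
    ∀ η > 0, ∃ J k₁, ∀ k ≥ k₁, ∀ Ks ∈ runs k, ∀ j ≥ J, ‖Ks j - greedy A B R P‖ < η := by
  intro η hη
  obtain ⟨Kx, Px, h0, hx⟩ := exists_isPolicyIteration hw h.schur_zero
  have hlim := (tendsto_iff_norm_sub_tendsto_zero (E := Matrix κ ι ℝ)).1 (hx.tendsto hw hPs hP hK)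
  obtain ⟨η₀, hη₀, hinv⟩ := h.invariant hw hP hK
  set η' := min η η₀ with hη'
  have hη'0 : 0 < η' := by positivity
  obtain ⟨J, hJ⟩ := (hlim.eventually_lt_const (half_pos hη'0)).exists
  obtain ⟨k1, hk1⟩ := hinv η' hη'0 (min_le_right _ _)
  obtain ⟨k2, hk2⟩ := h.near_exact hw hx h0 J (η' / 2) (half_pos hη'0)
  refine ⟨J, max k1 k2, fun k hk Ks hKs j hj => ?_⟩
  refine lt_of_lt_of_le ?_ (min_le_left η η₀)
  rw [← hη']
  induction j, hj using Nat.le_induction with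
  | base =>
    have h1 := hk2 k ((le_max_right _ _).trans hk) Ks hKs J le_rfl
    have h2 := norm_sub_le_norm_sub_add_norm_sub (Ks J) (Kx J) (greedy A B R P)
    linarith
  | succ j _ ih => exact hk1 k ((le_max_left _ _).trans hk) Ks hKs j ih

/-- A threshold below the gaps of the exact iteration stops the inexact one only near the optimal
gain. -/
lemma stops (h : IsInexactIteration A B W R K0 runs) (hw : Weights W R r)
    (hPs : P.PosSemidef) (hP : P = evalStep A B W R (greedy A B R P) P)
    (hK : Schur (A - B * greedy A B R P)) :
    ∀ η > 0, ∃ ε₀ > 0, ∀ ε : ℝ, 0 < ε → ε ≤ ε₀ → ∃ k₁, ∀ k ≥ k₁, ∀ Ks ∈ runs k,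
      ∃ j, StopsAt ε Ks j ∧ ‖Ks (j + 1) - greedy A B R P‖ < η := by
  intro η hη
  obtain ⟨Kx, Px, h0, hx⟩ := exists_isPolicyIteration hw h.schur_zero
  obtain ⟨J, k1, hJ⟩ := h.converges hw hPs hP hK η hη
  have hgap : ∀ J : ℕ, ∃ ε₀ > 0, ∀ j < J, Kx (j + 1) ≠ Kx j → 2 * ε₀ ≤ ‖Kx (j + 1) - Kx j‖ := by
    intro J
    induction J with
    | zero => exact ⟨1, one_pos, fun j hj => absurd hj (Nat.not_lt_zero j)⟩
    | succ J ih =>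
      obtain ⟨ε₀, hε₀, hj⟩ := ih
      by_cases he : Kx (J + 1) = Kx J
      · refine ⟨ε₀, hε₀, fun j hlt hne => ?_⟩
        rcases Nat.lt_succ_iff_lt_or_eq.1 hlt with hlt | rfl
        · exact hj j hlt hne
        · exact absurd he hne
      · have hpos : 0 < ‖Kx (J + 1) - Kx J‖ := norm_pos_iff.2 (sub_ne_zero.2 he)
        refine ⟨min ε₀ (‖Kx (J + 1) - Kx J‖ / 2), by positivity, fun j hlt hne => ?_⟩
        rcases Nat.lt_succ_iff_lt_or_eq.1 hlt with hlt | rfl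
        · have := hj j hlt hne
          have := min_le_left ε₀ (‖Kx (J + 1) - Kx J‖ / 2)
          linarith
        · have := min_le_right ε₀ (‖Kx (j + 1) - Kx j‖ / 2)
          linarith
  -- a stationary exact iteration has reached the optimal gain
  have hstat : ∀ j, Kx (j + 1) = Kx j → Kx (j + 1) = greedy A B R P := by
    intro j he
    have hg : greedy A B R (Px j) = Kx j := by rw [← he, hx.improve]
    have hPx : Px j = P := hw.fixedPoint_unique (hx.posSemidef hw j)
      (by rw [hg]; exact hx.eval j) (by rw [hg]; exact hx.schur hw j) hPs hP hK
    rw [hx.improve, hPx]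
  obtain ⟨ε₀, hε₀, hgapJ⟩ := hgap J
  refine ⟨ε₀, hε₀, fun ε hε hle => ?_⟩
  obtain ⟨J', k2, hJ'⟩ := h.converges hw hPs hP hK (ε / 2) (half_pos hε)
  obtain ⟨k3, hk3⟩ := h.near_exact hw hx h0 J (min η (ε₀ / 4)) (by positivity)
  refine ⟨max k1 (max k2 k3), fun k hk Ks hKs => ?_⟩
  have hkk1 := (le_max_left _ _).trans hk
  have hkk2 := ((le_max_left _ _).trans (le_max_right _ _)).trans hk
  have hkk3 := ((le_max_right _ _).trans (le_max_right _ _)).trans hk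
  classical
  have hex : ∃ j, ‖Ks (j + 1) - Ks j‖ ≤ ε := by
    refine ⟨J', ?_⟩
    have q1 := hJ' k hkk2 Ks hKs J' le_rfl
    have q2 := hJ' k hkk2 Ks hKs (J' + 1) (Nat.le_succ _)
    have q3 := norm_sub_le_norm_sub_add_norm_sub (Ks (J' + 1)) (greedy A B R P) (Ks J')
    rw [norm_sub_rev (greedy A B R P)] at q3
    linarith
  refine ⟨Nat.find hex, ⟨Nat.find_spec hex, fun i hi => not_le.1 (Nat.find_min hex hi)⟩, ?_⟩
  have hspec := Nat.find_spec hex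
  set j := Nat.find hex
  rcases le_or_gt J (j + 1) with hj | hj
  · exact hJ k hkk1 Ks hKs (j + 1) hj
  · have q1 := hk3 k hkk3 Ks hKs j (by omega)
    have q2 := hk3 k hkk3 Ks hKs (j + 1) hj.le
    obtain ⟨-, q3⟩ := lt_min_iff.1 q1
    obtain ⟨q4, q5⟩ := lt_min_iff.1 q2
    have he : Kx (j + 1) = Kx j := by
      by_contra hne
      have h1 := hgapJ j (by omega) hne
      have h2 := norm_sub_le_norm_sub_add_norm_sub (Kx (j + 1)) (Ks (j + 1)) (Kx j)
      have h3 := norm_sub_le_norm_sub_add_norm_sub (Ks (j + 1)) (Ks j) (Kx j)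
      rw [norm_sub_rev (Kx (j + 1)) (Ks (j + 1))] at h2
      linarith
    rwa [hstat j he] at q4

end IsInexactIteration

end Inexact

/-! ### Convergence of the learning algorithm -/

section ZetaSystem

variable {ι κ o ζ : Type*} [Fintype ι] [DecidableEq ι] [Fintype κ] [DecidableEq κ] [Fintype o]
  [Fintype ζ] [DecidableEq ζ]
  {A : Matrix ι ι ℝ} {B : Matrix ι κ ℝ} {G : Matrix ι o ℝ} {C : Matrix o ι ℝ} {L : Matrix ι o ℝ}
  {Φ : Matrix ζ ζ ℝ} {bu : Matrix ζ κ ℝ} {bY : Matrix ζ o ℝ} {bt : Matrix ζ o ℝ} {M : Matrix ι ζ ℝ}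

namespace IsReconstructor

omit [Fintype κ] [DecidableEq κ] in
lemma mul_zeta (h : IsReconstructor A B G C L Φ bu bY bt M) :
    M * (Φ + bY * (C * M)) = A * M := by
  rw [Matrix.mul_add, h.mul_filter, ← Matrix.mul_assoc M bY, h.mul_bY, Matrix.sub_mul,
    ← Matrix.mul_assoc]
  abel

/-- The Riccati gain of the filter system is `K M`, for the value matrix `Mᵀ P M`. -/
lemma greedy_zeta (h : IsReconstructor A B G C L Φ bu bY bt M) (R : Matrix κ κ ℝ)
    (P : Matrix ι ι ℝ) :
    greedy (Φ + bY * (C * M)) bu R (Mᵀ * P * M) = greedy A B R P * M := by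
  have e1 : buᵀ * (Mᵀ * P * M) = Bᵀ * P * M := by
    rw [← h.mul_bu, Matrix.transpose_mul]; simp only [Matrix.mul_assoc]
  rw [greedy, greedy, e1, Matrix.mul_assoc (Bᵀ * P) M bu, h.mul_bu, Matrix.mul_assoc _ buᵀ, e1,
    Matrix.mul_assoc _ (Bᵀ * P * M), Matrix.mul_assoc (Bᵀ * P) M, h.mul_zeta]
  simp only [Matrix.mul_assoc]

omit [DecidableEq κ] in
lemma evalStep_zeta (h : IsReconstructor A B G C L Φ bu bY bt M) (Q : Matrix o o ℝ)
    (R : Matrix κ κ ℝ) (K : Matrix κ ι ℝ) (P : Matrix ι ι ℝ) :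
    evalStep (Φ + bY * (C * M)) bu ((C * M)ᵀ * Q * (C * M)) R (K * M) (Mᵀ * P * M) =
      Mᵀ * evalStep A B (Cᵀ * Q * C) R K P * M := by
  have e : M * (Φ + bY * (C * M) - bu * (K * M)) = (A - B * K) * M := by
    rw [Matrix.mul_sub, h.mul_zeta, ← Matrix.mul_assoc M bu, h.mul_bu, Matrix.sub_mul,
      Matrix.mul_assoc B]
  set T := Φ + bY * (C * M) - bu * (K * M)
  have e1 : Tᵀ * (Mᵀ * P * M) * T = Mᵀ * ((A - B * K)ᵀ * P * (A - B * K)) * M := by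
    calc Tᵀ * (Mᵀ * P * M) * T = (M * T)ᵀ * P * (M * T) := by
          rw [Matrix.transpose_mul]; simp only [Matrix.mul_assoc]
      _ = _ := by rw [e, Matrix.transpose_mul]; simp only [Matrix.mul_assoc]
  rw [evalStep, evalStep, e1]
  simp only [Matrix.transpose_mul, Matrix.mul_add, Matrix.add_mul, Matrix.mul_assoc]

end IsReconstructor

end ZetaSystem

namespace Sys

variable {n m p q d : ℕ} {s : Sys n m p q d} {Q : Matrix (Fin p) (Fin p) ℝ}
  {Rb : Matrix (Fin m) (Fin m) ℝ} {c : Fin (n + d * p) → ℝ}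
  {P : Matrix (RIdx n p d) (RIdx n p d) ℝ} {ru : ℝ} {L : Matrix (RIdx n p d) (Fin p) ℝ}

/-- The gain sequences that the algorithm produces from data collected from the time `k` on. -/
def learningRuns (s : Sys n m p q d) (Q : Matrix (Fin p) (Fin p) ℝ) (Rb : Matrix (Fin m) (Fin m) ℝ)
    (c : Fin (n + d * p) → ℝ) (L : Matrix (RIdx n p d) (Fin p) ℝ)
    (K0 : Matrix (Fin m) (RIdx n p d) ℝ) (x₀ : Fin n → ℝ) (z₀ : Fin d × Fin p → ℝ) (σ b : ℝ)
    (k : ℕ) : Set (ℕ → Matrix (Fin m) (ZIdx m p (n + d * p)) ℝ) :=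
  {K | ∃ (w : Signals n m p d) (N : ℕ), s.IsBehaviorRun c K0 x₀ z₀ w ∧ w.RankCondition k N ∧
    Conditioned σ b (w.dataMatrix k N) ∧ s.IsIteration Q Rb w k N (K0 * s.paramMatrix L) K}

/-- The state matrix of the filters when the measured output is replaced by the reconstructed one. -/
noncomputable def zetaMat (s : Sys n m p q d) (c : Fin (n + d * p) → ℝ)
    (L : Matrix (RIdx n p d) (Fin p) ℝ) :
    Matrix (ZIdx m p (n + d * p)) (ZIdx m p (n + d * p)) ℝ :=
  filterMat m p c + inputY m p (n + d * p) * (s.Caug * s.paramMatrix L)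

/-- The reconstruction error of a run with given initial state and zero initial filter states has a
uniformly vanishing square sum from the time `k` on. -/
lemma exists_error_sum_le (hc : Schur (companion c))
    (hL : (s.Aaug - L * s.Caug).charpoly = (companion c).charpoly)
    (K0 : Matrix (Fin m) (RIdx n p d) ℝ) (x₀ : Fin n → ℝ) (z₀ : Fin d × Fin p → ℝ) :
    ∀ η > 0, ∃ κ, ∀ k ≥ κ, ∀ w : Signals n m p d, s.IsBehaviorRun c K0 x₀ z₀ w → ∀ T,
      ∑ t ∈ Finset.range T, (w.r (k + t) - s.paramMatrix L *ᵥ w.zeta (k + t)) ⬝ᵥ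
        (w.r (k + t) - s.paramMatrix L *ᵥ w.zeta (k + t)) ≤ η := by
  intro η hη
  have hrec := s.isReconstructor hc hL
  obtain ⟨a, ha, hsum⟩ := hrec.schur_observer.exists_sum_le
  have hlim := tendsto_quadratic (hrec.schur_observer.tendsto_pow_mulVec (Sum.elim x₀ z₀)) 1
  obtain ⟨κ, hκ⟩ := eventually_atTop.1 (hlim.eventually_lt_const (show 0 < η / a by positivity))
  refine ⟨κ, fun k hk w hw T => ?_⟩
  obtain ⟨hob, rfl, rfl, hz0, -⟩ := hw
  have herr := hrec.error_eq hob.r_succ hob.zeta_succ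
  have h1 := hsum (fun t => w.r (k + t) - s.paramMatrix L *ᵥ w.zeta (k + t)) (fun _ => 0)
    (fun t => by
      rw [← Nat.add_assoc, herr (k + t + 1), herr (k + t), pow_succ_mulVec, add_zero]) T
  refine h1.trans ?_
  simp only [add_zero, zero_dotProduct, Finset.sum_const_zero]
  rw [herr k, hz0, Matrix.mulVec_zero, sub_zero]
  have h2 := hκ k hk
  rw [Matrix.one_mulVec, lt_div_iff₀ ha] at h2
  rw [mul_comm]
  exact h2.le

/-- The algorithm is an inexact policy iteration for the filter system: the later the data are
collected, the smaller the influence of the reconstruction error. -/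
lemma isInexactIteration (hw : Weights (s.Caugᵀ * Q * s.Caug) Rb ru) (hQ : Q.PosSemidef)
    (hc : Schur (companion c)) (hL : (s.Aaug - L * s.Caug).charpoly = (companion c).charpoly)
    {K0 : Matrix (Fin m) (RIdx n p d) ℝ} (hK0 : Schur (s.Aaug - s.Baug * K0)) (x₀ : Fin n → ℝ)
    (z₀ : Fin d × Fin p → ℝ) {σ : ℝ} (hσ : 0 < σ) (b : ℝ) :
    IsInexactIteration (s.zetaMat c L) (inputU m p (n + d * p))
      ((s.Caug * s.paramMatrix L)ᵀ * Q * (s.Caug * s.paramMatrix L)) Rb (K0 * s.paramMatrix L)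
      (s.learningRuns Q Rb c L K0 x₀ z₀ σ b) where
  schur_zero := (s.isReconstructor hc hL).schur_zeta hK0
  zero := by
    rintro k K ⟨w, N, -, -, -, h, -⟩
    exact h
  step := by
    intro Kb hKb
    have hwz : Weights ((s.Caug * s.paramMatrix L)ᵀ * Q * (s.Caug * s.paramMatrix L)) Rb ru :=
      ⟨posSemidef_output hQ, hw.symm, hw.coercive⟩
    obtain ⟨δ, hδ, hest⟩ := exists_gain_estimate hwz hKb (inputTh m p (n + d * p))
    refine ⟨δ, hδ, fun η hη => ?_⟩
    set card := (Fintype.card (JointIdx m p (n + d * p)) : ℝ) with hcard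
    have hcard0 : 0 ≤ card := Nat.cast_nonneg _
    obtain ⟨t, ht, hgain⟩ := hest (σ ^ 2 / (card ^ 2 + 1)) (by positivity) (card * |b|)
      (by positivity) η hη
    set a := ‖inputY m p (n + d * p) * s.Caug‖ ^ 2 + ‖s.Caug‖ ^ 2 with ha
    obtain ⟨κ, hκ⟩ := exists_error_sum_le hc hL K0 x₀ z₀ (t / (a + 1)) (by positivity)
    refine ⟨κ, ?_⟩
    rintro k hk K ⟨w, N, hrun, hrank, hcond, -, hiter⟩ j hj
    obtain ⟨Lj, hLj, hK⟩ := hiter j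
    rw [hK]
    set ω : ℕ → RIdx n p d → ℝ := fun i => w.r (k + i) - s.paramMatrix L *ᵥ w.zeta (k + i) with hω
    have hr : ∀ i, w.r (k + i) = s.paramMatrix L *ᵥ w.zeta (k + i) + ω i := fun i =>
      (add_sub_cancel _ _).symm
    have hy : ∀ i, s.C *ᵥ w.x (k + i) =
        (s.Caug * s.paramMatrix L) *ᵥ w.zeta (k + i) + s.Caug *ᵥ ω i := by
      intro i
      rw [← s.Caug_mulVec_r, hr, Matrix.mulVec_add, Matrix.mulVec_mulVec]
    -- the reconstruction error `ω` enters the filters through `y` and the cost through `C ω`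
    refine hgain (K j) hj N (fun i => w.zeta (k + i)) (fun i => w.zeta (k + i + 1))
      (fun i => w.u (k + i)) (fun i => w.th (k + i)) (fun i => s.C *ᵥ w.x (k + i))
      (fun i => (inputY m p (n + d * p) * s.Caug) *ᵥ ω i) (fun i => s.Caug *ᵥ ω i) ?_ ?_ ?_ hy ?_ Lj
      hLj.1 hLj.2
    · intro H hH
      have h1 := w.norm_sq_le_sum hrank hcond hH
      rw [div_mul_eq_mul_div, div_le_iff₀ (by positivity)]
      refine h1.trans ?_
      rw [mul_comm]
      exact mul_le_mul_of_nonneg_left (by linarith)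
        (Finset.sum_nonneg fun _ _ => sq_nonneg _)
    · intro i hi
      refine (w.jointAt_dotProduct_self_le hcond hi).trans ?_
      exact mul_le_mul_of_nonneg_left (le_abs_self b) hcard0
    · intro i
      rw [hrun.1.zeta_succ, hr, zetaMat]
      simp only [Matrix.mulVec_add, Matrix.add_mulVec, Matrix.mulVec_mulVec]
      abel
    · have h1 := hκ k hk w hrun N
      have h2 : ∀ i, ((inputY m p (n + d * p) * s.Caug) *ᵥ ω i) ⬝ᵥ
          ((inputY m p (n + d * p) * s.Caug) *ᵥ ω i) + (s.Caug *ᵥ ω i) ⬝ᵥ (s.Caug *ᵥ ω i) ≤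
          a * (ω i ⬝ᵥ ω i) := by
        intro i
        have p1 := mulVec_dotProduct_self_le (inputY m p (n + d * p) * s.Caug) (ω i)
        have p2 := mulVec_dotProduct_self_le s.Caug (ω i)
        rw [ha]; linarith
      refine (Finset.sum_le_sum fun i _ => h2 i).trans ?_
      rw [← Finset.mul_sum]
      have ha0 : 0 ≤ a := by positivity
      refine (mul_le_mul_of_nonneg_left h1 ha0).trans ?_
      rw [mul_div_assoc', div_le_iff₀ (by positivity)]
      linarith

/-- The optimal gain of the filter system is `K M`. -/
lemma IsOptimalValue.zeta (h : s.IsOptimalValue Q Rb P) (hc : Schur (companion c))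
    (hL : (s.Aaug - L * s.Caug).charpoly = (companion c).charpoly) :
    greedy (s.zetaMat c L) (inputU m p (n + d * p)) Rb
        ((s.paramMatrix L)ᵀ * P * s.paramMatrix L) = s.lqrGain Rb P * s.paramMatrix L ∧
      ((s.paramMatrix L)ᵀ * P * s.paramMatrix L).PosSemidef ∧
      (s.paramMatrix L)ᵀ * P * s.paramMatrix L = evalStep (s.zetaMat c L)
        (inputU m p (n + d * p)) ((s.Caug * s.paramMatrix L)ᵀ * Q * (s.Caug * s.paramMatrix L)) Rb
        (s.lqrGain Rb P * s.paramMatrix L) ((s.paramMatrix L)ᵀ * P * s.paramMatrix L) ∧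
      Schur (s.zetaMat c L - inputU m p (n + d * p) * (s.lqrGain Rb P * s.paramMatrix L)) := by
  have hrec := s.isReconstructor hc hL
  refine ⟨hrec.greedy_zeta Rb P, posSemidef_output h.posSemidef, ?_, hrec.schur_zeta h.schur⟩
  rw [zetaMat, hrec.evalStep_zeta]
  exact congrArg (fun X => (s.paramMatrix L)ᵀ * X * s.paramMatrix L) h.fixed

end Sys

end OutputTracking

theorem theorem3 {n m p q d : ℕ} (s : OutputTracking.Sys n m p q d)
    (Q : Matrix (Fin p) (Fin p) ℝ) (Rb : Matrix (Fin m) (Fin m) ℝ)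
    (c : Fin (n + d * p) → ℝ)
    -- controllability and observability of the plant
    (hctrb : OutputTracking.Controllable s.A s.B)
    (hobsv : OutputTracking.Observable s.A s.C)
    -- eigenvalues of `S` on or outside the unit circle
    (hS : ∀ μ ∈ OutputTracking.cspec s.S, 1 ≤ ‖μ‖)
    -- the transmission-zero condition
    (hrank : ∀ μ ∈ OutputTracking.cspec s.S,
      (Matrix.fromBlocks
        (s.A.map (algebraMap ℝ ℂ) - μ • (1 : Matrix (Fin n) (Fin n) ℂ))
        (s.B.map (algebraMap ℝ ℂ)) (s.C.map (algebraMap ℝ ℂ))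
        (0 : Matrix (Fin p) (Fin m) ℂ)).rank = n + p)
    -- design of the controller, of the weights and of the filters
    (hFG : OutputTracking.IsInternalModel s.S s.F s.G)
    (hmp : m ≤ p) (hFT : OutputTracking.Observable s.F s.T)
    (hQ : Q.PosDef) (hR : Rb.PosDef)
    (hc : OutputTracking.Schur (OutputTracking.companion c)) :
    ∃ P : Matrix (OutputTracking.RIdx n p d) (OutputTracking.RIdx n p d) ℝ,
      -- the Riccati equation and the optimal gain
      (P.PosSemidef ∧ s.ARE Q Rb P ∧
        ∀ P' : Matrix (OutputTracking.RIdx n p d) (OutputTracking.RIdx n p d) ℝ,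
          P'.PosSemidef → s.ARE Q Rb P' → P' = P) ∧
      s.SolvesProblem Q Rb (s.lqrGain Rb P) ∧
      (∀ K, s.SolvesProblem Q Rb K → K = s.lqrGain Rb P) ∧
      -- the observer gains behind the parameterization matrix
      (∃ L : Matrix (OutputTracking.RIdx n p d) (Fin p) ℝ,
        (s.Aaug - L * s.Caug).charpoly = (OutputTracking.companion c).charpoly) ∧
      ∀ L : Matrix (OutputTracking.RIdx n p d) (Fin p) ℝ,
        (s.Aaug - L * s.Caug).charpoly = (OutputTracking.companion c).charpoly →
        -- state reconstruction
        (∀ w : OutputTracking.Signals n m p d, s.Obeys c w →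
          ∀ k, w.r k = s.paramMatrix L *ᵥ w.zeta k +
            (s.Aaug - L * s.Caug) ^ k *ᵥ (w.r 0 - s.paramMatrix L *ᵥ w.zeta 0)) ∧
        ∃ γ : ℝ, 0 ≤ γ ∧
          -- the controller with the limit gain
          (∃ X : Matrix (OutputTracking.RIdx n p d) (Fin q) ℝ,
            s.Tracks Q Rb c P (s.paramMatrix L) (s.lqrGain Rb P * s.paramMatrix L)
              X (-(s.lqrGain Rb P * X)) γ 0) ∧
          -- controllers whose gain is close to the limit gain
          (∀ η > 0, ∃ δ > 0, ∀ Kh : Matrix (Fin m) (OutputTracking.ZIdx m p (n + d * p)) ℝ,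
            ‖Kh - s.lqrGain Rb P * s.paramMatrix L‖ < δ →
            ∃ (X : Matrix (OutputTracking.RIdx n p d) (Fin q) ℝ) (U : Matrix (Fin m) (Fin q) ℝ),
              s.Tracks Q Rb c P (s.paramMatrix L) Kh X U γ η) ∧
          -- learning
          ∀ K0 : Matrix (Fin m) (OutputTracking.RIdx n p d) ℝ,
            OutputTracking.Schur (s.Aaug - s.Baug * K0) →
            ∀ (x₀ : Fin n → ℝ) (z₀ : Fin d × Fin p → ℝ) (σ b : ℝ), 0 < σ → ∀ η > 0,
              -- the iterated gains converge to the ideal gain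
              (∃ J κ : ℕ, ∀ (w : OutputTracking.Signals n m p d) (k₀ N : ℕ),
                s.IsBehaviorRun c K0 x₀ z₀ w → κ ≤ k₀ → w.RankCondition k₀ N →
                OutputTracking.Conditioned σ b (w.dataMatrix k₀ N) →
                ∀ K, s.IsIteration Q Rb w k₀ N (K0 * s.paramMatrix L) K →
                  ∀ j ≥ J, ‖K j - s.lqrGain Rb P * s.paramMatrix L‖ < η) ∧
              -- the algorithm stops, and the controller with the returned gain tracks
              (∃ ε₀ > 0, ∀ ε : ℝ, 0 < ε → ε ≤ ε₀ →
                ∃ κ : ℕ, ∀ (w : OutputTracking.Signals n m p d) (k₀ N : ℕ),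
                s.IsBehaviorRun c K0 x₀ z₀ w → κ ≤ k₀ → w.RankCondition k₀ N →
                OutputTracking.Conditioned σ b (w.dataMatrix k₀ N) →
                ∀ K, s.IsIteration Q Rb w k₀ N (K0 * s.paramMatrix L) K →
                  ∃ j, OutputTracking.StopsAt ε K j ∧
                    ‖K (j + 1) - s.lqrGain Rb P * s.paramMatrix L‖ < η ∧
                    ∃ (X : Matrix (OutputTracking.RIdx n p d) (Fin q) ℝ)
                      (U : Matrix (Fin m) (Fin q) ℝ),
                      s.Tracks Q Rb c P (s.paramMatrix L) (K (j + 1)) X U γ η) := by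
  obtain ⟨ru, hru⟩ := hR.exists_coercive
  obtain ⟨rq, hrq⟩ := hQ.exists_coercive
  have hw : OutputTracking.Weights (s.Caugᵀ * Q * s.Caug) Rb ru :=
    ⟨OutputTracking.posSemidef_output hQ.posSemidef,
      (OutputTracking.posSemidef_iff_real.1 hR.posSemidef).1, hru⟩
  have hobs := OutputTracking.Sys.pairObservable hobsv hrank hFG hmp hFT
  have hctr := OutputTracking.Sys.pairObservable_transpose hctrb hrank hFG
  obtain ⟨Ks, hKs⟩ := OutputTracking.Sys.exists_stabilizing_gain hctr hc
  obtain ⟨P, hP⟩ := OutputTracking.Sys.exists_isOptimalValue hw hrq hobs hKs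
  obtain ⟨L₀, hL₀⟩ := OutputTracking.Sys.exists_observer_gain hobs c
  refine ⟨P, ⟨hP.posSemidef, (hw.riccati_iff hP.posSemidef).2 hP.fixed,
    fun P' hP' hA => hP.eq_of_are hw hrq hobs hP' hA⟩,
    hP.solvesProblem hw hrq (hc.of_charpoly_eq hL₀), fun K hK => hP.eq_of_solvesProblem hw hK,
    ⟨L₀, hL₀⟩, fun L hL => ⟨fun w hob k => ?_, ?_⟩⟩
  · rw [← (s.isReconstructor hc hL).error_eq hob.r_succ hob.zeta_succ k, add_sub_cancel]
  obtain ⟨γ, hγ, hlimit, hnear⟩ := hP.exists_tracks hw hS hFG hc hL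
  refine ⟨γ, hγ, hlimit, hnear, fun K0 hK0 x₀ z₀ σ b hσ η hη => ?_⟩
  have hwz : OutputTracking.Weights
      ((s.Caug * s.paramMatrix L)ᵀ * Q * (s.Caug * s.paramMatrix L)) Rb ru :=
    ⟨OutputTracking.posSemidef_output hQ.posSemidef, hw.symm, hw.coercive⟩
  have hit := OutputTracking.Sys.isInexactIteration hw hQ.posSemidef hc hL hK0 x₀ z₀ hσ b
  obtain ⟨hg, hPs, hfix, hsch⟩ := hP.zeta hc hL
  rw [← hg] at hfix hsch
  refine ⟨?_, ?_⟩
  · obtain ⟨J, κ, h⟩ := hit.converges hwz hPs hfix hsch η hη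
    rw [hg] at h
    exact ⟨J, κ, fun w k₀ N hrun hk hrk hcond K hK => h k₀ hk K ⟨w, N, hrun, hrk, hcond, hK⟩⟩
  · obtain ⟨δ, hδ, htr⟩ := hnear η hη
    obtain ⟨ε₀, hε₀, h⟩ := hit.stops hwz hPs hfix hsch (min η δ) (lt_min hη hδ)
    rw [hg] at h
    refine ⟨ε₀, hε₀, fun ε hε hle => ?_⟩
    obtain ⟨κ, hκ⟩ := h ε hε hle
    refine ⟨κ, fun w k₀ N hrun hk hrk hcond K hK => ?_⟩
    obtain ⟨j, hj, hlt⟩ := hκ k₀ hk K ⟨w, N, hrun, hrk, hcond, hK⟩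
    exact ⟨j, hj, hlt.trans_le (min_le_left _ _), htr _ (hlt.trans_le (min_le_right _ _))⟩
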